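/- Boolean formulas over $x_1,\dots,x_d$ have AND and OR gates of arbitrary fan-in and NOT gates; the size is the number of leaves (occurrences of variables), and the depth is the largest number of AND/OR gates on a root-to-leaf path (negations are not counted). Let $\mathcal C_{d,s,\ell}$ be the class of functions $\{\pm1\}^d\to\{\pm1\}$ computed by Boolean formulas of size at most $s$ and depth at most $\ell$, and let $\mathcal D_d$ be the uniform distribution on $\{\pm1\}^d$. Logarithms are natural. There is a universal constant $C>0$ such that the following two statements hold. 1. ($\mathcal L_2$-sandwiching degree.) For all integers $d,s,\ell\ge 0$ and all real $\varepsilon>0$ with $s\ge 2\varepsilon$, and for every $f\in\mathcal C_{d,s,\ell}$, there are multilinear real polynomials $p_{\rm up},p_{\rm down}$ in $d$ variables, of degree at most $\sqrt s\,(C\log(s/\varepsilon))^{5\ell/2}$, such that $p_{\rm down}(x)\le f(x)\le p_{\rm up}(x)$ for all $x\in\{\pm1\}^d$ and $\mathbb E_{x\sim\mathcal D_d}[(p_{\rm up}(x)-p_{\rm down}(x))^2]\le\varepsilon$. 2. (Agnostic TDS learning.) There are a single deterministic algorithm $\mathcal A$ and a universal constant $K>0$ such that, for all integers $d\ge2$,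 $s\ge 1$, $\ell\ge1$ and all real $\varepsilon\in(0,1)$ with $s\ge2\varepsilon$, the following holds with $$T=d^{\sqrt s\,(C\log(s/\varepsilon))^{5\ell/2}} .$$ $\mathcal A$ is given $d,s,\ell,\lceil1/\varepsilon\rceil$, a set $S$ of $m$ labelled examples in $\{\pm1\}^d\times\{\pm1\}$ and a set $U$ of $n$ unlabelled examples in $\{\pm1\}^d$. There is a number $M\le T$ such that, for all $m,n\ge M$: - (Running time.) On all $S,U$, the algorithm $\mathcal A$ makes at most $T$ steps (on a unit-cost random access machine with addition and subtraction, and with random access to the samples) and then either rejects, or accepts and outputs a hypothesis $h:\{\pm1\}^d\to\{\pm1\}$, which can be evaluated at any given point within $T$ further steps. - Let $P,Q$ be any probability distributions on $\{\pm1\}^d\times\{\pm1\}$ such that $P$ has marginal $\mathcal D_d$ on $\{\pm1\}^d$, let $\mathrm{err}(f;P)=\Pr_{(x,y)\sim P}[y\ne f(x)]$ and $\lambda=\min_{f\in\mathcal C_{d,s,\ell}}\big(\mathrm{err}(f;P)+\mathrm{err}(f;Q)\big)$, let $S$ consist of $m$ independent draws from $P$, and let $U$ consist of $n$ independent draws from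 the marginal of $Q$ on $\{\pm1\}^d$, independent of $S$. Then: - (Soundness.) With probability at least $0.9$ over $(S,U)$: if $\mathcal A$ accepts, its output $h$ satisfies $\mathrm{err}(h;Q)\le32\lambda+K\varepsilon$. - (Completeness.) If the marginal of $Q$ on $\{\pm1\}^d$ is $\mathcal D_d$, then $\mathcal A$ accepts with probability at least $0.9$ over $(S,U)$. -/

import Mathlib

open MeasureTheory

/-! ## The hypercube, concepts and errors -/

/-- The hypercube `{±1}^d`; the Boolean `true` stands for `+1` and `false` for `-1`
(see `sgn`). -/
abbrev Cube (d : ℕ) : Type := Fin d → Bool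

/-- The sign in `{±1}` that a Boolean stands for. -/
def sgn (b : Bool) : ℤ := if b then 1 else -1

/-- The uniform distribution on the hypercube. -/
noncomputable def uniformCube (d : ℕ) : Measure (Cube d) :=
  (PMF.uniformOfFintype (Cube d)).toMeasure

/-- `err(h; P) = Pr_{(x, y) ∼ P} [y ≠ h(x)]`. -/
noncomputable def err {d : ℕ} (h : Cube d → Bool) (P : Measure (Cube d × Bool)) : ℝ :=
  P.real {z | z.2 ≠ h z.1}

/-- The optimal common error
`λ = min_{f ∈ 𝒞} (err(f; P) + err(f; Q))`; the infimum of a non-empty class is attained, because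
there are only finitely many functions on the cube. -/
noncomputable def optCommon {d : ℕ} (𝒞 : Set (Cube d → Bool))
    (P Q : Measure (Cube d × Bool)) : ℝ :=
  ⨅ f : 𝒞, (err f.1 P + err f.1 Q)

/-! ## Boolean formulas -/

/-- Boolean formulas over `d` variables with AND and OR gates of arbitrary fan-in and NOT gates. -/
inductive BoolFormula (d : ℕ) : Type
  | var (i : Fin d) : BoolFormula d
  | not (F : BoolFormula d) : BoolFormula d
  | and (n : ℕ) (F : Fin n → BoolFormula d) : BoolFormula d
  | or (n : ℕ) (F : Fin n → BoolFormula d) : BoolFormula d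

namespace BoolFormula

/-- The value of a formula at a point of the cube. -/
def eval {d : ℕ} (x : Cube d) : BoolFormula d → Bool
  | var i => x i
  | not F => !(F.eval x)
  | and _ F => decide (∀ i, (F i).eval x = true)
  | or _ F => decide (∃ i, (F i).eval x = true)

/-- The size of a formula: the number of its leaves, that is, of occurrences of variables. -/
def size {d : ℕ} : BoolFormula d → ℕ
  | var _ => 1
  | not F => F.size
  | and _ F => ∑ i, (F i).size
  | or _ F => ∑ i, (F i).size

/-- The depth of a formula: the largest number of AND / OR gates on a path from the root to a
leaf. Negations are not counted (they can be pushed to the leaves). -/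
def depth {d : ℕ} : BoolFormula d → ℕ
  | var _ => 0
  | not F => F.depth
  | and _ F => (Finset.univ.sup fun i => (F i).depth) + 1
  | or _ F => (Finset.univ.sup fun i => (F i).depth) + 1

end BoolFormula

/-- The functions on the cube computed by Boolean formulas of size at most `s` and depth at most
`l`. -/
def formulaClass (d s l : ℕ) : Set (Cube d → Bool) :=
  {f | ∃ F : BoolFormula d, F.size ≤ s ∧ F.depth ≤ l ∧ ∀ x, f x = F.eval x}

/-! ## `L₂`-sandwiching -/

/-- The value of a polynomial at a point of `{±1}^d`. -/
noncomputable def cubeEval {d : ℕ} (p : MvPolynomial (Fin d) ℝ) (x : Cube d) : ℝ :=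
  MvPolynomial.eval (fun i => (sgn (x i) : ℝ)) p

/-- `pUp` and `pDown` are `ε`-approximate `L₂`-sandwiching polynomials for `f` under `D`. -/
def IsL2Sandwiching {d : ℕ} (D : Measure (Cube d)) (ε : ℝ) (f : Cube d → Bool)
    (pUp pDown : MvPolynomial (Fin d) ℝ) : Prop :=
  (∀ x, cubeEval pDown x ≤ (sgn (f x) : ℝ) ∧ (sgn (f x) : ℝ) ≤ cubeEval pUp x) ∧
    ∫ x, (cubeEval pUp x - cubeEval pDown x) ^ 2 ∂D ≤ ε

/-- The `ε`-approximate `L₂`-sandwiching degree of the class `𝒞` under `D` is at most `k`.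
Polynomials on the cube are taken in their multilinear form. -/
def L2SandwichingDegreeLE {d : ℕ} (𝒞 : Set (Cube d → Bool)) (D : Measure (Cube d))
    (ε k : ℝ) : Prop :=
  ∀ f ∈ 𝒞, ∃ pUp pDown : MvPolynomial (Fin d) ℝ,
    IsL2Sandwiching D ε f pUp pDown ∧
    (∀ i, pUp.degreeOf i ≤ 1) ∧ (∀ i, pDown.degreeOf i ≤ 1) ∧
    (pUp.totalDegree : ℝ) ≤ k ∧ (pDown.totalDegree : ℝ) ≤ k

/-! ## A random access machine with a step count

Structured programs over integer registers and an integer-indexed memory. Addition and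
subtraction are the only arithmetic operations, so that after `t` steps all numbers have
at most `O(t)` bits more than those in the input: the unit-cost step count is polynomially related
to the running time of a Turing machine. -/

/-- Register contents and memory contents. -/
structure RamState : Type where
  reg : ℕ → ℤ
  mem : ℤ → ℤ

/-- The read-only input of a program: numbered tables of integers with random access. -/
abbrev RamInput : Type := ℕ → ℤ → ℤ → ℤ

/-- Programs. The natural numbers `r a b i j` are names of registers. -/
inductive Cmd : Type
  /-- `r := c`. -/
  | const (r : ℕ) (c : ℤ) : Cmd
  /-- `r := a + b`. -/
  | add (r a b : ℕ) : Cmd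
  /-- `r := a - b`. -/
  | sub (r a b : ℕ) : Cmd
  /-- `r := mem[a]`. -/
  | load (r a : ℕ) : Cmd
  /-- `mem[a] := r`. -/
  | store (a r : ℕ) : Cmd
  /-- `r :=` the entry in row `i` and column `j` of the input table number `t`. -/
  | read (r t i j : ℕ) : Cmd
  /-- First `p`, then `q`. -/
  | seq (p q : Cmd) : Cmd
  /-- If `r > 0` then `p`, else `q`. -/
  | branch (r : ℕ) (p q : Cmd) : Cmd
  /-- While `r > 0` do `p`. -/
  | loop (r : ℕ) (p : Cmd) : Cmd

namespace RamState

/-- Overwrite a register. -/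
def setReg (σ : RamState) (r : ℕ) (v : ℤ) : RamState :=
  { σ with reg := Function.update σ.reg r v }

/-- Overwrite a memory cell. -/
def setMem (σ : RamState) (a v : ℤ) : RamState :=
  { σ with mem := Function.update σ.mem a v }

end RamState

namespace Cmd

/-- One step of the machine. A configuration consists of the stack of commands that remain to be
executed and of the current state; the machine has halted when the stack is empty. -/
def step (I : RamInput) : List Cmd × RamState → List Cmd × RamState
  | ([], σ) => ([], σ)
  | (const r c :: k, σ) => (k, σ.setReg r c)
  | (add r a b :: k, σ) => (k, σ.setReg r (σ.reg a + σ.reg b))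
  | (sub r a b :: k, σ) => (k, σ.setReg r (σ.reg a - σ.reg b))
  | (load r a :: k, σ) => (k, σ.setReg r (σ.mem (σ.reg a)))
  | (store a r :: k, σ) => (k, σ.setMem (σ.reg a) (σ.reg r))
  | (read r t i j :: k, σ) => (k, σ.setReg r (I t (σ.reg i) (σ.reg j)))
  | (seq p q :: k, σ) => (p :: q :: k, σ)
  | (branch r p q :: k, σ) => (if 0 < σ.reg r then p :: k else q :: k, σ)
  | (loop r p :: k, σ) => (if 0 < σ.reg r then p :: loop r p :: k else k, σ)

/-- The configuration of the program `c` after `t` steps from the state `σ` on the input `I`. -/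
def run (I : RamInput) (c : Cmd) (σ : RamState) (t : ℕ) : List Cmd × RamState :=
  (step I)^[t] ([c], σ)

/-- The program halts after at most `t` steps. -/
def HaltsWithin (I : RamInput) (c : Cmd) (σ : RamState) (t : ℕ) : Prop :=
  (run I c σ t).1 = []

end Cmd

/-! ## Learners -/

/-- A learning algorithm: the program `learn` receives the samples and rejects, or accepts and
leaves a representation of its hypothesis in the registers and the memory; the program `predict`
then evaluates the hypothesis at a given point. -/
structure Learner : Type where
  learn : Cmd
  predict : Cmd

/-- The initial state: the numerical parameters in the first registers, everything else zero. -/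
def initState (params : List ℕ) : RamState where
  reg r := (params.getD r 0 : ℤ)
  mem _ := 0

/-- The entry of a list at an integer position, `none` when out of range. -/
def entry {α : Type} {m : ℕ} (v : Fin m → α) (i : ℤ) : Option α :=
  if h : 0 ≤ i ∧ i.toNat < m then some (v ⟨i.toNat, h.2⟩) else none

/-- The `j`-th coordinate in `{±1}` of a point of the cube, `0` when out of range. -/
def coordAt {d : ℕ} (x : Cube d) (j : ℤ) : ℤ := ((entry x j).map sgn).getD 0

/-- The input of `learn`: table `0` holds the points of the labelled training sample `S`, table `1`
(column `0`) their labels, table `2` the points of the unlabelled test sample `U`. Entries out of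
range are `0`. -/
def sampleInput {d m n : ℕ} (S : Fin m → Cube d × Bool) (U : Fin n → Cube d) : RamInput
  | 0, i, j => ((entry S i).map fun z => coordAt z.1 j).getD 0
  | 1, i, 0 => ((entry S i).map fun z => sgn z.2).getD 0
  | 2, i, j => ((entry U i).map fun x => coordAt x j).getD 0
  | _, _, _ => 0

/-- The input of `predict`: table `0` holds, in row `0`, the point to be classified. -/
def pointInput {d : ℕ} (x : Cube d) : RamInput
  | 0, 0, j => coordAt x j
  | _, _, _ => 0

namespace Learner

/-- The state of the learner after `t` steps on the samples `S` and `U`. -/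
def learned (A : Learner) (params : List ℕ) {d m n : ℕ}
    (S : Fin m → Cube d × Bool) (U : Fin n → Cube d) (t : ℕ) : RamState :=
  (Cmd.run (sampleInput S U) A.learn (initState params) t).2

/-- The learner accepts: register `0` is positive (the learner rejects otherwise). -/
def Accepts (A : Learner) (params : List ℕ) {d m n : ℕ}
    (S : Fin m → Cube d × Bool) (U : Fin n → Cube d) (t : ℕ) : Prop :=
  0 < (A.learned params S U t).reg 0

/-- The hypothesis `h : {±1}^d → {±1}` of the learner: its value at `x` is `+1` if `predict`, started
in the state in which `learn` ended, leaves a positive number in register `0`, and `-1` otherwise. -/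
def hypothesis (A : Learner) (params : List ℕ) {d m n : ℕ}
    (S : Fin m → Cube d × Bool) (U : Fin n → Cube d) (t : ℕ) : Cube d → Bool :=
  fun x => decide (0 < (Cmd.run (pointInput x) A.predict (A.learned params S U t) t).2.reg 0)

/-- Run with the given parameters, the algorithm `A` testably learns `𝒞` with distribution shift
with respect to `D`, up to error `ψ(λ) + ε` and with probability of failure `δ`, in time `t`:
whenever the two samples are large enough (`M` examples each suffice, for some `M ≤ t`), on all
samples `A` makes at most `t` steps until it rejects or accepts, and `t` steps to evaluate an
accepted hypothesis at a point; and it is sound and complete for independent samples from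
`P` and from the marginal of `Q`, for any training distribution `P` with marginal `D` and any test
distribution `Q`. -/
def TDSLearns (A : Learner) (params : List ℕ) {d : ℕ} (𝒞 : Set (Cube d → Bool))
    (D : Measure (Cube d)) (ψ : ℝ → ℝ) (ε δ : ℝ) (t : ℕ) : Prop :=
  ∃ M ≤ t, ∀ m n : ℕ, M ≤ m → M ≤ n →
    (∀ (S : Fin m → Cube d × Bool) (U : Fin n → Cube d),
      Cmd.HaltsWithin (sampleInput S U) A.learn (initState params) t ∧
      (A.Accepts params S U t →
        ∀ x : Cube d,
          Cmd.HaltsWithin (pointInput x) A.predict (A.learned params S U t) t)) ∧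
    ∀ P Q : Measure (Cube d × Bool), IsProbabilityMeasure P → IsProbabilityMeasure Q →
      P.map Prod.fst = D →
      (1 - δ ≤ ((Measure.pi fun _ : Fin m => P).prod
          (Measure.pi fun _ : Fin n => Q.map Prod.fst)).real
        {z | A.Accepts params z.1 z.2 t →
          err (A.hypothesis params z.1 z.2 t) Q ≤ ψ (optCommon 𝒞 P Q) + ε}) ∧
      (Q.map Prod.fst = D →
        1 - δ ≤ ((Measure.pi fun _ : Fin m => P).prod
            (Measure.pi fun _ : Fin n => Q.map Prod.fst)).real
          {z | A.Accepts params z.1 z.2 t})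

end Learner

/-! Both statements rest on one uniform approximation theorem, `BoolFormula.approx`: a formula of
size `S ≥ 1` and depth `l` is within `δ` in sup norm of a function of degree `√S · (16 ·
2^(5n/2))^l`, as soon as `S^20 ≤ δ · 2^(2^n)`; so `2^n` is of the order of `log (S/δ)`. The proof is
an induction on the formula.

At an AND gate (OR follows by negation) the children are grouped dyadically by size. Inside a group
of `K` children of comparable size, a Chebyshev polynomial of degree `O(√K)` in the sum of the
approximants computes the conjunction up to `1/16` (`exists_and_polynomial`), and `n` rounds of `3t²
- 2t³` square the error each time at a cost of `3^n` in the degree. The groups are then multiplied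
together. There are `O(2^n)` of them, so by Cauchy–Schwarz the square roots of their sizes add up to
`O(2^(n/2)) · √S`. One gate therefore costs a factor `O(3^n · 2^(n/2))`, which is at most
`O(2^(5n/2))`: this is the exponent `5/2`. The `20`th power in the error budget makes the budget of
a child in a group of `K ≥ 2` children smaller than that of the gate by the factor `512 K` which the
Chebyshev polynomial requires (`approx_bucket`).

Sandwiching: if `p` is within `√ε/2` of `f` everywhere, then `p ± √ε/2` sandwich `f` with constant
gap `√ε`.

Learning: with `k` the degree, the learner estimates the coefficients `E_P[y χ_T(x)]` for `|T| ≤ k`,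
predicts with the sign of the resulting polynomial, and accepts if the empirical moments of the
unlabelled sample of degree `1` to `2k` are nearly zero. Let `q` be the uniform approximant of the
best common `f`. By Bessel under `P` (`bessel`) the coefficients of `q` are close in `ℓ₂` to the
estimated ones, up to `O(err(f; P))`. Small moments make the `L₂(Q)` norm of a polynomial of degree
`k` at most `√3` times the `ℓ₂` norm of its coefficients (`integral_sq_le_of_small_moments`). Since
`q` is close to `±1` everywhere, also under `Q`, a wrong sign forces a large difference, and
Chebyshev's inequality bounds `Q(h ≠ f)` (`err_le_of_estimates`).

Neither the coefficients nor the moments are listed by the program. Both the sum of squared moments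
and the prediction are sums of the kernel `∑_{|T| ≤ K} χ_T(u) χ_T(v)` over examples, and the kernel
is a sum of elementary symmetric polynomials of the signs `u_i v_i`, computed by dynamic programming
with additions only. -/

/-! ## Functions of low degree on the cube -/

/-- The character `χ_S(x) = ∏_{i ∈ S} x_i` of the cube. -/
noncomputable def chi {d : ℕ} (S : Finset (Fin d)) (x : Cube d) : ℝ := ∏ i ∈ S, (sgn (x i) : ℝ)

/-- The real functions on the cube of degree at most `k`. -/
noncomputable def lowDeg (d k : ℕ) : Submodule ℝ (Cube d → ℝ) :=
  Submodule.span ℝ (chi '' {S : Finset (Fin d) | S.card ≤ k})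

theorem sgn_mul_self (b : Bool) : (sgn b : ℝ) * sgn b = 1 := by cases b <;> norm_num [sgn]

theorem chi_mul_self {d : ℕ} (S : Finset (Fin d)) (x : Cube d) : chi S x * chi S x = 1 := by
  simp [chi, ← Finset.prod_mul_distrib, sgn_mul_self]

theorem abs_chi {d : ℕ} (S : Finset (Fin d)) (x : Cube d) : |chi S x| = 1 := by
  have h := chi_mul_self S x
  rcases mul_self_eq_one_iff.1 h with h | h <;> simp [h]

@[simp] theorem chi_empty {d : ℕ} (x : Cube d) : chi ∅ x = 1 := by simp [chi]

/-- The coordinates in `S ∩ T` occur squared and drop out. -/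
theorem chi_mul_chi {d : ℕ} (S T : Finset (Fin d)) (x : Cube d) :
    chi S x * chi T x = chi (symmDiff S T) x := by
  have h1 : chi S x = chi (S \ T) x * chi (S ∩ T) x := by
    rw [chi, chi, chi, ← Finset.prod_union (Finset.disjoint_sdiff_inter S T),
      Finset.sdiff_union_inter]
  have h2 : chi T x = chi (T \ S) x * chi (S ∩ T) x := by
    rw [Finset.inter_comm, chi, chi, chi, ← Finset.prod_union (Finset.disjoint_sdiff_inter T S),
      Finset.sdiff_union_inter]
  have h3 : chi (symmDiff S T) x = chi (S \ T) x * chi (T \ S) x := by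
    rw [symmDiff, chi, Finset.sup_eq_union, Finset.prod_union disjoint_sdiff_sdiff]; rfl
  rw [h1, h2, h3]
  linear_combination chi (S \ T) x * chi (T \ S) x * chi_mul_self (S ∩ T) x

theorem card_symmDiff_le_add {d : ℕ} (S T : Finset (Fin d)) :
    (symmDiff S T).card ≤ S.card + T.card := by
  refine (Finset.card_union_le _ _).trans ?_
  exact add_le_add (Finset.card_le_card Finset.sdiff_subset)
    (Finset.card_le_card Finset.sdiff_subset)

theorem chi_mem_lowDeg {d k : ℕ} {S : Finset (Fin d)} (h : S.card ≤ k) : chi S ∈ lowDeg d k :=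
  Submodule.subset_span ⟨S, h, rfl⟩

theorem lowDeg_mono {d j k : ℕ} (h : j ≤ k) : lowDeg d j ≤ lowDeg d k :=
  Submodule.span_mono (Set.image_mono fun _ hS => le_trans hS h)

theorem const_mem_lowDeg {d : ℕ} (k : ℕ) (c : ℝ) : (fun _ => c) ∈ lowDeg d k := by
  have h := (lowDeg d k).smul_mem c (chi_mem_lowDeg (S := ∅) (by simp))
  convert h using 1
  ext x; simp

theorem mul_mem_lowDeg {d j k : ℕ} {f g : Cube d → ℝ} (hf : f ∈ lowDeg d j)
    (hg : g ∈ lowDeg d k) : (fun x => f x * g x) ∈ lowDeg d (j + k) := by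
  have h : f * g ∈ lowDeg d j * lowDeg d k := Submodule.mul_mem_mul hf hg
  rw [lowDeg, lowDeg, Submodule.span_mul_span] at h
  refine Submodule.span_le.2 ?_ h
  rintro _ ⟨_, ⟨S, hS, rfl⟩, _, ⟨T, hT, rfl⟩, rfl⟩
  have : chi S * chi T = chi (symmDiff S T) := funext (chi_mul_chi S T)
  simp only [this]
  exact chi_mem_lowDeg ((card_symmDiff_le_add S T).trans (add_le_add hS hT))

theorem pow_mem_lowDeg {d k : ℕ} {f : Cube d → ℝ} (hf : f ∈ lowDeg d k) (n : ℕ) :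
    (fun x => f x ^ n) ∈ lowDeg d (n * k) := by
  induction n with
  | zero => simpa using const_mem_lowDeg _ 1
  | succ n ih => simpa [pow_succ, add_mul] using mul_mem_lowDeg ih hf

theorem sum_mem_lowDeg {d k : ℕ} {ι : Type*} (J : Finset ι) (f : ι → Cube d → ℝ)
    (h : ∀ i ∈ J, f i ∈ lowDeg d k) : (fun x => ∑ i ∈ J, f i x) ∈ lowDeg d k := by
  have := (lowDeg d k).sum_mem h
  convert this using 1
  ext x; simp

theorem eval_mem_lowDeg {d k : ℕ} {f : Cube d → ℝ} (hf : f ∈ lowDeg d k) (p : Polynomial ℝ) :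
    (fun x => p.eval (f x)) ∈ lowDeg d (p.natDegree * k) := by
  simp only [Polynomial.eval_eq_sum_range]
  refine sum_mem_lowDeg _ _ fun i hi => ?_
  refine lowDeg_mono (Nat.mul_le_mul_right k (Nat.lt_succ_iff.1 (Finset.mem_range.1 hi))) ?_
  exact (lowDeg d (i * k)).smul_mem (p.coeff i) (pow_mem_lowDeg hf i)

theorem sgn_mem_lowDeg {d : ℕ} (i : Fin d) : (fun x : Cube d => (sgn (x i) : ℝ)) ∈ lowDeg d 1 := by
  have := chi_mem_lowDeg (d := d) (k := 1) (S := {i}) (by simp)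
  convert this using 1
  ext x; simp [chi]

/-- The sets of at most `k` coordinates. -/
def smallSets (d k : ℕ) : Finset (Finset (Fin d)) := Finset.univ.filter fun S => S.card ≤ k

@[simp] theorem mem_smallSets {d k : ℕ} {S : Finset (Fin d)} : S ∈ smallSets d k ↔ S.card ≤ k := by
  simp [smallSets]

theorem exists_coeff_of_mem_lowDeg {d k : ℕ} {f : Cube d → ℝ} (hf : f ∈ lowDeg d k) :
    ∃ c : Finset (Fin d) → ℝ, ∀ x, f x = ∑ S ∈ smallSets d k, c S * chi S x := by
  induction hf using Submodule.span_induction with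
  | mem f h =>
    obtain ⟨S, hS, rfl⟩ := h
    have hS' : S.card ≤ k := hS
    refine ⟨fun T => if T = S then 1 else 0, fun x => ?_⟩
    simp [Finset.sum_ite_eq', hS']
  | zero => exact ⟨0, fun x => by simp⟩
  | add f g _ _ hf hg =>
    obtain ⟨a, ha⟩ := hf
    obtain ⟨b, hb⟩ := hg
    exact ⟨a + b, fun x => by simp [ha, hb, add_mul, Finset.sum_add_distrib]⟩
  | smul t f _ hf =>
    obtain ⟨a, ha⟩ := hf
    exact ⟨t • a, fun x => by simp [ha, Finset.mul_sum, mul_assoc]⟩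

theorem exists_multilinear_of_mem_lowDeg {d k : ℕ} {f : Cube d → ℝ} (hf : f ∈ lowDeg d k) :
    ∃ p : MvPolynomial (Fin d) ℝ, cubeEval p = f ∧ (∀ i, p.degreeOf i ≤ 1) ∧
      p.totalDegree ≤ k := by
  induction hf using Submodule.span_induction with
  | mem f h =>
    obtain ⟨S, hS, rfl⟩ := h
    refine ⟨∏ i ∈ S, MvPolynomial.X i, ?_, fun i => ?_, ?_⟩
    · ext x; simp [cubeEval, chi]
    · refine (MvPolynomial.degreeOf_prod_le _ _ _).trans ?_
      simp only [MvPolynomial.degreeOf_X]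
      rw [Finset.sum_ite_eq]
      split_ifs <;> simp
    · refine (MvPolynomial.totalDegree_finsetProd _ _).trans ?_
      simpa using hS
  | zero => exact ⟨0, by ext x; simp [cubeEval], by simp, by simp⟩
  | add f g _ _ hf hg =>
    obtain ⟨p, hp, hp1, hp2⟩ := hf
    obtain ⟨q, hq, hq1, hq2⟩ := hg
    refine ⟨p + q, ?_, fun i => ?_, ?_⟩
    · ext x; simp [← hp, ← hq, cubeEval]
    · exact (MvPolynomial.degreeOf_add_le _ _ _).trans (max_le (hp1 i) (hq1 i))
    · exact (MvPolynomial.totalDegree_add _ _).trans (max_le hp2 hq2)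
  | smul t f _ hf =>
    obtain ⟨p, hp, hp1, hp2⟩ := hf
    refine ⟨MvPolynomial.C t * p, ?_, fun i => ?_, ?_⟩
    · ext x; simp [← hp, cubeEval]
    · exact (MvPolynomial.degreeOf_C_mul_le _ _ _).trans (hp1 i)
    · refine (MvPolynomial.totalDegree_mul _ _).trans ?_
      simpa using hp2

/-! ## Growth of Chebyshev polynomials to the right of `1` -/

-- A joint induction by the recurrences `U_n = y U_{n-1} + T_n` and `T_{n+1} = y T_n + (y² - 1)
-- U_{n-1}`, whose coefficients are nonnegative for `y ≥ 1`. Since `T_n' = n U_{n-1}`, these are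
-- bounds for the derivative of `T_n`.
open Polynomial in
theorem chebyshev_bounds (n : ℕ) {y : ℝ} (hy : 1 ≤ y) :
    1 ≤ (Chebyshev.T ℝ n).eval y ∧ (n : ℝ) ≤ (Chebyshev.U ℝ ((n : ℤ) - 1)).eval y ∧
      (Chebyshev.U ℝ ((n : ℤ) - 1)).eval y ≤ n * (Chebyshev.T ℝ n).eval y := by
  induction n with
  | zero => simp
  | succ n ih =>
    obtain ⟨h1, h2, h3⟩ := ih
    have hU : (Chebyshev.U ℝ (n : ℤ)).eval y =
        y * (Chebyshev.U ℝ ((n : ℤ) - 1)).eval y + (Chebyshev.T ℝ n).eval y := by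
      have := congrArg (eval y) (Chebyshev.U_eq_X_mul_U_add_T ℝ ((n : ℤ) - 1))
      simpa using this
    have hT : (Chebyshev.T ℝ ((n : ℤ) + 1)).eval y = y * (Chebyshev.T ℝ n).eval y
        - (1 - y ^ 2) * (Chebyshev.U ℝ ((n : ℤ) - 1)).eval y := by
      have := congrArg (eval y) (Chebyshev.T_eq_X_mul_T_sub_pol_U ℝ ((n : ℤ) - 1))
      rw [show (n : ℤ) - 1 + 2 = n + 1 by ring, show (n : ℤ) - 1 + 1 = n by ring] at this
      simpa using this
    push_cast
    rw [show (n : ℤ) + 1 - 1 = n by ring, hU, hT]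
    have hn : (0 : ℝ) ≤ n := n.cast_nonneg
    have hU0 : 0 ≤ (y ^ 2 - 1) * (Chebyshev.U ℝ ((n : ℤ) - 1)).eval y :=
      mul_nonneg (by nlinarith) (hn.trans h2)
    set t := (Chebyshev.T ℝ n).eval y
    set u := (Chebyshev.U ℝ ((n : ℤ) - 1)).eval y
    have hyt : t ≤ y * t := by nlinarith
    have hyu : u ≤ y * u := by nlinarith
    refine ⟨by linarith, by linarith, ?_⟩
    have h4 : y * u ≤ y * (n * t) := mul_le_mul_of_nonneg_left h3 (by linarith)
    have h5 : (n + 1 : ℝ) * (y * t) ≤ (n + 1) * (y * t - (1 - y ^ 2) * u) :=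
      mul_le_mul_of_nonneg_left (by linarith) (by linarith)
    linarith

open Polynomial in
theorem chebyshev_mvt (n : ℕ) {y h : ℝ} (hh : 0 ≤ h) :
    ∃ z, y ≤ z ∧ z ≤ y + h ∧ (Chebyshev.T ℝ n).eval (y + h) - (Chebyshev.T ℝ n).eval y =
      h * (n * (Chebyshev.U ℝ ((n : ℤ) - 1)).eval z) := by
  rcases hh.eq_or_lt with rfl | hh
  · exact ⟨y, by simp⟩
  obtain ⟨z, hz, hz'⟩ := exists_deriv_eq_slope (fun x => (Chebyshev.T ℝ n).eval x)
    (show y < y + h by linarith) (Chebyshev.T ℝ n).continuousOn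
    (Chebyshev.T ℝ n).differentiable.differentiableOn
  refine ⟨z, hz.1.le, hz.2.le, ?_⟩
  rw [Polynomial.deriv, Chebyshev.T_derivative_eq_U] at hz'
  simp only [eval_mul, Int.cast_natCast, eval_natCast] at hz'
  rw [hz', add_sub_cancel_left, mul_div_cancel₀ _ hh.ne']

open Polynomial in
theorem chebyshev_growth (n : ℕ) {h : ℝ} (hh : 0 ≤ h) :
    1 + n ^ 2 * h ≤ (Chebyshev.T ℝ n).eval (1 + h) := by
  obtain ⟨z, hz, -, he⟩ := chebyshev_mvt n (y := 1) hh
  have hU := (chebyshev_bounds n hz).2.1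
  rw [Chebyshev.T_eval_one] at he
  have : h * (n * n) ≤ h * (n * (Chebyshev.U ℝ ((n : ℤ) - 1)).eval z) := by gcongr
  nlinarith

open Polynomial in
theorem chebyshev_monotoneOn (n : ℕ) {y h : ℝ} (hy : 1 ≤ y) (hh : 0 ≤ h) :
    (Chebyshev.T ℝ n).eval y ≤ (Chebyshev.T ℝ n).eval (y + h) := by
  obtain ⟨z, hz, -, he⟩ := chebyshev_mvt n (y := y) hh
  have hU := (chebyshev_bounds n (hy.trans hz)).2.1
  have : 0 ≤ h * (n * (Chebyshev.U ℝ ((n : ℤ) - 1)).eval z) :=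
    mul_nonneg hh (mul_nonneg n.cast_nonneg (le_trans n.cast_nonneg hU))
  linarith

-- To the right of `1` one has `T_n' = n U_{n-1} ≤ n² T_n` and `T_n` is increasing. So a step of
-- length `h` to the left loses at most the fraction `n² h` of the value.
open Polynomial in
theorem chebyshev_increment_le (n : ℕ) {y h : ℝ} (hy : 1 ≤ y) (hh : 0 ≤ h) :
    (Chebyshev.T ℝ n).eval (y + h) - (Chebyshev.T ℝ n).eval y ≤
      n ^ 2 * h * (Chebyshev.T ℝ n).eval (y + h) := by
  obtain ⟨z, hz, hz', he⟩ := chebyshev_mvt n (y := y) hh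
  have hU := (chebyshev_bounds n (hy.trans hz)).2.2
  have hm := chebyshev_monotoneOn n (hy.trans hz) (show 0 ≤ y + h - z by linarith)
  rw [add_sub_cancel] at hm
  rw [he]
  calc h * (n * (Chebyshev.U ℝ ((n : ℤ) - 1)).eval z)
      ≤ h * (n * (n * (Chebyshev.T ℝ n).eval (y + h))) := by
        gcongr; exact hU.trans (by gcongr)
    _ = _ := by ring

/-- A polynomial of degree `O(√k)` that maps sums of `k` numbers in `[0, 1]` close to `1` or
to `0`, according to whether all of them are close to `1` or one of them is close to `0`. -/
theorem exists_and_polynomial {k : ℕ} (hk : 1 ≤ k) :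
    ∃ p : Polynomial ℝ, (p.natDegree : ℝ) ≤ 8 * √k ∧
      (∀ t : ℝ, 0 ≤ t → t ≤ k - 1 / 2 → 0 ≤ p.eval t ∧ p.eval t ≤ 1 / 16) ∧
      (∀ t : ℝ, k - 1 / 512 ≤ t → t ≤ k → 1 - 1 / 16 ≤ p.eval t ∧ p.eval t ≤ 1) := by
  have hk0 : (1 : ℝ) ≤ k := by exact_mod_cast hk
  have hs1 : 1 ≤ √(k : ℝ) := Real.one_le_sqrt.2 hk0
  have hs2 : √(k : ℝ) ^ 2 = k := Real.sq_sqrt (by linarith)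
  -- With `D² ≥ 9k`, the growth bound at `1 + 1/(2k)` gives `M ≥ 1 + 9/2 ≥ 4`.
  set D : ℕ := ⌈3 * √(k : ℝ)⌉₊ with hD
  have hD1 : 3 * √(k : ℝ) ≤ D := Nat.le_ceil _
  have hD2 : (D : ℝ) ≤ 4 * √k := by
    have := (Nat.ceil_lt_add_one (show 0 ≤ 3 * √(k : ℝ) by positivity)).le
    rw [← hD] at this; linarith
  set T := Polynomial.Chebyshev.T ℝ D with hT
  set M := T.eval (1 + 1 / (2 * (k : ℝ))) with hM
  have hM4 : 4 ≤ M := by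
    have h1 := chebyshev_growth D (h := 1 / (2 * k)) (by positivity)
    have h2 : (3 : ℝ) ≤ D ^ 2 * (1 / (2 * k)) := by
      rw [mul_one_div, le_div_iff₀ (by positivity)]
      nlinarith
    linarith
  have hM0 : 0 < M := by linarith
  -- The affine map sends `[0, k - 1/2]` into `[0, 1]`, where `|T| ≤ 1`, and `k` to `1 + 1/(2k)`,
  -- where `T = M`. The square makes the values nonnegative and turns `1/M ≤ 1/4` into `1/16`.
  refine ⟨(Polynomial.C M⁻¹ * T.comp (Polynomial.C (1 / (k : ℝ)) * Polynomial.X +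
    Polynomial.C (1 / (2 * (k : ℝ))))) ^ 2, ?_, fun t h0 h1 => ?_, fun t h0 h1 => ?_⟩
  · have hdeg : ((Polynomial.C M⁻¹ * T.comp (Polynomial.C (1 / (k : ℝ)) * Polynomial.X +
        Polynomial.C (1 / (2 * (k : ℝ))))) ^ 2).natDegree ≤ 2 * D := by
      refine Polynomial.natDegree_pow_le.trans (Nat.mul_le_mul_left 2 ?_)
      refine (Polynomial.natDegree_C_mul_le _ _).trans ?_
      refine Polynomial.natDegree_comp_le.trans ?_
      have hl := Polynomial.natDegree_linear_le (a := 1 / (k : ℝ)) (b := 1 / (2 * k))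
      have hTd : T.natDegree ≤ D := by
        rw [hT, Polynomial.Chebyshev.natDegree_T]; simp
      calc _ ≤ D * 1 := Nat.mul_le_mul hTd hl
        _ = D := mul_one D
    have : (((Polynomial.C M⁻¹ * T.comp (Polynomial.C (1 / (k : ℝ)) * Polynomial.X +
        Polynomial.C (1 / (2 * (k : ℝ))))) ^ 2).natDegree : ℝ) ≤ 2 * D := by exact_mod_cast hdeg
    linarith
  · simp only [Polynomial.eval_pow, Polynomial.eval_mul, Polynomial.eval_C, Polynomial.eval_comp,
      Polynomial.eval_add, Polynomial.eval_X]
    have hy : |1 / (k : ℝ) * t + 1 / (2 * k)| ≤ 1 := by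
      rw [abs_of_nonneg (by positivity), ← mul_le_mul_iff_right₀ (show (0 : ℝ) < k by linarith)]
      field_simp
      linarith
    have hT1 := Polynomial.Chebyshev.abs_eval_T_real_le_one D hy
    refine ⟨sq_nonneg _, ?_⟩
    rw [mul_pow, ← sq_abs (T.eval _)]
    have h5 : M⁻¹ ≤ 4⁻¹ := inv_anti₀ (by norm_num) hM4
    have h6 : M⁻¹ ^ 2 ≤ 4⁻¹ ^ 2 := by gcongr
    have h7 : |T.eval (1 / (k : ℝ) * t + 1 / (2 * k))| ^ 2 ≤ 1 :=
      pow_le_one₀ (abs_nonneg _) hT1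
    calc _ ≤ (4⁻¹ : ℝ) ^ 2 * 1 := by gcongr
      _ = 1 / 16 := by norm_num
  · simp only [Polynomial.eval_pow, Polynomial.eval_mul, Polynomial.eval_C, Polynomial.eval_comp,
      Polynomial.eval_add, Polynomial.eval_X]
    set h := ((k : ℝ) - t) / k with hh
    have hh0 : 0 ≤ h := div_nonneg (by linarith) (by linarith)
    have hh1 : h ≤ 1 / (512 * k) := by
      rw [hh, div_le_div_iff₀ (by linarith) (by linarith)]
      nlinarith
    set y := 1 / (k : ℝ) * t + 1 / (2 * k) with hy
    have hyh : y + h = 1 + 1 / (2 * k) := by rw [hy, hh]; field_simp; ring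
    have hy1 : 1 ≤ y := by
      have : 1 / (512 * (k : ℝ)) ≤ 1 / (2 * k) := by gcongr; norm_num
      linarith
    have h1' := chebyshev_increment_le D hy1 hh0
    have h2' := chebyshev_monotoneOn D hy1 hh0
    have h3' := (chebyshev_bounds D hy1).1
    rw [hyh, ← hT, ← hM] at h1' h2'
    rw [← hT] at h3'
    -- The tolerance `1/512` comes from here: `D² ≤ 16 k` and `16/512 = 1/32`, and squaring at most
    -- doubles the loss to `1/16`.
    have h4' : (D : ℝ) ^ 2 * h ≤ 1 / 32 := by
      calc (D : ℝ) ^ 2 * h ≤ (4 * √k) ^ 2 * (1 / (512 * k)) := by gcongr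
        _ = 1 / 32 := by rw [mul_pow, hs2]; field_simp; norm_num
    have h5' : (1 - 1 / 32) * M ≤ T.eval y := by nlinarith
    have h6' : 1 - 1 / 32 ≤ M⁻¹ * T.eval y := by
      rw [inv_mul_eq_div, le_div_iff₀ hM0]; exact h5'
    have h7' : M⁻¹ * T.eval y ≤ 1 := by
      rw [inv_mul_eq_div, div_le_one hM0]; exact h2'
    constructor
    · nlinarith
    · exact pow_le_one₀ (by linarith) h7'

/-! ## Amplification -/

/-- The polynomial `3t² - 2t³`, which moves numbers close to `0` or `1` closer to them. -/
noncomputable def smoothStep : Polynomial ℝ :=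
  3 * Polynomial.X ^ 2 - 2 * Polynomial.X ^ 3

theorem smoothStep_eval (t : ℝ) : smoothStep.eval t = 3 * t ^ 2 - 2 * t ^ 3 := by
  simp [smoothStep]

theorem natDegree_smoothStep_le : smoothStep.natDegree ≤ 3 := by
  rw [smoothStep]; compute_degree

theorem smoothStep_mem {t : ℝ} (h0 : 0 ≤ t) (h1 : t ≤ 1) :
    0 ≤ smoothStep.eval t ∧ smoothStep.eval t ≤ 1 := by
  rw [smoothStep_eval]
  constructor <;> nlinarith [sq_nonneg t, mul_nonneg (sq_nonneg t) (sub_nonneg.2 h1),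
    mul_nonneg (sq_nonneg (1 - t)) h0]

/-- The polynomial has a double fixed value at both ends: it is at most `3t²` near `0`, and `1 -
(3t² - 2t³) = (1-t)² (1 + 2t)` near `1`. -/
theorem smoothStep_close {t b e : ℝ} (hb : b = 0 ∨ b = 1) (h0 : 0 ≤ t) (h1 : t ≤ 1)
    (h : |t - b| ≤ e) : |smoothStep.eval t - b| ≤ 4 * e ^ 2 := by
  have hm := smoothStep_mem h0 h1
  rw [smoothStep_eval] at *
  rcases hb with rfl | rfl
  · rw [sub_zero, abs_of_nonneg h0] at h
    rw [sub_zero, abs_of_nonneg hm.1]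
    nlinarith [mul_nonneg (sq_nonneg t) h0, pow_le_pow_left₀ h0 h 2]
  · rw [abs_sub_comm, abs_of_nonneg (by linarith)] at h
    rw [abs_sub_comm, abs_of_nonneg (by linarith)]
    nlinarith [mul_nonneg (sq_nonneg (1 - t)) (sub_nonneg.2 h1),
      pow_le_pow_left₀ (sub_nonneg.2 h1) h 2]

/-- One round replaces the error `e` by `4e²`, that is, squares `4e`. Starting from `4e = 1/4`,
after `n` rounds `4e = (1/4)^(2^n)`. -/
theorem exists_amplifier {d : ℕ} (n : ℕ) {k : ℕ} {p b : Cube d → ℝ} (hp : p ∈ lowDeg d k)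
    (hb : ∀ x, b x = 0 ∨ b x = 1) (h01 : ∀ x, 0 ≤ p x ∧ p x ≤ 1)
    (h : ∀ x, |p x - b x| ≤ 1 / 16) :
    ∃ q ∈ lowDeg d (3 ^ n * k), (∀ x, 0 ≤ q x ∧ q x ≤ 1) ∧
      ∀ x, |q x - b x| ≤ (1 / 4) ^ (2 ^ n) / 4 := by
  induction n with
  | zero => exact ⟨p, by simpa using hp, h01, fun x => (h x).trans (by norm_num)⟩
  | succ n ih =>
    obtain ⟨q, hq, hq1, hq2⟩ := ih
    refine ⟨fun x => smoothStep.eval (q x), ?_, fun x => smoothStep_mem (hq1 x).1 (hq1 x).2,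
      fun x => (smoothStep_close (hb x) (hq1 x).1 (hq1 x).2 (hq2 x)).trans (le_of_eq ?_)⟩
    · refine lowDeg_mono ?_ (eval_mem_lowDeg hq smoothStep)
      rw [pow_succ, mul_comm (3 ^ n) 3, mul_assoc]
      exact Nat.mul_le_mul_right _ natDegree_smoothStep_le
    · rw [pow_succ 2 n, pow_mul]; ring

/-! ## Uniform approximation of formulas -/

/-- The numerical value of a Boolean. -/
def bit (b : Bool) : ℝ := if b then 1 else 0

theorem bit_eq (b : Bool) : bit b = 0 ∨ bit b = 1 := by cases b <;> simp [bit]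

/-- `g` is within `δ` of a function with values in `[0, 1]` of degree at most `D`. -/
def Approx {d : ℕ} (g : Cube d → Bool) (δ D : ℝ) : Prop :=
  ∃ k : ℕ, ∃ p ∈ lowDeg d k, (k : ℝ) ≤ D ∧ (∀ x, 0 ≤ p x ∧ p x ≤ 1) ∧ ∀ x, |p x - bit (g x)| ≤ δ

theorem Approx.mono {d : ℕ} {g : Cube d → Bool} {δ δ' D D' : ℝ} (h : Approx g δ D)
    (hδ : δ ≤ δ') (hD : D ≤ D') : Approx g δ' D' := by
  obtain ⟨k, p, hp, hk, h01, hc⟩ := h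
  exact ⟨k, p, hp, hk.trans hD, h01, fun x => (hc x).trans hδ⟩

theorem approx_const {d : ℕ} {g : Cube d → Bool} (b : Bool) (h : ∀ x, g x = b) :
    Approx g 0 0 := by
  refine ⟨0, _, const_mem_lowDeg 0 (bit b), by simp, fun x => ?_, fun x => by simp [h x]⟩
  rcases bit_eq b with h | h <;> simp [h]

theorem approx_of_one_le {d : ℕ} (g : Cube d → Bool) {δ D : ℝ} (hδ : 1 ≤ δ) (hD : 0 ≤ D) :
    Approx g δ D := by
  refine ⟨0, _, const_mem_lowDeg 0 0, by simpa using hD, by simp, fun x => ?_⟩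
  rcases bit_eq (g x) with h | h <;> simp [h] <;> linarith

theorem Approx.not {d : ℕ} {g : Cube d → Bool} {δ D : ℝ} (h : Approx g δ D) :
    Approx (fun x => !(g x)) δ D := by
  obtain ⟨k, p, hp, hk, h01, hc⟩ := h
  refine ⟨k, fun x => 1 - p x, (lowDeg d k).sub_mem (const_mem_lowDeg k 1) hp, hk,
    fun x => ⟨by linarith [(h01 x).2], by linarith [(h01 x).1]⟩, fun x => ?_⟩
  have : bit (!(g x)) = 1 - bit (g x) := by cases g x <;> simp [bit]
  rw [this, abs_sub_comm]
  simpa using hc x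

/-- Errors of a product of functions with values in `[0, 1]` only add up. This is why `Approx`
insists on the range. -/
theorem approx_and_of_approx {d : ℕ} {g h : Cube d → Bool} {δ δ' D D' : ℝ} (hg : Approx g δ D)
    (hh : Approx h δ' D') : Approx (fun x => g x && h x) (δ + δ') (D + D') := by
  obtain ⟨k, p, hp, hk, h01, hc⟩ := hg
  obtain ⟨k', p', hp', hk', h01', hc'⟩ := hh
  refine ⟨k + k', _, mul_mem_lowDeg hp hp', by push_cast; linarith, fun x =>
    ⟨mul_nonneg (h01 x).1 (h01' x).1, mul_le_one₀ (h01 x).2 (h01' x).1 (h01' x).2⟩, fun x => ?_⟩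
  have hb : bit (g x && h x) = bit (g x) * bit (h x) := by
    cases g x <;> cases h x <;> simp [bit]
  have h1 : p x * p' x - bit (g x && h x) =
      (p x - bit (g x)) * p' x + bit (g x) * (p' x - bit (h x)) := by rw [hb]; ring
  have h2 : |bit (g x)| ≤ 1 := by rcases bit_eq (g x) with h | h <;> simp [h]
  have h3 : |p' x| ≤ 1 := by rw [abs_of_nonneg (h01' x).1]; exact (h01' x).2
  rw [h1]
  refine (abs_add_le _ _).trans ?_
  rw [abs_mul, abs_mul]
  have h4 := mul_le_mul (hc x) h3 (abs_nonneg _) ((abs_nonneg _).trans (hc x))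
  have h5 := mul_le_mul h2 (hc' x) (abs_nonneg _) zero_le_one
  linarith

theorem approx_forall {d : ℕ} {ι : Type*} (J : Finset ι) (g : ι → Cube d → Bool)
    (δ D : ι → ℝ) (h : ∀ i ∈ J, Approx (g i) (δ i) (D i)) :
    Approx (fun x => decide (∀ i ∈ J, g i x = true)) (∑ i ∈ J, δ i) (∑ i ∈ J, D i) := by
  classical
  induction J using Finset.induction_on with
  | empty => simpa using approx_const (d := d) true fun _ => rfl
  | insert a J ha ih =>
    rw [Finset.sum_insert ha, Finset.sum_insert ha]
    convert approx_and_of_approx (h a (by simp)) (ih fun i hi => h i (by simp [hi])) using 2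
    simp

/-- The sum of the approximants is at least `|J| - 1/512` if all conjuncts hold, and at most `|J| -
1/2` if one fails. `exists_and_polynomial` separates these cases, and amplification sharpens the
result. -/
theorem approx_forall_of_uniform {d : ℕ} {ι : Type*} (J : Finset ι) (hJ : J.Nonempty) (n : ℕ)
    (g : ι → Cube d → Bool) {D : ℝ}
    (h : ∀ i ∈ J, Approx (g i) (1 / (512 * J.card)) D) :
    Approx (fun x => decide (∀ i ∈ J, g i x = true)) ((1 / 4) ^ (2 ^ n) / 4)
      (3 ^ n * (8 * √J.card * D)) := by
  classical
  have hD : 0 ≤ D := by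
    obtain ⟨i, hi⟩ := hJ
    obtain ⟨k, -, -, hk, -⟩ := h i hi
    exact k.cast_nonneg.trans hk
  have hc1 : 1 ≤ J.card := hJ.card_pos
  have hc0 : (0 : ℝ) < J.card := by exact_mod_cast hc1
  have hp : ∀ i : ι, ∃ p ∈ lowDeg d ⌊D⌋₊, i ∈ J → (∀ x, 0 ≤ p x ∧ p x ≤ 1) ∧
      ∀ x, |p x - bit (g i x)| ≤ 1 / (512 * J.card) := by
    intro i
    by_cases hi : i ∈ J
    · obtain ⟨k, p, hp, hk, h01, hc⟩ := h i hi
      exact ⟨p, lowDeg_mono (Nat.le_floor hk) hp, fun _ => ⟨h01, hc⟩⟩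
    -- A dummy value outside `J`, so that one function `p` can be chosen for all indices.
    · exact ⟨0, Submodule.zero_mem _, fun h => absurd h hi⟩
  choose p hp hp' using hp
  obtain ⟨q, hq, hq1, hq2⟩ := exists_and_polynomial hc1
  have hsum := sum_mem_lowDeg J p fun i _ => hp i
  have hle : ∀ x, ∑ i ∈ J, p i x ≤ J.card := fun x => by
    simpa using Finset.sum_le_card_nsmul J (fun i => p i x) 1 fun i hi => ((hp' i hi).1 x).2
  have hge : ∀ x, 0 ≤ ∑ i ∈ J, p i x := fun x =>
    Finset.sum_nonneg fun i hi => ((hp' i hi).1 x).1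
  have key : ∀ x, (0 ≤ q.eval (∑ i ∈ J, p i x) ∧ q.eval (∑ i ∈ J, p i x) ≤ 1) ∧
      |q.eval (∑ i ∈ J, p i x) - bit (decide (∀ i ∈ J, g i x = true))| ≤ 1 / 16 := by
    intro x
    by_cases hx : ∀ i ∈ J, g i x = true
    · have h1 : (J.card : ℝ) - 1 / 512 ≤ ∑ i ∈ J, p i x := by
        have h2 : ∀ i ∈ J, 1 - 1 / (512 * (J.card : ℝ)) ≤ p i x := fun i hi => by
          have := (hp' i hi).2 x
          rw [hx i hi, abs_le] at this
          simp only [bit, if_true] at this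
          linarith [this.1]
        have := Finset.card_nsmul_le_sum J (fun i => p i x) _ h2
        rw [nsmul_eq_mul] at this
        have h3 : (J.card : ℝ) * (1 - 1 / (512 * J.card)) = J.card - 1 / 512 := by
          field_simp
        linarith
      obtain ⟨h4, h5⟩ := hq2 _ h1 (hle x)
      refine ⟨⟨by linarith, h5⟩, ?_⟩
      rw [decide_eq_true hx, abs_sub_comm]
      simp only [bit, if_true]
      rw [abs_of_nonneg (by linarith)]
      linarith
    · have hx' := hx
      push Not at hx'
      obtain ⟨a, ha, hax⟩ := hx'
      have h1 : ∑ i ∈ J, p i x ≤ J.card - 1 / 2 := by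
        rw [← Finset.add_sum_erase J _ ha]
        have h2 : p a x ≤ 1 / 2 := by
          have := (hp' a ha).2 x
          simp only [Bool.not_eq_true] at hax
          rw [hax, abs_le] at this
          simp only [bit] at this
          have h3 : 1 / (512 * (J.card : ℝ)) ≤ 1 / 2 := by
            have : (1 : ℝ) ≤ J.card := by exact_mod_cast hc1
            gcongr; linarith
          have h4 := this.2
          simp at h4 h3 ⊢
          linarith
        have h3 := Finset.sum_le_card_nsmul (J.erase a) (fun i => p i x) 1
          fun i hi => ((hp' i (Finset.mem_of_mem_erase hi)).1 x).2
        rw [Finset.card_erase_of_mem ha, nsmul_eq_mul, Nat.cast_sub hc1] at h3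
        push_cast at h3
        linarith
      obtain ⟨h4, h5⟩ := hq1 _ (hge x) h1
      refine ⟨⟨h4, by linarith⟩, ?_⟩
      rw [decide_eq_false hx]
      simp only [bit]
      simpa [abs_of_nonneg h4] using h5
  obtain ⟨r, hr, hr1, hr2⟩ := exists_amplifier n (eval_mem_lowDeg hsum q)
    (fun x => bit_eq (decide (∀ i ∈ J, g i x = true))) (fun x => (key x).1) fun x => (key x).2
  refine ⟨_, r, hr, ?_, hr1, hr2⟩
  push_cast
  have := Nat.floor_le hD
  gcongr

/-- This fixes the exponent `20` of the error budget: a child in a group of `K` comparable ones has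
size at most `2/(K+1)` times the total, so its budget shrinks by at least the factor `512 K`. -/
theorem le_half_pow {K : ℕ} (hK : 2 ≤ K) : (512 * K : ℝ) ≤ ((K + 1) / 2) ^ 20 := by
  have hK' : (2 : ℝ) ≤ K := by exact_mod_cast hK
  set u : ℝ := (K + 1) / 2 with hu
  have h1 : (3 / 2 : ℝ) ≤ u := by rw [hu]; linarith
  have h2 : (3 / 2 : ℝ) ^ 19 ≤ u ^ 19 := by gcongr
  have h3 : (1024 : ℝ) ≤ (3 / 2) ^ 19 := by norm_num
  have h4 : (K : ℝ) ≤ 2 * u := by rw [hu]; linarith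
  calc (512 * K : ℝ) ≤ 1024 * u := by linarith
    _ ≤ u ^ 19 * u := by gcongr; linarith
    _ = u ^ 20 := by ring

/-- Conjunctions of functions of comparable sizes. -/
theorem approx_bucket {d N n j S : ℕ} {δ X : ℝ} (hX : 0 ≤ X) (g : Fin N → Cube d → Bool)
    (s : Fin N → ℕ) (J : Finset (Fin N)) (hJ : ∀ i ∈ J, 2 ^ j ≤ s i ∧ s i < 2 ^ (j + 1))
    (hS : ∑ i ∈ J, s i ≤ S) (hS1 : 1 ≤ S) (hδ1 : δ ≤ 1)
    (hδ : (S : ℝ) ^ 20 ≤ δ * 2 ^ (2 ^ n))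
    (H : ∀ i ∈ J, ∀ η : ℝ, (s i : ℝ) ^ 20 ≤ η * 2 ^ (2 ^ n) → Approx (g i) η (√(s i) * X)) :
    Approx (fun x => decide (∀ i ∈ J, g i x = true)) (δ * (∑ i ∈ J, s i : ℕ) / S)
      (3 ^ n * (8 * √2) * X * √(∑ i ∈ J, s i : ℕ)) := by
  have hS0 : (1 : ℝ) ≤ S := by exact_mod_cast hS1
  have hΛ : (0 : ℝ) < 2 ^ (2 ^ n) := by positivity
  have hδ0 : 0 < δ := by
    by_contra h
    have : δ * 2 ^ (2 ^ n) ≤ 0 := mul_nonpos_of_nonpos_of_nonneg (not_lt.1 h) hΛ.le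
    have : (0 : ℝ) < (S : ℝ) ^ 20 := by positivity
    linarith
  have hs2 : 1 ≤ √(2 : ℝ) := Real.one_le_sqrt.2 (by norm_num)
  have h3n : (1 : ℝ) ≤ 3 ^ n := one_le_pow₀ (by norm_num)
  rcases Nat.lt_or_ge 1 J.card with hc | hc
  · have hne : J.Nonempty := Finset.card_pos.1 (by omega)
    set σ := ∑ i ∈ J, s i with hσ
    have hσJ : J.card * 2 ^ j ≤ σ := by
      have := Finset.card_nsmul_le_sum J s (2 ^ j) fun i hi => (hJ i hi).1
      simpa using this
    have hσ1 : 1 ≤ σ := le_trans (Nat.mul_pos (by omega) (by positivity)) hσJ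
    -- Each of the other `|J| - 1` members has size at least `2^j`, hence at least half of `s i`.
    have hsi : ∀ i ∈ J, (s i : ℝ) * ((J.card + 1) / 2) ≤ S := by
      intro i hi
      have h1 : s i + (J.card - 1) * 2 ^ j ≤ σ := by
        rw [hσ, ← Finset.add_sum_erase J _ hi, ← Finset.card_erase_of_mem hi]
        have := Finset.card_nsmul_le_sum (J.erase i) s (2 ^ j)
          fun i hi => (hJ i (Finset.mem_of_mem_erase hi)).1
        simpa using this
      have h2 : s i ≤ 2 * 2 ^ j := by have := (hJ i hi).2; rw [pow_succ] at this; omega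
      have h3 : (J.card - 1) * s i ≤ (J.card - 1) * (2 * 2 ^ j) := Nat.mul_le_mul_left _ h2
      have h4 : 2 * s i + (J.card - 1) * s i ≤ 2 * S := by nlinarith
      have h5 : (J.card - 1) + 2 = J.card + 1 := by omega
      have h6 : (J.card + 1) * s i ≤ 2 * S := by rw [← h5]; nlinarith
      have h7 : ((J.card + 1 : ℕ) : ℝ) * s i ≤ 2 * S := by exact_mod_cast h6
      push_cast at h7
      linarith
    have hap : ∀ i ∈ J, Approx (g i) (1 / (512 * J.card)) (√(2 ^ (j + 1) : ℕ) * X) := by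
      intro i hi
      refine (H i hi _ ?_).mono le_rfl ?_
      · have h1 := le_half_pow hc
        have h2 : ((s i : ℝ) * ((J.card + 1) / 2)) ^ 20 ≤ S ^ 20 :=
          pow_le_pow_left₀ (by positivity) (hsi i hi) 20
        rw [mul_pow] at h2
        have hJ0 : (0 : ℝ) < J.card := by exact_mod_cast hne.card_pos
        rw [one_div_mul_eq_div, le_div_iff₀ (by positivity)]
        calc (s i : ℝ) ^ 20 * (512 * J.card) ≤ (s i : ℝ) ^ 20 * ((J.card + 1) / 2) ^ 20 := by
              gcongr
          _ ≤ δ * 2 ^ (2 ^ n) := h2.trans hδ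
          _ ≤ 2 ^ (2 ^ n) := mul_le_of_le_one_left hΛ.le hδ1
      · gcongr
        exact (hJ i hi).2.le
    have hall : Approx (fun x => decide (∀ i ∈ J, g i x = true)) ((1 / 4) ^ (2 ^ n) / 4)
        (3 ^ n * (8 * √J.card * (√(2 ^ (j + 1) : ℕ) * X))) := by
      convert approx_forall_of_uniform J hne n g hap
    refine hall.mono ?_ ?_
    · have h1 : (1 / 4 : ℝ) ^ (2 ^ n) / 4 ≤ 1 / 2 ^ (2 ^ n) := by
        have h2 : (1 / 4 : ℝ) ^ (2 ^ n) ≤ (1 / 2) ^ (2 ^ n) := by gcongr; norm_num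
        have h3 : (0 : ℝ) ≤ (1 / 4) ^ (2 ^ n) := by positivity
        rw [← one_div_pow]
        linarith
      refine h1.trans ?_
      rw [div_le_div_iff₀ hΛ (by linarith)]
      have hσ1' : (1 : ℝ) ≤ σ := by exact_mod_cast hσ1
      calc 1 * (S : ℝ) ≤ (S : ℝ) ^ 20 := by rw [one_mul]; exact le_self_pow₀ hS0 (by norm_num)
        _ ≤ δ * 2 ^ (2 ^ n) := hδ
        _ ≤ δ * σ * 2 ^ (2 ^ n) := by
          gcongr; exact le_mul_of_one_le_right hδ0.le hσ1'
    -- Replacing every size by the upper end `2^(j+1)` of the dyadic range overestimates the total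
    -- size `σ` by at most a factor `2`.
    · have h1 : √(J.card : ℝ) * √((2 ^ (j + 1) : ℕ) : ℝ) ≤ √2 * √(σ : ℝ) := by
        rw [← Real.sqrt_mul (by positivity), ← Real.sqrt_mul (by positivity)]
        refine Real.sqrt_le_sqrt ?_
        have : J.card * 2 ^ (j + 1) ≤ 2 * σ := by rw [pow_succ]; nlinarith
        exact_mod_cast this
      calc (3 : ℝ) ^ n * (8 * √J.card * (√(2 ^ (j + 1) : ℕ) * X))
          = 3 ^ n * 8 * X * (√J.card * √(2 ^ (j + 1) : ℕ)) := by ring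
        _ ≤ 3 ^ n * 8 * X * (√2 * √(σ : ℝ)) := by gcongr
        _ = _ := by ring
  -- A group of one child leaves no gap in size for the Chebyshev polynomial, but needs none: the
  -- child's own approximant is used, and its budget fits into the share `δ · s i / S` because `s i
  -- ≤ S`.
  · rcases Nat.eq_zero_or_pos J.card with h0 | h0
    · obtain rfl := Finset.card_eq_zero.1 h0
      simpa using approx_const (d := d) true fun _ => rfl
    · obtain ⟨i, rfl⟩ := Finset.card_eq_one.1 (le_antisymm hc h0)
      have hi := hJ i (by simp)
      simp only [Finset.sum_singleton, Finset.mem_singleton, forall_eq, Bool.decide_eq_true] at *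
      have hsi1 : (1 : ℝ) ≤ s i := by exact_mod_cast (Nat.one_le_two_pow.trans hi.1)
      have hsiS : (s i : ℝ) ≤ S := by exact_mod_cast hS
      refine (H _ ?_).mono le_rfl ?_
      · rw [div_mul_eq_mul_div, le_div_iff₀ (by linarith)]
        calc (s i : ℝ) ^ 20 * S = s i ^ 19 * (s i * S) := by ring
          _ ≤ (S : ℝ) ^ 19 * (s i * S) := by gcongr
          _ = s i * (S : ℝ) ^ 20 := by ring
          _ ≤ s i * (δ * 2 ^ (2 ^ n)) := by gcongr
          _ = _ := by ring
      · have h1 : 1 ≤ (3 : ℝ) ^ n * (8 * √2) := by nlinarith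
        have h2 : 0 ≤ √(s i : ℝ) * X := by positivity
        nlinarith

/-- The children are split into dyadic size classes and the error `δ` is shared among the classes in
proportion to their total sizes, so that the errors of the product add up to exactly `δ`. -/
theorem approx_and_gate {d N n : ℕ} {δ X : ℝ} (hX : 0 ≤ X) (g : Fin N → Cube d → Bool)
    (s : Fin N → ℕ) (hS : 1 ≤ ∑ i, s i) (hδ : ((∑ i, s i : ℕ) : ℝ) ^ 20 ≤ δ * 2 ^ (2 ^ n))
    (H0 : ∀ i, s i = 0 → ∃ b, ∀ x, g i x = b)
    (H : ∀ i, 1 ≤ s i → ∀ η : ℝ, (s i : ℝ) ^ 20 ≤ η * 2 ^ (2 ^ n) →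
      Approx (g i) η (√(s i) * X)) :
    Approx (fun x => decide (∀ i, g i x = true)) δ
      (√(∑ i, s i : ℕ) * (16 * √(32 ^ n) * X)) := by
  set S := ∑ i, s i with hSdef
  have hD : 0 ≤ √(S : ℝ) * (16 * √(32 ^ n) * X) := by positivity
  rcases le_total 1 δ with h1 | hδ1
  · exact approx_of_one_le _ h1 hD
  have hS0 : (1 : ℝ) ≤ S := by exact_mod_cast hS
  have hδ0 : 0 ≤ δ := by
    by_contra h
    have : δ * 2 ^ (2 ^ n) ≤ 0 :=
      mul_nonpos_of_nonpos_of_nonneg (not_le.1 h).le (by positivity)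
    have : (0 : ℝ) < (S : ℝ) ^ 20 := by positivity
    linarith
  -- Children without leaves are constant: one constant `false` decides the conjunction, and
  -- constants `true` may be dropped, so only children of positive size are put into classes.
  by_cases hf : ∃ i, s i = 0 ∧ ∀ x, g i x = false
  · obtain ⟨i, -, hi⟩ := hf
    refine (approx_const false fun x => ?_).mono hδ0 hD
    simp only [decide_eq_false_iff_not, not_forall]
    exact ⟨i, by simp [hi]⟩
  have H0' : ∀ i, s i = 0 → ∀ x, g i x = true := by
    intro i hi
    obtain ⟨b, hb⟩ := H0 i hi
    cases b
    · exact absurd ⟨i, hi, hb⟩ hf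
    · exact hb
  set R := Nat.log 2 S + 1 with hR
  let J : ℕ → Finset (Fin N) := fun j => Finset.univ.filter fun i => s i ≠ 0 ∧ Nat.log 2 (s i) = j
  have hdisj : (Finset.range R : Set ℕ).PairwiseDisjoint J := by
    intro a _ b _ hab
    refine Finset.disjoint_left.2 fun i hi hi' => hab ?_
    simp only [J, Finset.mem_filter] at hi hi'
    rw [← hi.2.2, ← hi'.2.2]
  have hcov : ∀ i, s i ≠ 0 → i ∈ J (Nat.log 2 (s i)) ∧ Nat.log 2 (s i) ∈ Finset.range R := by
    intro i hi
    refine ⟨by simp [J, hi], Finset.mem_range.2 (Nat.lt_succ_of_le (Nat.log_mono_right ?_))⟩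
    exact Finset.single_le_sum (f := s) (fun _ _ => Nat.zero_le _) (Finset.mem_univ i)
  have hsum : ∑ j ∈ Finset.range R, ∑ i ∈ J j, s i = S := by
    rw [← Finset.sum_biUnion hdisj, hSdef]
    refine Finset.sum_subset (Finset.subset_univ _) fun i _ hi => ?_
    by_contra h
    exact hi (Finset.mem_biUnion.2 ⟨_, (hcov i h).2, (hcov i h).1⟩)
  have hsum' : ∑ j ∈ Finset.range R, ((∑ i ∈ J j, s i : ℕ) : ℝ) = S := by exact_mod_cast hsum
  have hb : ∀ j ∈ Finset.range R, Approx (fun x => decide (∀ i ∈ J j, g i x = true))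
      (δ * (∑ i ∈ J j, s i : ℕ) / S) (3 ^ n * (8 * √2) * X * √(∑ i ∈ J j, s i : ℕ)) := by
    intro j hj
    refine approx_bucket (j := j) hX g s (J j) (fun i hi => ?_) ?_ hS hδ1 hδ fun i hi => H i ?_
    · simp only [J, Finset.mem_filter] at hi
      rw [← hi.2.2]
      exact ⟨Nat.pow_log_le_self 2 hi.2.1, Nat.lt_pow_succ_log_self (by norm_num) _⟩
    · rw [← hsum]
      exact Finset.single_le_sum (f := fun j => ∑ i ∈ J j, s i) (fun _ _ => Nat.zero_le _) hj
    · simp only [J, Finset.mem_filter] at hi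
      exact Nat.one_le_iff_ne_zero.2 hi.2.1
  have hall := approx_forall (Finset.range R) _ _ _ hb
  have heq : (fun x => decide (∀ j ∈ Finset.range R,
      decide (∀ i ∈ J j, g i x = true) = true)) = fun x => decide (∀ i, g i x = true) := by
    ext x
    simp only [decide_eq_true_eq]
    congr 1
    refine propext ⟨fun h i => ?_, fun h j _ i _ => h i⟩
    by_cases hi : s i = 0
    · exact H0' i hi x
    · exact h _ (hcov i hi).2 i (hcov i hi).1
  rw [heq] at hall
  refine hall.mono (le_of_eq ?_) ?_
  · rw [← Finset.sum_div, ← Finset.mul_sum, hsum', mul_div_assoc, div_self (by linarith), mul_one]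
  · rw [← Finset.mul_sum]
    -- The budget condition with `δ ≤ 1` forces `S ≤ 2^(2^n)`, hence `log₂ S ≤ 2^n`.
    have hRn : (R : ℝ) ≤ 2 * 2 ^ n := by
      have h1 : 2 ^ Nat.log 2 S ≤ 2 ^ (2 ^ n) := by
        refine (Nat.pow_log_le_self 2 (by omega)).trans ?_
        have h2 : (S : ℝ) ≤ 2 ^ (2 ^ n) := calc
          (S : ℝ) ≤ (S : ℝ) ^ 20 := le_self_pow₀ hS0 (by norm_num)
          _ ≤ δ * 2 ^ (2 ^ n) := hδ
          _ ≤ 2 ^ (2 ^ n) := mul_le_of_le_one_left (by positivity) hδ1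
        exact_mod_cast h2
      have h2 := (Nat.pow_le_pow_iff_right (by norm_num)).1 h1
      have h3 : R ≤ 2 * 2 ^ n := by have := Nat.one_le_two_pow (n := n); omega
      exact_mod_cast h3
    -- Cauchy–Schwarz over the `R` classes keeps the dependence on the size at `√S`.
    have hcs : ∑ j ∈ Finset.range R, √((∑ i ∈ J j, s i : ℕ) : ℝ) ≤ √(2 * 2 ^ n) * √(S : ℝ) := by
      rw [← Real.sqrt_mul (by positivity)]
      refine Real.le_sqrt_of_sq_le ?_
      refine sq_sum_le_card_mul_sum_sq.trans ?_
      simp only [Finset.card_range]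
      rw [Finset.sum_congr rfl fun j _ => Real.sq_sqrt (Nat.cast_nonneg _), hsum']
      gcongr
    -- The left-hand side is `√(18^n)`; rounding `18` up to `32 = 2^5` gives the fifth power of
    -- `√(2^n)`.
    have h4 : (3 : ℝ) ^ n * √(2 ^ n) ≤ √(32 ^ n) := by
      refine Real.le_sqrt_of_sq_le ?_
      rw [mul_pow, Real.sq_sqrt (by positivity), ← pow_mul, mul_comm n 2, pow_mul, ← mul_pow]
      gcongr
      norm_num
    have h5 : √(2 : ℝ) * √2 = 2 := Real.mul_self_sqrt (by norm_num)
    calc (3 : ℝ) ^ n * (8 * √2) * X * ∑ j ∈ Finset.range R, √((∑ i ∈ J j, s i : ℕ) : ℝ)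
        ≤ 3 ^ n * (8 * √2) * X * (√(2 * 2 ^ n) * √(S : ℝ)) := by gcongr
      _ = √(S : ℝ) * (8 * (√2 * √2) * (3 ^ n * √(2 ^ n)) * X) := by
          rw [Real.sqrt_mul (by norm_num)]; ring
      _ ≤ √(S : ℝ) * (8 * (√2 * √2) * √(32 ^ n) * X) := by gcongr
      _ = _ := by rw [h5]; ring

namespace BoolFormula

theorem eval_const_of_size_eq_zero {d : ℕ} (F : BoolFormula d) (h : F.size = 0) :
    ∃ b, ∀ x, F.eval x = b := by
  induction F with
  | var i => simp [size] at h
  | not F ih =>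
    obtain ⟨b, hb⟩ := ih h
    exact ⟨!b, fun x => by simp [eval, hb]⟩
  | and n F ih =>
    simp only [size, Finset.sum_eq_zero_iff, Finset.mem_univ, true_imp_iff] at h
    choose b hb using fun i => ih i (h i)
    exact ⟨decide (∀ i, b i = true), fun x => by simp [eval, hb]⟩
  | or n F ih =>
    simp only [size, Finset.sum_eq_zero_iff, Finset.mem_univ, true_imp_iff] at h
    choose b hb using fun i => ih i (h i)
    exact ⟨decide (∃ i, b i = true), fun x => by simp [eval, hb]⟩

/-- A formula of size `S` and depth `l` has degree at most `√S · (16 · 2^{5n/2})^l` up to an error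
`δ ≥ S^20 / 2^(2^n)`. -/
theorem approx {d : ℕ} (n : ℕ) (F : BoolFormula d) (h : 1 ≤ F.size) {l : ℕ} (hl : F.depth ≤ l)
    {δ : ℝ} (hδ : (F.size : ℝ) ^ 20 ≤ δ * 2 ^ (2 ^ n)) :
    Approx (fun x => F.eval x) δ (√F.size * (16 * √(32 ^ n)) ^ l) := by
  have hB : 1 ≤ 16 * √((32 : ℝ) ^ n) := by
    have : 1 ≤ √((32 : ℝ) ^ n) := Real.one_le_sqrt.2 (one_le_pow₀ (by norm_num))
    linarith
  induction F generalizing l δ with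
  | var i =>
    refine ⟨1, fun x => (1 / 2 : ℝ) * 1 + (1 / 2 : ℝ) * sgn (x i), ?_, ?_, fun x => ?_,
      fun x => ?_⟩
    · exact (lowDeg d 1).add_mem (const_mem_lowDeg 1 _)
        ((lowDeg d 1).smul_mem _ (sgn_mem_lowDeg i))
    · simpa [size] using one_le_pow₀ hB
    · cases hx : x i <;> norm_num [sgn, hx]
    · have h0 : 0 ≤ δ := by
        by_contra h
        have : δ * 2 ^ (2 ^ n) ≤ 0 :=
          mul_nonpos_of_nonpos_of_nonneg (not_le.1 h).le (by positivity)
        norm_num [size] at hδ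
        linarith
      simp only [eval]
      cases x i <;> norm_num [sgn, bit, h0]
  | not F ih => exact (ih h hl hδ).not
  | and N F ih =>
    simp only [depth] at hl
    obtain ⟨l, rfl⟩ : ∃ l', l = l' + 1 := ⟨l - 1, by omega⟩
    have hl' : ∀ i, (F i).depth ≤ l := fun i =>
      (Finset.le_sup (f := fun i => (F i).depth) (Finset.mem_univ i)).trans (by omega)
    have := approx_and_gate (n := n) (δ := δ) (X := (16 * √(32 ^ n)) ^ l) (by positivity)
      (fun i x => (F i).eval x) (fun i => (F i).size) h hδ
      (fun i hi => (F i).eval_const_of_size_eq_zero hi) fun i hi η hη => ih i hi (hl' i) hη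
    rw [pow_succ']
    exact this
  | or N F ih =>
    simp only [depth] at hl
    obtain ⟨l, rfl⟩ : ∃ l', l = l' + 1 := ⟨l - 1, by omega⟩
    have hl' : ∀ i, (F i).depth ≤ l := fun i =>
      (Finset.le_sup (f := fun i => (F i).depth) (Finset.mem_univ i)).trans (by omega)
    have := (approx_and_gate (n := n) (δ := δ) (X := (16 * √(32 ^ n)) ^ l) (by positivity)
      (fun i x => !((F i).eval x)) (fun i => (F i).size) h hδ (fun i hi => by
        obtain ⟨b, hb⟩ := (F i).eval_const_of_size_eq_zero hi
        exact ⟨!b, fun x => by simp [hb]⟩) fun i hi η hη => (ih i hi (hl' i) hη).not).not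
    rw [pow_succ']
    have he : (fun x => (or N F).eval x) =
        fun x => !(decide (∀ i, (!((F i).eval x)) = true)) := by
      ext x
      rw [eval, ← decide_not]
      simp
    rw [he]
    exact this

end BoolFormula

/-- Functions computed by formulas are, in the sup norm, close to functions of low degree. -/
theorem exists_lowDeg_of_mem_formulaClass {d s l n : ℕ} (hs : 1 ≤ s) {f : Cube d → Bool}
    (hf : f ∈ formulaClass d s l) {δ : ℝ} (hδ : 2 * (s : ℝ) ^ 20 ≤ δ * 2 ^ (2 ^ n)) :
    ∃ k : ℕ, ∃ p ∈ lowDeg d k, (k : ℝ) ≤ √(s : ℝ) * (16 * √(32 ^ n)) ^ l ∧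
      ∀ x, |p x - sgn (f x)| ≤ δ := by
  obtain ⟨F, hFs, hFl, hF⟩ := hf
  have hs0 : (1 : ℝ) ≤ s := by exact_mod_cast hs
  have key : Approx f (δ / 2) (√(s : ℝ) * (16 * √(32 ^ n)) ^ l) := by
    have hfe : f = fun x => F.eval x := funext hF
    rcases Nat.eq_zero_or_pos F.size with h0 | h0
    · obtain ⟨b, hb⟩ := F.eval_const_of_size_eq_zero h0
      refine (approx_const b fun x => (hF x).trans (hb x)).mono ?_ (by positivity)
      by_contra h
      have : δ * 2 ^ (2 ^ n) ≤ 0 :=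
        mul_nonpos_of_nonpos_of_nonneg (by linarith) (by positivity)
      have : (0 : ℝ) < 2 * (s : ℝ) ^ 20 := by positivity
      linarith
    · rw [hfe]
      have hFs' : (F.size : ℝ) ≤ s := by exact_mod_cast hFs
      refine (F.approx n h0 hFl (δ := δ / 2) ?_).mono le_rfl (by gcongr)
      have : (F.size : ℝ) ^ 20 ≤ (s : ℝ) ^ 20 := by gcongr
      linarith
  obtain ⟨k, p, hp, hk, -, hc⟩ := key
  refine ⟨k, fun x => 2 * p x - 1, ?_, hk, fun x => ?_⟩
  · exact (lowDeg d k).sub_mem ((lowDeg d k).smul_mem 2 hp) (const_mem_lowDeg k 1)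
  · have h1 : (sgn (f x) : ℝ) = 2 * bit (f x) - 1 := by cases f x <;> norm_num [sgn, bit]
    have h2 := hc x
    rw [abs_le] at h2 ⊢
    constructor <;> linarith [h2.1, h2.2]

/-! ### From uniform approximation to sandwiching polynomials. -/

theorem rpow_five_halves {z : ℝ} (hz : 0 ≤ z) (l : ℕ) :
    z ^ (5 * (l : ℝ) / 2) = √(z ^ 5) ^ l := by
  rw [Real.sqrt_eq_rpow, ← Real.rpow_natCast z 5, ← Real.rpow_mul hz, ← Real.rpow_natCast,
    ← Real.rpow_mul hz]
  congr 1
  push_cast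
  ring

theorem exists_two_pow_near {y : ℝ} (hy : 1 ≤ y) : ∃ n : ℕ, y ≤ 2 ^ n ∧ (2 : ℝ) ^ n ≤ 2 * y := by
  obtain ⟨n, h1, h2⟩ := exists_nat_pow_near hy (one_lt_two)
  exact ⟨n + 1, h2.le, by rw [pow_succ]; linarith⟩

/-- The factor `16` of each gate is absorbed into the base of the fifth power, since `16² ≤
(16/5)^5`. -/
theorem gate_factor_le {n : ℕ} {y : ℝ} (h : (2 : ℝ) ^ n ≤ y) :
    16 * √((32 : ℝ) ^ n) ≤ √((16 / 5 * y) ^ 5) := by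
  refine Real.le_sqrt_of_sq_le ?_
  rw [mul_pow, Real.sq_sqrt (by positivity), mul_pow]
  have h1 : (32 : ℝ) ^ n = (2 ^ n) ^ 5 := by rw [← pow_mul, mul_comm, pow_mul]; norm_num
  have h2 : ((2 : ℝ) ^ n) ^ 5 ≤ y ^ 5 := by gcongr
  have h3 : 0 ≤ y ^ 5 := by have := (show (0 : ℝ) ≤ (2 ^ n) ^ 5 by positivity); linarith
  rw [h1]
  nlinarith

theorem l2SandwichingDegreeLE_formulaClass {C : ℝ} (hC : 1000 ≤ C) (d s l : ℕ) {ε : ℝ}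
    (hε : 0 < ε) (hs : 2 * ε ≤ (s : ℝ)) :
    L2SandwichingDegreeLE (formulaClass d s l) (uniformCube d) ε
      (√(s : ℝ) * (C * Real.log ((s : ℝ) / ε)) ^ (5 * (l : ℝ) / 2)) := by
  have hu2 : 2 ≤ (s : ℝ) / ε := by rw [le_div_iff₀ hε]; exact hs
  have hs1 : 1 ≤ s := by
    rcases Nat.eq_zero_or_pos s with h | h
    · simp only [h, Nat.cast_zero] at hs; linarith
    · exact h
  have hs1' : (1 : ℝ) ≤ s := by exact_mod_cast hs1
  set u := (s : ℝ) / ε with hu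
  have hlog2 := Real.log_two_gt_d9
  have hlog : Real.log 2 ≤ Real.log u := Real.log_le_log (by norm_num) hu2
  have hz : 0 ≤ C * Real.log u := mul_nonneg (by linarith) (by linarith)
  have : IsProbabilityMeasure (uniformCube d) := by unfold uniformCube; infer_instance
  intro f hf
  -- For `ε ≥ 4` the constants `±1` already have squared gap `4 ≤ ε`; otherwise `s ≤ 4 s/ε`, so that
  -- powers of `s` can be bounded by powers of `u = s/ε`.
  rcases le_or_gt 4 ε with h4 | h4
  · refine ⟨1, -1, ⟨fun x => ?_, ?_⟩, ?_, ?_, ?_, ?_⟩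
    · cases f x <;> simp [cubeEval, sgn]
    · simp only [cubeEval, map_one, map_neg]
      norm_num
      exact h4
    · intro i; rw [← MvPolynomial.C_1, MvPolynomial.degreeOf_C]; exact zero_le_one
    · intro i; rw [← MvPolynomial.C_1, ← MvPolynomial.C_neg, MvPolynomial.degreeOf_C]
      exact zero_le_one
    · rw [MvPolynomial.totalDegree_one]; push_cast; positivity
    · rw [MvPolynomial.totalDegree_neg, MvPolynomial.totalDegree_one]; push_cast; positivity
  -- This makes `2^(2^n) ≥ u^63`. The condition to be met is at most `2 (4u)^20 · √ε u = (√ε/2) ·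
  -- 2^42 · u^21`, and `2^42 ≤ u^42`, which explains `63 = 42 + 21`.
  have hlog1 : 1 ≤ 63 * Real.log u / Real.log 2 := by
    rw [le_div_iff₀ (by linarith)]; linarith
  obtain ⟨n, hn1, hn2⟩ := exists_two_pow_near hlog1
  have hδ0 : 0 < √ε := Real.sqrt_pos.2 hε
  have hs4u : (s : ℝ) ≤ 4 * u := by
    rw [hu, mul_div_assoc', le_div_iff₀ hε]; nlinarith
  have hinv : 1 ≤ √ε * u := by
    have h1 : √ε * √ε = ε := Real.mul_self_sqrt hε.le
    have h2 : ε * u = s := by rw [hu]; field_simp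
    have h3 : 1 ≤ (√ε * u) ^ 2 := by
      calc (1 : ℝ) ≤ s * u := by nlinarith
        _ = (√ε * √ε) * u * u := by rw [h1, h2]
        _ = _ := by ring
    exact (one_le_sq_iff₀ (by positivity)).1 h3
  have hbig : u ^ 63 ≤ 2 ^ (2 ^ n) := by
    rw [div_le_iff₀ (by linarith)] at hn1
    rw [← Real.log_le_log_iff (by positivity) (by positivity), Real.log_pow, Real.log_pow]
    push_cast
    exact hn1
  have hδ : 2 * (s : ℝ) ^ 20 ≤ √ε / 2 * 2 ^ (2 ^ n) := by
    have h1 : (s : ℝ) ^ 20 ≤ (4 * u) ^ 20 := by gcongr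
    have h2 : (2 : ℝ) ^ 42 ≤ u ^ 42 := by gcongr
    calc 2 * (s : ℝ) ^ 20 ≤ 2 * (4 * u) ^ 20 := by gcongr
      _ ≤ 2 * (4 * u) ^ 20 * (√ε * u) := le_mul_of_one_le_right (by positivity) hinv
      _ = √ε / 2 * (2 ^ 42 * u ^ 21) := by ring
      _ ≤ √ε / 2 * (u ^ 42 * u ^ 21) := by gcongr
      _ = √ε / 2 * u ^ 63 := by ring
      _ ≤ _ := by gcongr
  obtain ⟨k, p, hp, hk, hc⟩ := exists_lowDeg_of_mem_formulaClass hs1 hf hδ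
  have hk' : (k : ℝ) ≤ √(s : ℝ) * (C * Real.log u) ^ (5 * (l : ℝ) / 2) := by
    rw [rpow_five_halves hz]
    refine hk.trans ?_
    have h1 : 16 / 5 * (2 * (63 * Real.log u / Real.log 2)) ≤ C * Real.log u := by
      have h2 : 2 * (63 * Real.log u / Real.log 2) ≤ 200 * Real.log u := by
        rw [mul_div_assoc', div_le_iff₀ (by linarith)]
        nlinarith
      nlinarith
    have h2 := gate_factor_le hn2
    have h3 : √((16 / 5 * (2 * (63 * Real.log u / Real.log 2))) ^ 5) ≤
        √((C * Real.log u) ^ 5) := by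
      apply Real.sqrt_le_sqrt
      gcongr
    gcongr
    exact h2.trans h3
  obtain ⟨pU, hU, hU1, hU2⟩ := exists_multilinear_of_mem_lowDeg
    ((lowDeg d k).add_mem hp (const_mem_lowDeg k (√ε / 2)))
  obtain ⟨pD, hD, hD1, hD2⟩ := exists_multilinear_of_mem_lowDeg
    ((lowDeg d k).sub_mem hp (const_mem_lowDeg k (√ε / 2)))
  refine ⟨pU, pD, ⟨fun x => ?_, ?_⟩, hU1, hD1, le_trans (by exact_mod_cast hU2) hk',
    le_trans (by exact_mod_cast hD2) hk'⟩
  · have := abs_le.1 (hc x)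
    rw [hU, hD]
    simp only [Pi.add_apply, Pi.sub_apply]
    constructor <;> linarith [this.1, this.2]
  · have : ∀ x, (cubeEval pU x - cubeEval pD x) ^ 2 = ε := fun x => by
      rw [hU, hD]
      simp only [Pi.add_apply, Pi.sub_apply]
      rw [show p x + √ε / 2 - (p x - √ε / 2) = √ε by ring, Real.sq_sqrt hε.le]
    simp [this]

/-! ## Execution of programs -/

namespace RamState

@[simp] theorem setReg_reg (σ : RamState) (r : ℕ) (v : ℤ) (q : ℕ) :
    (σ.setReg r v).reg q = if q = r then v else σ.reg q := by
  simp [setReg, Function.update_apply]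

@[simp] theorem setReg_mem (σ : RamState) (r : ℕ) (v : ℤ) : (σ.setReg r v).mem = σ.mem := rfl

@[simp] theorem setMem_reg (σ : RamState) (a v : ℤ) : (σ.setMem a v).reg = σ.reg := rfl

@[simp] theorem setMem_mem (σ : RamState) (a v b : ℤ) :
    (σ.setMem a v).mem b = if b = a then v else σ.mem b := by
  simp [setMem, Function.update_apply]

/-- The states `σ` and `τ` agree on the registers below `b` and on the memory cells with
nonnegative addresses. -/
def Agree (b : ℕ) (σ τ : RamState) : Prop :=
  (∀ q < b, τ.reg q = σ.reg q) ∧ ∀ a : ℤ, 0 ≤ a → τ.mem a = σ.mem a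

theorem Agree.refl (b : ℕ) (σ : RamState) : Agree b σ σ := ⟨fun _ _ => rfl, fun _ _ => rfl⟩

theorem Agree.trans {b : ℕ} {σ τ ρ : RamState} (h : Agree b σ τ) (h' : Agree b τ ρ) :
    Agree b σ ρ :=
  ⟨fun q hq => (h'.1 q hq).trans (h.1 q hq), fun a ha => (h'.2 a ha).trans (h.2 a ha)⟩

theorem Agree.mono {b c : ℕ} {σ τ : RamState} (h : Agree b σ τ) (hc : c ≤ b) : Agree c σ τ :=
  ⟨fun q hq => h.1 q (hq.trans_le hc), h.2⟩

theorem Agree.setReg {b : ℕ} {σ τ : RamState} (h : Agree b σ τ) {r : ℕ} (hr : b ≤ r) (v : ℤ) :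
    Agree b σ (τ.setReg r v) := by
  refine ⟨fun q hq => ?_, h.2⟩
  rw [setReg_reg, if_neg (by omega), h.1 q hq]

theorem Agree.setMem {b : ℕ} {σ τ : RamState} (h : Agree b σ τ) {a : ℤ} (ha : a < 0) (v : ℤ) :
    Agree b σ (τ.setMem a v) := by
  refine ⟨h.1, fun q hq => ?_⟩
  rw [setMem_mem, if_neg (by omega), h.2 q hq]

end RamState

/-! ### A program logic that counts steps. -/

namespace Cmd

open RamState

/-- Started in `σ`, the program `c` terminates after at most `t` steps in a state that
satisfies `Q`. -/
def Wp (I : RamInput) (c : Cmd) (t : ℕ) (Q : RamState → Prop) (σ : RamState) : Prop :=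
  -- The number of steps and the final state do not depend on the rest `k` of the stack, which is
  -- what lets commands be composed.
  ∃ t' ≤ t, ∃ σ', Q σ' ∧ ∀ k, (step I)^[t'] (c :: k, σ) = (k, σ')

infixr:60 " ⨟ " => Cmd.seq

variable {I : RamInput} {c p q : Cmd} {t t₁ t₂ : ℕ} {Q Q' : RamState → Prop} {σ : RamState}

theorem Wp.mono (h : Wp I c t₁ Q σ) (ht : t₁ ≤ t₂) : Wp I c t₂ Q σ := by
  obtain ⟨t', ht', h⟩ := h
  exact ⟨t', ht'.trans ht, h⟩

theorem Wp.imp (h : Wp I c t Q σ) (hQ : ∀ τ, Q τ → Q' τ) : Wp I c t Q' σ := by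
  obtain ⟨t', ht', τ, h, hk⟩ := h
  exact ⟨t', ht', τ, hQ τ h, hk⟩

theorem Wp.run (h : Wp I c t Q σ) :
    ∃ τ, Q τ ∧ ∀ t' ≥ t, Cmd.run I c σ t' = ([], τ) := by
  obtain ⟨u, hu, τ, hQ, hk⟩ := h
  refine ⟨τ, hQ, fun t' ht' => ?_⟩
  obtain ⟨e, rfl⟩ := Nat.exists_eq_add_of_le (hu.trans ht')
  have : ∀ e, (step I)^[e] ([], τ) = ([], τ) := fun e =>
    Function.iterate_fixed (by simp [step]) e
  rw [Cmd.run, add_comm u e, Function.iterate_add_apply, hk, this]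

theorem wp_of_step {τ : RamState} (h : ∀ k, step I (c :: k, σ) = (k, τ)) (hQ : Q τ) :
    Wp I c 1 Q σ :=
  ⟨1, le_rfl, τ, hQ, fun k => by simp [h]⟩

theorem wp_const {r : ℕ} {v : ℤ} (h : Q (σ.setReg r v)) : Wp I (const r v) 1 Q σ :=
  wp_of_step (fun _ => by simp [step]) h

theorem wp_add {r a b : ℕ} (h : Q (σ.setReg r (σ.reg a + σ.reg b))) : Wp I (add r a b) 1 Q σ :=
  wp_of_step (fun _ => by simp [step]) h

theorem wp_sub {r a b : ℕ} (h : Q (σ.setReg r (σ.reg a - σ.reg b))) : Wp I (sub r a b) 1 Q σ :=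
  wp_of_step (fun _ => by simp [step]) h

theorem wp_load {r a : ℕ} (h : Q (σ.setReg r (σ.mem (σ.reg a)))) : Wp I (load r a) 1 Q σ :=
  wp_of_step (fun _ => by simp [step]) h

theorem wp_store {a r : ℕ} (h : Q (σ.setMem (σ.reg a) (σ.reg r))) : Wp I (store a r) 1 Q σ :=
  wp_of_step (fun _ => by simp [step]) h

theorem wp_read {r t i j : ℕ} (h : Q (σ.setReg r (I t (σ.reg i) (σ.reg j)))) :
    Wp I (read r t i j) 1 Q σ :=
  wp_of_step (fun _ => by simp [step]) h

theorem wp_seq (h : Wp I p t₁ (Wp I q t₂ Q) σ) : Wp I (p ⨟ q) (t₁ + t₂ + 1) Q σ := by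
  obtain ⟨u, hu, τ, ⟨v, hv, ρ, hQ, h2⟩, h1⟩ := h
  refine ⟨v + u + 1, by omega, ρ, hQ, fun k => ?_⟩
  rw [Function.iterate_succ_apply, show step I ((p ⨟ q) :: k, σ) = (p :: q :: k, σ) by
    simp [step], Function.iterate_add_apply, h1, h2]

theorem wp_branch {r : ℕ} (h₁ : 0 < σ.reg r → Wp I p t Q σ) (h₂ : ¬0 < σ.reg r → Wp I q t Q σ) :
    Wp I (branch r p q) (t + 1) Q σ := by
  by_cases hr : 0 < σ.reg r
  · obtain ⟨u, hu, τ, hQ, h⟩ := h₁ hr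
    refine ⟨u + 1, by omega, τ, hQ, fun k => ?_⟩
    rw [Function.iterate_succ_apply, ← h k]
    simp [step, hr]
  · obtain ⟨u, hu, τ, hQ, h⟩ := h₂ hr
    refine ⟨u + 1, by omega, τ, hQ, fun k => ?_⟩
    rw [Function.iterate_succ_apply, ← h k]
    simp [step, hr]

/-- A loop that makes `n` rounds. -/
theorem wp_loop {r : ℕ} (n : ℕ) (Inv : ℕ → RamState → Prop) (h0 : Inv 0 σ)
    (hstep : ∀ i < n, ∀ τ, Inv i τ → 0 < τ.reg r ∧ Wp I p t (Inv (i + 1)) τ)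
    (hend : ∀ τ, Inv n τ → ¬0 < τ.reg r ∧ Q τ) : Wp I (loop r p) (n * (t + 1) + 1) Q σ := by
  have key : ∀ m ≤ n, ∀ τ, Inv (n - m) τ → Wp I (loop r p) (m * (t + 1) + 1) Q τ := by
    intro m
    induction m with
    | zero =>
      intro _ τ hτ
      obtain ⟨h1, h2⟩ := hend τ hτ
      refine ⟨1, by omega, τ, h2, fun k => ?_⟩
      simp [step, h1]
    | succ m ih =>
      intro hm τ hτ
      obtain ⟨h1, u, hu, ρ, hρ, h2⟩ := hstep (n - (m + 1)) (by omega) τ hτ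
      rw [show n - (m + 1) + 1 = n - m by omega] at hρ
      obtain ⟨v, hv, π, hQ, h3⟩ := ih (by omega) ρ hρ
      refine ⟨v + u + 1, by rw [add_mul]; omega, π, hQ, fun k => ?_⟩
      rw [Function.iterate_succ_apply,
        show step I (loop r p :: k, τ) = (p :: loop r p :: k, τ) by simp [step, h1],
        Function.iterate_add_apply, h2, h3]
  exact key n le_rfl σ (by simpa using h0)

theorem wp_const_seq {r : ℕ} {v : ℤ} (h : Wp I q t Q (σ.setReg r v)) :
    Wp I (const r v ⨟ q) (t + 2) Q σ :=
  (wp_seq (wp_const h)).mono (by omega)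

theorem wp_add_seq {r a b : ℕ} (h : Wp I q t Q (σ.setReg r (σ.reg a + σ.reg b))) :
    Wp I (add r a b ⨟ q) (t + 2) Q σ :=
  (wp_seq (wp_add h)).mono (by omega)

theorem wp_sub_seq {r a b : ℕ} (h : Wp I q t Q (σ.setReg r (σ.reg a - σ.reg b))) :
    Wp I (sub r a b ⨟ q) (t + 2) Q σ :=
  (wp_seq (wp_sub h)).mono (by omega)

theorem wp_load_seq {r a : ℕ} (h : Wp I q t Q (σ.setReg r (σ.mem (σ.reg a)))) :
    Wp I (load r a ⨟ q) (t + 2) Q σ :=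
  (wp_seq (wp_load h)).mono (by omega)

theorem wp_store_seq {a r : ℕ} (h : Wp I q t Q (σ.setMem (σ.reg a) (σ.reg r))) :
    Wp I (store a r ⨟ q) (t + 2) Q σ :=
  (wp_seq (wp_store h)).mono (by omega)

theorem wp_read_seq {r u i j : ℕ} (h : Wp I q t Q (σ.setReg r (I u (σ.reg i) (σ.reg j)))) :
    Wp I (read r u i j ⨟ q) (t + 2) Q σ :=
  (wp_seq (wp_read h)).mono (by omega)

theorem wp_seq_of {R : RamState → Prop} (h₁ : Wp I p t₁ R σ) (h₂ : ∀ τ, R τ → Wp I q t₂ Q τ) :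
    Wp I (p ⨟ q) (t₁ + t₂ + 1) Q σ :=
  wp_seq (h₁.imp h₂)

/-- Execute `p` as many times as register `r` says, counting down in register `i`. Register `4` is
supposed to hold `1` and register `5` to hold `0`. -/
def rep (i r : ℕ) (p : Cmd) : Cmd := add i r 5 ⨟ loop i (p ⨟ sub i i 4)

/-- The body has to preserve the counter, and the invariant is asked for with an arbitrary value in
register `i`, so that decrementing the counter cannot disturb it. -/
theorem wp_rep {i r n : ℕ} (Inv : ℕ → RamState → Prop) (h5 : σ.reg 5 = 0) (hn : σ.reg r = n)
    (h0 : Inv 0 (σ.setReg i n))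
    (hstep : ∀ m < n, ∀ τ, Inv m τ →
      Wp I p t (fun τ' => τ'.reg i = τ.reg i ∧ τ'.reg 4 = 1 ∧
        ∀ v, Inv (m + 1) (τ'.setReg i v)) τ)
    (hend : ∀ τ, Inv n τ → Q τ) : Wp I (rep i r p) (n * (t + 3) + 3) Q σ := by
  refine (wp_add_seq (wp_loop (t := t + 2) n
    (fun m τ => Inv m τ ∧ τ.reg i = (n : ℤ) - m) ?_ ?_ ?_)).mono (le_of_eq (by ring))
  · simpa [h5, hn] using h0
  · rintro m hm τ ⟨hI, hi⟩
    refine ⟨by omega, (wp_seq_of (hstep m hm τ hI) fun τ' h => wp_sub ⟨h.2.2 _, ?_⟩)⟩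
    simp only [setReg_reg, if_true, h.1, h.2.1, hi]
    push_cast
    ring
  · rintro τ ⟨hI, hi⟩
    exact ⟨by omega, hend τ hI⟩

/-! ## The kernel `∑_{|S| ≤ K} χ_S(u) χ_S(v)` by dynamic programming

The value `e_j(z_1, …, z_c)` of an elementary symmetric polynomial is kept in memory cell
`-1 - j`; register `39` holds `K`. -/

/-- The `j`-th elementary symmetric polynomial of `z 0, …, z (c - 1)`. -/
def dpTab (z : ℕ → ℤ) : ℕ → ℕ → ℤ
  | 0, 0 => 1
  | 0, _ + 1 => 0
  | c + 1, 0 => dpTab z c 0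
  | c + 1, j + 1 => dpTab z c (j + 1) + z c * dpTab z c j

/-- Initialize the table. -/
def dpInit : Cmd :=
  const 50 (-1) ⨟ const 52 1 ⨟ store 50 52 ⨟ rep 51 39 (sub 50 50 4 ⨟ store 50 5)

/-- Multiply by `1 + z X`, where register `40` holds `z`. -/
def dpStep : Cmd :=
  sub 50 5 39 ⨟ sub 50 50 4 ⨟ rep 51 39 (add 52 50 4 ⨟ load 53 52 ⨟ load 54 50 ⨟
    branch 40 (add 54 54 53) (sub 54 54 53) ⨟ store 50 54 ⨟ add 50 52 5)

/-- Sum the table into register `55`. -/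
def dpSum : Cmd :=
  const 50 (-1) ⨟ load 55 50 ⨟ rep 51 39 (sub 50 50 4 ⨟ load 52 50 ⨟ add 55 55 52)

theorem wp_dpInit {K : ℕ} (z : ℕ → ℤ) (h4 : σ.reg 4 = 1) (h5 : σ.reg 5 = 0) (hK : σ.reg 39 = K) :
    Wp I dpInit (6 * K + 9) (fun τ => Agree 50 σ τ ∧
      ∀ j ≤ K, τ.mem (-1 - (j : ℤ)) = dpTab z 0 j) σ := by
  refine (wp_const_seq (wp_const_seq (wp_store_seq (wp_rep (t := 3) (n := K)
    (fun i τ => Agree 50 σ τ ∧ τ.reg 50 = -1 - (i : ℤ) ∧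
      ∀ j ≤ i, τ.mem (-1 - (j : ℤ)) = dpTab z 0 j)
    ?_ ?_ ?_ ?_ ?_)))).mono (by omega)
  · simpa using h5
  · simpa using hK
  · refine ⟨Agree.setReg (Agree.setMem (Agree.setReg (Agree.setReg (Agree.refl _ _)
      (by norm_num) _) (by norm_num) _) (by norm_num) _) (by norm_num) _, by simp, ?_⟩
    intro j hj
    obtain rfl : j = 0 := by omega
    simp [dpTab]
  · rintro m hm τ ⟨hA, h50, hmem⟩
    have e4 := hA.1 4 (by norm_num)
    have e5 := hA.1 5 (by norm_num)
    refine (wp_sub_seq (wp_store ⟨by simp, by simp [e4, h4], fun v => ⟨?_, ?_, ?_⟩⟩))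
    · refine Agree.setReg (Agree.setMem (Agree.setReg hA (by norm_num) _) ?_ _) (by norm_num) _
      simp [h50, e4, h4]; omega
    · simp [h50, e4, h4]; ring
    · intro j hj
      simp only [setReg_mem, setMem_mem, setReg_reg, if_true, h50, e4, h4]
      rcases Nat.lt_or_ge m j with hj' | hj'
      · obtain rfl : j = m + 1 := by omega
        rw [if_pos (by push_cast; ring)]
        simp [e5, h5, dpTab]
      · rw [if_neg (by omega), hmem j hj']
  · rintro τ ⟨hA, -, h⟩
    exact ⟨hA, h⟩

/-- The table is updated in place by `e_j := e_j + z e_{j-1}`, from `j = K` down to `j = 1`, so that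
`e_{j-1}` still has its old value when it is used. As `z = ±1`, a branch between addition and
subtraction replaces the multiplication. -/
theorem wp_dpStep {K c : ℕ} {z : ℕ → ℤ} (h4 : σ.reg 4 = 1) (h5 : σ.reg 5 = 0)
    (hK : σ.reg 39 = K) (h40 : σ.reg 40 = z c) (hz : z c = 1 ∨ z c = -1)
    (hmem : ∀ j ≤ K, σ.mem (-1 - (j : ℤ)) = dpTab z c j) :
    Wp I dpStep (15 * K + 7) (fun τ => Agree 50 σ τ ∧
      ∀ j ≤ K, τ.mem (-1 - (j : ℤ)) = dpTab z (c + 1) j) σ := by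
  refine (wp_sub_seq (wp_sub_seq (wp_rep (t := 12) (n := K)
    (fun i τ => Agree 50 σ τ ∧ τ.reg 50 = -1 - (K : ℤ) + i ∧
      ∀ j ≤ K, τ.mem (-1 - (j : ℤ)) = if K < j + i then dpTab z (c + 1) j else dpTab z c j)
    ?_ ?_ ?_ ?_ ?_))).mono (by omega)
  · simpa using h5
  · simpa using hK
  · refine ⟨Agree.setReg (Agree.setReg (Agree.setReg (Agree.refl _ _)
      (by norm_num) _) (by norm_num) _) (by norm_num) _, ?_, ?_⟩
    · simp [h4, h5, hK]; ring
    intro j hj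
    rw [if_neg (by omega)]
    simpa using hmem j hj
  · rintro m hm τ ⟨hA, h50, hm'⟩
    have e4 := (hA.1 4 (by norm_num)).trans h4
    have e5 := (hA.1 5 (by norm_num)).trans h5
    have e40 := (hA.1 40 (by norm_num)).trans h40
    obtain ⟨j, rfl⟩ : ∃ j, K = j + 1 + m := ⟨K - m - 1, by omega⟩
    have a1 : τ.mem (τ.reg 50 + 1) = dpTab z c j := by
      have := hm' j (by omega)
      rw [if_neg (by omega)] at this
      rw [← this, h50]; congr 1; push_cast; ring
    have a2 : τ.mem (τ.reg 50) = dpTab z c (j + 1) := by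
      have := hm' (j + 1) (by omega)
      rw [if_neg (by omega)] at this
      rw [← this, h50]; congr 1; push_cast; ring
    have key : ∀ ρ : RamState, Agree 50 σ ρ → ρ.reg 50 = τ.reg 50 → ρ.reg 52 = τ.reg 50 + 1 →
        ρ.reg 51 = τ.reg 51 → ρ.mem = τ.mem → ρ.reg 54 = dpTab z (c + 1) (j + 1) →
        Wp I (store 50 54 ⨟ add 50 52 5) 3 (fun τ' => τ'.reg 51 = τ.reg 51 ∧ τ'.reg 4 = 1 ∧
        ∀ v, (Agree 50 σ (τ'.setReg 51 v) ∧
          (τ'.setReg 51 v).reg 50 = -1 - ((j + 1 + m : ℕ) : ℤ) + (m + 1 : ℕ) ∧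
          ∀ i ≤ j + 1 + m, (τ'.setReg 51 v).mem (-1 - (i : ℤ)) =
            if j + 1 + m < i + (m + 1) then dpTab z (c + 1) i else dpTab z c i)) ρ := by
      intro ρ r1 r2 r3 r4 r5 r6
      have q4 := (r1.1 4 (by norm_num)).trans h4
      have q5 := (r1.1 5 (by norm_num)).trans h5
      refine wp_store_seq (wp_add ⟨by simp [r4], by simp [q4], fun v => ⟨?_, ?_, ?_⟩⟩)
      · refine Agree.setReg (Agree.setReg (Agree.setMem r1 ?_ _) (by norm_num) _) (by norm_num) _
        rw [r2, h50]; push_cast; omega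
      · simp [q5, r3, h50]; ring
      · intro i hi
        simp only [setReg_mem, setMem_mem, r2, h50, r6, r5]
        by_cases hij : i = j + 1
        · subst hij
          rw [if_pos (by push_cast; ring), if_pos (by omega)]
        · rw [if_neg (by push_cast; omega), hm' i hi]
          by_cases h : j + 1 + m < i + m
          · rw [if_pos h, if_pos (by omega)]
          · rw [if_neg h, if_neg (by omega)]
    refine (wp_add_seq (wp_load_seq (wp_load_seq (wp_seq (t₂ := 3)
      (wp_branch (t := 1) (fun hpos => ?_) fun hneg => ?_))))).mono (by omega)
    · have hz1 : z c = 1 := by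
        simp [e40] at hpos
        rcases hz with h | h <;> omega
      refine wp_add (key _ ?_ ?_ ?_ ?_ ?_ ?_)
      · repeat refine Agree.setReg ?_ (by norm_num) _
        exact hA
      · simp
      · simp [e4]
      · simp
      · simp
      · simp [e4, a1, a2, dpTab, hz1]
    · have hz1 : z c = -1 := by
        simp [e40] at hneg
        rcases hz with h | h <;> omega
      refine wp_sub (key _ ?_ ?_ ?_ ?_ ?_ ?_)
      · repeat refine Agree.setReg ?_ (by norm_num) _
        exact hA
      · simp
      · simp [e4]
      · simp
      · simp
      · simp [e4, a1, a2, dpTab, hz1]; ring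
  · rintro τ ⟨hA, -, h⟩
    refine ⟨hA, fun j hj => ?_⟩
    rw [h j hj]
    split_ifs with h'
    · rfl
    -- The cell of `e_0 = 1` is never rewritten.
    · obtain rfl : j = 0 := by omega
      rfl

theorem wp_dpSum {K : ℕ} {e : ℕ → ℤ} (h4 : σ.reg 4 = 1) (h5 : σ.reg 5 = 0)
    (hK : σ.reg 39 = K) (hmem : ∀ j ≤ K, σ.mem (-1 - (j : ℤ)) = e j) :
    Wp I dpSum (8 * K + 7) (fun τ => Agree 50 σ τ ∧
      τ.reg 55 = ∑ j ∈ Finset.range (K + 1), e j) σ := by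
  refine (wp_const_seq (wp_load_seq (wp_rep (t := 5) (n := K)
    (fun i τ => Agree 50 σ τ ∧ τ.mem = σ.mem ∧ τ.reg 50 = -1 - (i : ℤ) ∧
      τ.reg 55 = ∑ j ∈ Finset.range (i + 1), e j)
    ?_ ?_ ?_ ?_ ?_))).mono (by omega)
  · simpa using h5
  · simpa using hK
  · refine ⟨?_, by simp, by simp, ?_⟩
    · repeat refine Agree.setReg ?_ (by norm_num) _
      exact Agree.refl _ _
    · have := hmem 0 (by omega)
      simp at this
      simp [this]
  · rintro m hm τ ⟨hA, hm', h50, h55⟩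
    have e4 := (hA.1 4 (by norm_num)).trans h4
    refine (wp_sub_seq (wp_load_seq (wp_add ⟨by simp, by simp [e4], fun v =>
      ⟨?_, by simpa using hm', ?_, ?_⟩⟩)))
    · repeat refine Agree.setReg ?_ (by norm_num) _
      exact hA
    · simp [h50, e4]; ring
    · rw [Finset.sum_range_succ, ← hmem (m + 1) (by omega)]
      simp only [setReg_reg, setReg_mem, h50, e4, h55, hm']
      norm_num
      congr 1
      ring
  · rintro τ ⟨hA, -, -, h⟩
    exact ⟨hA, h⟩

/-- The kernel of two points of the cube, into register `55`. For the coordinate whose number is in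
register `41`, the program `fetch` puts the two signs into registers `43` and `44`. -/
def kernelCmd (fetch : Cmd) : Cmd :=
  dpInit ⨟ const 41 0 ⨟ rep 42 6 (fetch ⨟ branch 43 (add 40 44 5) (sub 40 5 44) ⨟ dpStep ⨟
    add 41 41 4) ⨟ dpSum

/-- The table lives at negative addresses and the scratch registers start at `40`, so the caller's
registers and the stored sample survive in the sense of `Agree`. -/
theorem wp_kernelCmd {K d tf : ℕ} {u v : ℕ → ℤ} {fetch : Cmd} (h4 : σ.reg 4 = 1)
    (h5 : σ.reg 5 = 0) (h6 : σ.reg 6 = d) (hK : σ.reg 39 = K)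
    (hu : ∀ c < d, u c = 1 ∨ u c = -1) (hv : ∀ c < d, v c = 1 ∨ v c = -1)
    (hf : ∀ c < d, ∀ τ, Agree 40 σ τ → τ.reg 41 = c → Wp I fetch tf (fun τ' => Agree 43 τ τ' ∧
      τ'.mem = τ.mem ∧ τ'.reg 43 = u c ∧ τ'.reg 44 = v c) τ) :
    Wp I (kernelCmd fetch) ((d + 1) * (15 * K + tf + 16) + 14 * K + 10) (fun τ => Agree 40 σ τ ∧
      τ.reg 55 = ∑ j ∈ Finset.range (K + 1), dpTab (fun c => u c * v c) d j) σ := by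
  refine (wp_seq_of (wp_dpInit (fun c => u c * v c) h4 h5 hK) fun τ hτ => wp_const_seq
    (wp_seq_of (t₂ := 8 * K + 7) (wp_rep (t := 15 * K + tf + 13) (n := d)
      (Q := fun ρ => Agree 40 σ ρ ∧
        ∀ j ≤ K, ρ.mem (-1 - (j : ℤ)) = dpTab (fun c => u c * v c) d j)
      (fun i ρ => Agree 40 σ ρ ∧ ρ.reg 41 = i ∧
        ∀ j ≤ K, ρ.mem (-1 - (j : ℤ)) = dpTab (fun c => u c * v c) i j)
      ?_ ?_ ?_ ?_ ?_) ?_)).mono ?_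
  rotate_right
  · ring_nf; omega
  · simpa using (hτ.1.1 5 (by norm_num)).trans h5
  · simpa using (hτ.1.1 6 (by norm_num)).trans h6
  · refine ⟨?_, by simp, fun j hj => by simpa using hτ.2 j hj⟩
    repeat refine Agree.setReg ?_ (by norm_num) _
    exact hτ.1.mono (by norm_num)
  · rintro m hm ρ ⟨hA, h41, hmem⟩
    refine (wp_seq_of (hf m hm ρ hA h41) ?_).mono (t₁ := tf + (15 * K + 12) + 1) (by omega)
    rintro π ⟨hπ, hπm, h43, h44⟩
    have hAπ : Agree 40 σ π := hA.trans (hπ.mono (by norm_num))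
    have e4 := (hAπ.1 4 (by norm_num)).trans h4
    have e5 := (hAπ.1 5 (by norm_num)).trans h5
    have key : ∀ w : ℤ, w = u m * v m → Wp I (dpStep ⨟ add 41 41 4) (15 * K + 9) (fun τ' =>
        τ'.reg 42 = ρ.reg 42 ∧ τ'.reg 4 = 1 ∧ ∀ x, (Agree 40 σ (τ'.setReg 42 x) ∧
          (τ'.setReg 42 x).reg 41 = (m + 1 : ℕ) ∧ ∀ j ≤ K, (τ'.setReg 42 x).mem (-1 - (j : ℤ)) =
            dpTab (fun c => u c * v c) (m + 1) j)) (π.setReg 40 w) := by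
      intro w hw
      refine (wp_seq_of (t₂ := 1) (wp_dpStep (K := K) (c := m) (z := fun c => u c * v c)
        ?_ ?_ ?_ ?_ ?_ ?_) ?_).mono (by omega)
      · simpa using e4
      · simpa using e5
      · simpa using (hAπ.1 39 (by norm_num)).trans hK
      · simpa using hw
      · rcases hu m hm with h | h <;> rcases hv m hm with h' | h' <;> simp [h, h']
      · simpa [hπm] using hmem
      · rintro κ ⟨hκ, hκm⟩
        have k42 := hκ.1 42 (by norm_num)
        have k41 := hκ.1 41 (by norm_num)
        have k4 := hκ.1 4 (by norm_num)
        have p41 := hπ.1 41 (by norm_num)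
        have p42 := hπ.1 42 (by norm_num)
        simp only [setReg_reg] at k42 k41 k4
        norm_num at k42 k41 k4
        refine wp_add ⟨by simp [k42, p42], by simp [k4, e4], fun x => ⟨?_, ?_, ?_⟩⟩
        · refine Agree.setReg (Agree.setReg ?_ (by norm_num) _) (by norm_num) _
          exact (Agree.setReg hAπ (by norm_num) _).trans (hκ.mono (by norm_num))
        · simp [k41, p41, h41, k4, e4]
        · simpa using hκm
    refine (wp_seq (wp_branch (t := 1) (fun hpos => wp_add ?_) fun hneg => wp_sub ?_)).mono
      (t₁ := 1 + 1 + (15 * K + 9) + 1) (by omega)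
    · refine key _ ?_
      rw [h43] at hpos
      rw [h44, e5]
      rcases hu m hm with h | h
      · rw [h]; ring
      · omega
    · refine key _ ?_
      rw [h43] at hneg
      rw [h44, e5]
      rcases hu m hm with h | h
      · omega
      · rw [h]; ring
  · rintro ρ ⟨hA, -, hmem⟩
    exact ⟨hA, hmem⟩
  · rintro ρ ⟨hA, hmem⟩
    refine (wp_dpSum ((hA.1 4 (by norm_num)).trans h4) ((hA.1 5 (by norm_num)).trans h5)
      ((hA.1 39 (by norm_num)).trans hK) hmem).imp ?_
    rintro κ ⟨hκ, h⟩
    exact ⟨hA.trans (hκ.mono (by norm_num)), h⟩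

end Cmd

/-! ## The learner -/

/-! ### Arithmetic subroutines and the parameters of the learner. -/

namespace Cmd

open RamState

variable {I : RamInput} {Q : RamState → Prop} {σ : RamState}

/-- Double register `r` `n` times. -/
def dbls (r : ℕ) : ℕ → Cmd
  | 0 => add r r 5
  | n + 1 => add r r r ⨟ dbls r n

theorem wp_dbls {r n : ℕ} (hr : r ≠ 5) (h5 : σ.reg 5 = 0)
    (h : Q (σ.setReg r (2 ^ n * σ.reg r))) : Wp I (dbls r n) (2 * n + 1) Q σ := by
  induction n generalizing σ with
  | zero => exact wp_add (by simpa [h5] using h)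
  | succ n ih =>
    refine wp_add_seq (ih ?_ ?_)
    · simpa [Ne.symm hr] using h5
    · convert h using 1
      simp only [setReg, Function.update_idem, Function.update_self]
      congr 2
      ring

/-- Add `⌈log₂ x⌉` to register `o`. -/
def bitsCmd (o x : ℕ) : Cmd :=
  const (o + 1) 1 ⨟ sub (o + 2) x (o + 1) ⨟
    loop (o + 2) (add (o + 1) (o + 1) (o + 1) ⨟ add o o 4 ⨟ sub (o + 2) x (o + 1))

theorem wp_bitsCmd {o x n b : ℕ} (ho : 5 < o) (hx : x < o) (h4 : σ.reg 4 = 1)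
    (hn : σ.reg x = n) (hb : σ.reg o = b) :
    Wp I (bitsCmd o x) (6 * Nat.clog 2 n + 5) (fun τ => Agree o σ τ ∧
      τ.reg o = (b + Nat.clog 2 n : ℕ)) σ := by
  refine (wp_const_seq (wp_sub_seq (wp_loop (t := 5) (Nat.clog 2 n)
    (fun i τ => Agree o σ τ ∧ τ.reg o = (b + i : ℕ) ∧ τ.reg (o + 1) = 2 ^ i ∧
      τ.reg (o + 2) = n - 2 ^ i) ?_ ?_ ?_))).mono (by omega)
  · refine ⟨?_, by simp [hb], by simp, ?_⟩
    · exact Agree.setReg (Agree.setReg (Agree.refl _ _) (by omega) _) (by omega) _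
    · simp [show x ≠ o + 1 by omega, hn]
  · rintro i hi τ ⟨hA, h0, h1, h2⟩
    refine ⟨?_, ?_⟩
    · have : (2 : ℤ) ^ i < n := by exact_mod_cast (Nat.lt_clog_iff_pow_lt (by norm_num)).1 hi
      omega
    · refine (wp_add_seq (wp_add_seq (wp_sub ⟨?_, ?_, ?_, ?_⟩)))
      · exact Agree.setReg (Agree.setReg (Agree.setReg hA (by omega) _) (by omega) _) (by omega) _
      · have := hA.1 4 (by omega)
        simp [h0, show (4 : ℕ) ≠ o + 1 by omega, this, h4]
        ring
      · simp [h1]; ring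
      · have := hA.1 x (by omega)
        simp [h1, show x ≠ o + 1 by omega, show x ≠ o by omega, this, hn]
        ring
  · rintro τ ⟨hA, h0, -, h2⟩
    refine ⟨?_, hA, h0⟩
    have : (n : ℤ) ≤ 2 ^ Nat.clog 2 n := by exact_mod_cast Nat.le_pow_clog (by norm_num) n
    omega

/-- Multiply register `8` as often as register `7` says by register `6`. -/
def powCmd : Cmd :=
  rep 9 7 (const 10 0 ⨟ rep 11 6 (add 10 10 8) ⨟ add 8 10 5)

/-- Every multiplication by `H` is `H` additions. This is affordable because `H` is only of
logarithmic size. -/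
theorem wp_powCmd {H e v : ℕ} (h4 : σ.reg 4 = 1) (h5 : σ.reg 5 = 0) (h6 : σ.reg 6 = H)
    (h7 : σ.reg 7 = e) (h8 : σ.reg 8 = v) :
    Wp I powCmd (e * (4 * H + 10) + 3) (fun τ => Agree 8 σ τ ∧
      τ.reg 8 = (v * H ^ e : ℕ)) σ := by
  refine (wp_rep (t := 4 * H + 7) (n := e) (fun i τ => Agree 8 σ τ ∧ τ.reg 8 = (v * H ^ i : ℕ))
    h5 h7 ?_ ?_ fun τ h => h).mono (le_of_eq (by ring))
  · exact ⟨Agree.setReg (Agree.refl _ _) (by norm_num) _, by simp [h8]⟩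
  · rintro i hi τ ⟨hA, ht⟩
    have e4 := (hA.1 4 (by norm_num)).trans h4
    have e5 := (hA.1 5 (by norm_num)).trans h5
    have e6 := (hA.1 6 (by norm_num)).trans h6
    refine (wp_const_seq (wp_seq_of (t₂ := 1) (wp_rep (t := 1) (n := H)
      (Q := fun ρ => Agree 10 τ ρ ∧ ρ.reg 10 = H * τ.reg 8)
      (fun j ρ => Agree 10 τ ρ ∧ ρ.reg 10 = j * τ.reg 8) ?_ ?_ ?_ ?_ fun τ h => h) ?_)).mono
      (by omega)
    · simpa using e5
    · simpa using e6
    · exact ⟨Agree.setReg (Agree.setReg (Agree.refl _ _) (by norm_num) _) (by norm_num) _, by simp⟩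
    · rintro j hj ρ ⟨hB, hρ⟩
      refine wp_add ⟨by simp, ?_, fun w => ⟨?_, ?_⟩⟩
      · simpa using (hB.1 4 (by norm_num)).trans e4
      · exact Agree.setReg (Agree.setReg hB (by norm_num) _) (by norm_num) _
      · have := hB.1 8 (by norm_num)
        simp [hρ, this]; ring
    · rintro ρ ⟨hB, hρ⟩
      refine wp_add ⟨?_, ?_, fun w => ⟨?_, ?_⟩⟩
      · simpa using (hB.1 9 (by norm_num))
      · simpa using (hB.1 4 (by norm_num)).trans e4
      · refine Agree.setReg (Agree.setReg ?_ (by norm_num) _) (by norm_num) _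
        exact hA.trans (hB.mono (by norm_num))
      · have := (hB.1 5 (by norm_num)).trans e5
        simp [hρ, this, ht]; ring

/-- The least number whose square is at least `v`, for `v ≥ 1`. -/
def ceilSqrt (v : ℕ) : ℕ := Nat.sqrt (v - 1) + 1

theorem le_ceilSqrt_sq {v : ℕ} : v ≤ ceilSqrt v ^ 2 := by
  have := Nat.lt_succ_sqrt (v - 1)
  rw [ceilSqrt, pow_two]
  simp only [Nat.succ_eq_add_one] at this
  omega

theorem sq_lt_of_lt_ceilSqrt {v i : ℕ} (hv : 1 ≤ v) (hi : i < ceilSqrt v) : i ^ 2 < v := by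
  have h1 : i ≤ Nat.sqrt (v - 1) := Nat.lt_succ_iff.1 hi
  have h2 := Nat.sqrt_le' (v - 1)
  have h3 : i ^ 2 ≤ Nat.sqrt (v - 1) ^ 2 := Nat.pow_le_pow_left h1 2
  omega

/-- The rounded up square root of register `8`, into register `9`. -/
def sqrtCmd : Cmd :=
  const 9 0 ⨟ const 10 0 ⨟ sub 11 8 10 ⨟ loop 11 (add 10 10 9 ⨟ add 10 10 9 ⨟ add 10 10 4 ⨟
    add 9 9 4 ⨟ sub 11 8 10)

/-- A linear search that updates `i²` by `2i + 1`. The time is proportional to the root, here the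
degree, while the total time allowed is exponential in the degree. -/
theorem wp_sqrtCmd {v : ℕ} (hv : 1 ≤ v) (h4 : σ.reg 4 = 1) (h8 : σ.reg 8 = v) :
    Wp I sqrtCmd (10 * ceilSqrt v + 7) (fun τ => Agree 9 σ τ ∧ τ.reg 9 = ceilSqrt v) σ := by
  refine (wp_const_seq (wp_const_seq (wp_sub_seq (wp_loop (t := 9) (ceilSqrt v)
    (fun i τ => Agree 9 σ τ ∧ τ.reg 9 = i ∧ τ.reg 10 = (i : ℤ) ^ 2 ∧
      τ.reg 11 = v - (i : ℤ) ^ 2) ?_ ?_ ?_)))).mono (by omega)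
  · refine ⟨?_, by simp, by simp, by simp [h8]⟩
    repeat refine Agree.setReg ?_ (by norm_num) _
    exact Agree.refl _ _
  · rintro i hi τ ⟨hA, h9, h10, h11⟩
    refine ⟨?_, ?_⟩
    · have : (i : ℤ) ^ 2 < v := by exact_mod_cast sq_lt_of_lt_ceilSqrt hv hi
      omega
    · have e4 := (hA.1 4 (by norm_num)).trans h4
      have e8 := (hA.1 8 (by norm_num)).trans h8
      refine (wp_add_seq (wp_add_seq (wp_add_seq (wp_add_seq (wp_sub ⟨?_, ?_, ?_, ?_⟩)))))
      · repeat refine Agree.setReg ?_ (by norm_num) _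
        exact hA
      · simp [h9, e4]
      · simp [h9, h10, e4]; ring
      · simp [h9, h10, e4, e8]; ring
  · rintro τ ⟨hA, h9, -, h11⟩
    refine ⟨?_, hA, h9⟩
    have : (v : ℤ) ≤ (ceilSqrt v : ℤ) ^ 2 := by exact_mod_cast le_ceilSqrt_sq
    omega

/-- Powers of two with exponents `6 q`, `12 q`, `10 q`, for the product `q` of the registers `9`
and `11`. -/
def sizesCmd : Cmd :=
  const 12 1 ⨟ const 13 1 ⨟ const 14 1 ⨟
    rep 15 9 (rep 16 11 (dbls 12 6 ⨟ dbls 13 12 ⨟ dbls 14 10))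

theorem wp_sizesCmd {k a : ℕ} (h4 : σ.reg 4 = 1) (h5 : σ.reg 5 = 0) (h9 : σ.reg 9 = k)
    (h11 : σ.reg 11 = a) :
    Wp I sizesCmd (k * (64 * a + 6) + 9) (fun τ => Agree 12 σ τ ∧
      τ.reg 12 = 2 ^ (6 * (a * k)) ∧ τ.reg 13 = 2 ^ (12 * (a * k)) ∧
      τ.reg 14 = 2 ^ (10 * (a * k))) σ := by
  refine (wp_const_seq (wp_const_seq (wp_const_seq (wp_rep (t := 64 * a + 3) (n := k)
    (fun i τ => Agree 12 σ τ ∧ τ.reg 12 = 2 ^ (6 * (a * i)) ∧ τ.reg 13 = 2 ^ (12 * (a * i)) ∧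
      τ.reg 14 = 2 ^ (10 * (a * i))) ?_ ?_ ?_ ?_ fun τ h => h)))).mono (le_of_eq (by ring))
  · simpa using h5
  · simpa using h9
  · refine ⟨?_, by simp, by simp, by simp⟩
    repeat refine Agree.setReg ?_ (by norm_num) _
    exact Agree.refl _ _
  · rintro i hi τ ⟨hA, t12, t13, t14⟩
    have e4 := (hA.1 4 (by norm_num)).trans h4
    have e5 := (hA.1 5 (by norm_num)).trans h5
    have e11 := (hA.1 11 (by norm_num)).trans h11
    refine (wp_rep (t := 61) (n := a)
      (fun j ρ => (Agree 12 τ ρ ∧ ρ.reg 15 = τ.reg 15) ∧ ρ.reg 12 = 2 ^ (6 * (a * i + j)) ∧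
        ρ.reg 13 = 2 ^ (12 * (a * i + j)) ∧ ρ.reg 14 = 2 ^ (10 * (a * i + j)))
      e5 e11 ?_ ?_ ?_).mono (by omega)
    · exact ⟨⟨Agree.setReg (Agree.refl _ _) (by norm_num) _, by simp⟩, by simp [t12], by simp [t13],
        by simp [t14]⟩
    · rintro j hj ρ ⟨⟨hB, b15⟩, b12, b13, b14⟩
      have f5 := (hB.1 5 (by norm_num)).trans e5
      have f4 := (hB.1 4 (by norm_num)).trans e4
      refine (wp_seq (wp_dbls (by norm_num) f5 (wp_seq (wp_dbls (by norm_num) (by simpa using f5)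
        (wp_dbls (by norm_num) (by simpa using f5)
          ⟨by simp, by simpa using f4, fun w => ⟨⟨?_, ?_⟩, ?_, ?_, ?_⟩⟩))))).mono (by norm_num)
      · repeat refine Agree.setReg ?_ (by norm_num) _
        exact hB
      · simp [b15]
      · simp only [setReg_reg]; norm_num; rw [b12]; ring
      · simp only [setReg_reg]; norm_num; rw [b13]; ring
      · simp only [setReg_reg]; norm_num; rw [b14]; ring
    · rintro ρ ⟨⟨hB, b15⟩, b12, b13, b14⟩
      refine ⟨b15, (hB.1 4 (by norm_num)).trans e4, fun w => ⟨?_, ?_, ?_, ?_⟩⟩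
      · exact Agree.setReg (hA.trans hB) (by norm_num) _
      · simpa [mul_add] using b12
      · simpa [mul_add] using b13
      · simpa [mul_add] using b14

/-! The parameters -/

/-- An upper bound for the binary logarithm of `8 s E`. -/
def logParam (s E : ℕ) : ℕ := 3 + Nat.clog 2 s + Nat.clog 2 E

/-- The square of the degree, before rounding. -/
def sqParam (s l E : ℕ) : ℕ := s * (128 * logParam s E) ^ (5 * l)

/-- The degree. -/
def degParam (s l E : ℕ) : ℕ := ceilSqrt (sqParam s l E)

/-- The logarithm of the bound for the number of sets of coordinates. -/
def expParam (d s l E : ℕ) : ℕ := Nat.clog 2 (d + 1) * degParam s l E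

/-- Compute the parameters. Afterwards register `9` holds the degree, register `12` the
sample size, and the sum of the registers `13` and `14` the threshold of the test. -/
def paramCmd : Cmd :=
  const 4 1 ⨟ const 6 3 ⨟ bitsCmd 6 1 ⨟ bitsCmd 6 3 ⨟ dbls 6 7 ⨟ add 7 2 2 ⨟ add 7 7 7 ⨟
    add 7 7 2 ⨟ add 8 1 5 ⨟ powCmd ⨟ sqrtCmd ⨟ add 10 0 4 ⨟ const 11 0 ⨟ bitsCmd 11 10 ⨟
    sizesCmd ⨟ add 6 0 5 ⨟ add 7 9 9

theorem one_le_sqParam {s l E : ℕ} (hs : 1 ≤ s) : 1 ≤ sqParam s l E := by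
  refine Nat.mul_pos hs (pow_pos ?_ _)
  unfold logParam
  omega

/-- The degree has the half-integral power `5l/2` in it; its square `s · (128 G)^(5l)`, with `G` the
value of `logParam`, is an integer, and a rounded root is taken at the end. Write `X = 2^expParam`;
then the sample size is `X^6`, and the two summands of the threshold are `X^12` and `X^10`. -/
theorem wp_paramCmd {d s l E : ℕ} (hs : 1 ≤ s) :
    Wp I paramCmd (6 * logParam s E + 5 * l * (512 * logParam s E + 10) +
        10 * degParam s l E + 6 * Nat.clog 2 (d + 1) +
        degParam s l E * (64 * Nat.clog 2 (d + 1) + 6) + 90)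
      (fun τ => τ.reg 4 = 1 ∧ τ.reg 5 = 0 ∧ τ.reg 6 = d ∧ τ.reg 7 = (2 * degParam s l E : ℕ) ∧
        τ.reg 9 = degParam s l E ∧ τ.reg 12 = (2 ^ (6 * expParam d s l E) : ℕ) ∧
        τ.reg 13 = 2 ^ (12 * expParam d s l E) ∧ τ.reg 14 = 2 ^ (10 * expParam d s l E))
      (initState [d, s, l, E]) := by
  refine (wp_const_seq (wp_const_seq (wp_seq_of (t₂ := ?t) (wp_bitsCmd (n := s) (b := 3)
    (by norm_num) (by norm_num) (by simp) (by simp [initState]) (by simp)) ?_))).mono ?ht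
  case t => exact 6 * Nat.clog 2 E + 5 * l * (512 * logParam s E + 10) + 10 * degParam s l E +
    6 * Nat.clog 2 (d + 1) + degParam s l E * (64 * Nat.clog 2 (d + 1) + 6) + 80
  case ht => unfold logParam; omega
  rintro τ ⟨hA, h6⟩
  have r0 : τ.reg 0 = d := by rw [hA.1 0 (by norm_num)]; simp [initState]
  have r1 : τ.reg 1 = s := by rw [hA.1 1 (by norm_num)]; simp [initState]
  have r2 : τ.reg 2 = l := by rw [hA.1 2 (by norm_num)]; simp [initState]
  have r3 : τ.reg 3 = E := by rw [hA.1 3 (by norm_num)]; simp [initState]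
  have r4 : τ.reg 4 = 1 := by rw [hA.1 4 (by norm_num)]; simp
  have r5 : τ.reg 5 = 0 := by rw [hA.1 5 (by norm_num)]; simp [initState]
  clear hA
  refine (wp_seq_of (t₂ := ?t) (wp_bitsCmd (n := E) (b := 3 + Nat.clog 2 s) (by norm_num)
    (by norm_num) r4 r3 h6) ?_).mono ?ht
  case t => exact 5 * l * (512 * logParam s E + 10) + 10 * degParam s l E +
    6 * Nat.clog 2 (d + 1) + degParam s l E * (64 * Nat.clog 2 (d + 1) + 6) + 74
  case ht => omega
  clear h6
  rintro ρ ⟨hA, h6⟩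
  rw [← hA.1 0 (by norm_num)] at r0
  rw [← hA.1 1 (by norm_num)] at r1
  rw [← hA.1 2 (by norm_num)] at r2
  rw [← hA.1 4 (by norm_num)] at r4
  rw [← hA.1 5 (by norm_num)] at r5
  clear hA r3
  refine (wp_seq (t₂ := ?t) (wp_dbls (by norm_num) r5 ?_)).mono ?ht
  case t => exact 5 * l * (512 * logParam s E + 10) + 10 * degParam s l E +
    6 * Nat.clog 2 (d + 1) + degParam s l E * (64 * Nat.clog 2 (d + 1) + 6) + 58
  case ht => omega
  refine (wp_add_seq (wp_add_seq (wp_add_seq (wp_add_seq (wp_seq_of (t₂ := ?t)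
    (wp_powCmd (H := 128 * logParam s E) (e := 5 * l) (v := s) ?_ ?_ ?_ ?_ ?_) ?_))))).mono ?ht
  case t => exact 10 * degParam s l E +
    6 * Nat.clog 2 (d + 1) + degParam s l E * (64 * Nat.clog 2 (d + 1) + 6) + 46
  case ht => rw [show 4 * (128 * logParam s E) = 512 * logParam s E by ring]; omega
  · simpa using r4
  · simpa using r5
  · simp [h6, logParam]
  · simp [r2]; ring
  · simp [r1, r5]
  rintro π ⟨hA, h8⟩
  have s0 : π.reg 0 = d := by rw [hA.1 0 (by norm_num)]; simp [r0]
  have s4 : π.reg 4 = 1 := by rw [hA.1 4 (by norm_num)]; simp [r4]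
  have s5 : π.reg 5 = 0 := by rw [hA.1 5 (by norm_num)]; simp [r5]
  clear hA
  refine (wp_seq_of (t₂ := ?t) (wp_sqrtCmd (one_le_sqParam (l := l) (E := E) hs) s4 h8) ?_).mono ?ht
  case t => exact 6 * Nat.clog 2 (d + 1) + degParam s l E * (64 * Nat.clog 2 (d + 1) + 6) + 38
  case ht => unfold degParam; omega
  clear r0 r1 r2 r4 r5 h6
  rintro κ ⟨hA, h9⟩
  rw [← hA.1 0 (by norm_num)] at s0
  rw [← hA.1 4 (by norm_num)] at s4
  rw [← hA.1 5 (by norm_num)] at s5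
  clear hA
  refine (wp_add_seq (wp_const_seq (wp_seq_of (t₂ := ?t) (wp_bitsCmd (n := d + 1) (b := 0)
    (by norm_num) (by norm_num) ?_ ?_ ?_) ?_))).mono ?ht
  case t => exact degParam s l E * (64 * Nat.clog 2 (d + 1) + 6) + 28
  case ht => omega
  · simpa using s4
  · simp [s0, s4]
  · simp
  rintro μ ⟨hA, h11⟩
  have t0 : μ.reg 0 = d := by rw [hA.1 0 (by norm_num)]; simp [s0]
  have t4 : μ.reg 4 = 1 := by rw [hA.1 4 (by norm_num)]; simp [s4]
  have t5 : μ.reg 5 = 0 := by rw [hA.1 5 (by norm_num)]; simp [s5]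
  have t9 : μ.reg 9 = degParam s l E := by rw [hA.1 9 (by norm_num)]; simp [h9, degParam]
  rw [zero_add] at h11
  refine (wp_seq_of (t₂ := 3) (wp_sizesCmd t4 t5 t9 h11) ?_).mono (by omega)
  rintro ν ⟨hB, n12, n13, n14⟩
  have u0 := (hB.1 0 (by norm_num)).trans t0
  have u4 := (hB.1 4 (by norm_num)).trans t4
  have u5 := (hB.1 5 (by norm_num)).trans t5
  have u9 := (hB.1 9 (by norm_num)).trans t9
  refine wp_add_seq (wp_add ⟨?_, ?_, ?_, ?_, ?_, ?_, ?_, ?_⟩)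
  · simpa using u4
  · simpa using u5
  · simp [u0, u5]
  · simp [u9]; ring
  · simpa using u9
  · simp [n12, expParam]
  · simp [n13, expParam]
  · simp [n14, expParam]

end Cmd

/-! ### Storing the sample, the moment test and the prediction. -/

namespace Cmd

open RamState

variable {I : RamInput} {Q : RamState → Prop} {σ : RamState}

/-- Copy the labelled sample to the memory: each label is followed by its point. -/
def storeCmd : Cmd :=
  const 20 0 ⨟ const 21 0 ⨟ rep 22 12 (read 23 1 21 5 ⨟ store 20 23 ⨟ add 20 20 4 ⨟ const 24 0 ⨟
    rep 25 6 (read 23 0 21 24 ⨟ store 20 23 ⨟ add 20 20 4 ⨟ add 24 24 4) ⨟ add 21 21 4)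

/-- The memory after `storeCmd`. -/
def storedAt (I : RamInput) (d a : ℕ) : ℤ :=
  if a % (d + 1) = 0 then I 1 (a / (d + 1) : ℕ) 0 else I 0 (a / (d + 1) : ℕ) (a % (d + 1) - 1 : ℕ)

theorem storedAt_label (I : RamInput) (d i : ℕ) : storedAt I d (i * (d + 1)) = I 1 i 0 := by
  simp [storedAt]

theorem storedAt_coord (I : RamInput) {d i c : ℕ} (hc : c < d) :
    storedAt I d (i * (d + 1) + 1 + c) = I 0 i c := by
  have h1 : (i * (d + 1) + 1 + c) % (d + 1) = 1 + c := by
    rw [add_assoc, mul_comm, Nat.mul_add_mod, Nat.mod_eq_of_lt (by omega)]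
  have h2 : (i * (d + 1) + 1 + c) / (d + 1) = i := by
    rw [add_assoc, mul_comm, Nat.mul_add_div (by omega), Nat.div_eq_of_lt (by omega), add_zero]
  rw [storedAt, h1, h2, if_neg (by omega), show 1 + c - 1 = c by omega]

/-- The copy is necessary since `predict` reads only the point to be classified, and not the sample.
Example `i` occupies the `d + 1` cells from `i (d + 1)` on. -/
theorem wp_storeCmd {N d : ℕ} (h4 : σ.reg 4 = 1) (h5 : σ.reg 5 = 0) (h6 : σ.reg 6 = d)
    (h12 : σ.reg 12 = N) :
    Wp I storeCmd (N * (10 * d + 16) + 7) (fun τ => (∀ q < 20, τ.reg q = σ.reg q) ∧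
      ∀ a < N * (d + 1), τ.mem a = storedAt I d a) σ := by
  refine (wp_const_seq (wp_const_seq (wp_rep (t := 10 * d + 13) (n := N)
    (fun i τ => (∀ q < 20, τ.reg q = σ.reg q) ∧ τ.reg 20 = (i * (d + 1) : ℕ) ∧ τ.reg 21 = i ∧
      ∀ a < i * (d + 1), τ.mem a = storedAt I d a) ?_ ?_ ?_ ?_ ?_))).mono (by ring_nf; omega)
  · simpa using h5
  · simpa using h12
  · refine ⟨fun q hq => ?_, by simp, by simp, by simp⟩
    simp only [setReg_reg]
    rw [if_neg (by omega), if_neg (by omega), if_neg (by omega)]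
  · rintro i hi τ ⟨hA, h20, h21, hmem⟩
    have e4 := (hA 4 (by norm_num)).trans h4
    have e5 := (hA 5 (by norm_num)).trans h5
    have e6 := (hA 6 (by norm_num)).trans h6
    refine (wp_read_seq (wp_store_seq (wp_add_seq (wp_const_seq (wp_seq_of (t₂ := 1)
      (wp_rep (t := 7) (n := d)
      (Q := fun ρ => ((∀ q < 20, ρ.reg q = σ.reg q) ∧ ρ.reg 22 = τ.reg 22 ∧ ρ.reg 21 = i) ∧
        ρ.reg 20 = (i * (d + 1) + 1 + d : ℕ) ∧
        ∀ a < i * (d + 1) + 1 + d, ρ.mem a = storedAt I d a)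
      (fun c ρ => ((∀ q < 20, ρ.reg q = σ.reg q) ∧ ρ.reg 22 = τ.reg 22 ∧ ρ.reg 21 = i) ∧
        (ρ.reg 20 = (i * (d + 1) + 1 + c : ℕ) ∧ ρ.reg 24 = c) ∧
        ∀ a < i * (d + 1) + 1 + c, ρ.mem a = storedAt I d a) ?_ ?_ ?_ ?_ ?_) ?_))))).mono ?_
    · simpa using e5
    · simpa using e6
    · refine ⟨⟨fun q hq => ?_, by simp, by simp [h21]⟩, ⟨?_, by simp⟩, fun a ha => ?_⟩
      · simp only [setReg_reg, setMem_reg]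
        rw [if_neg (by omega), if_neg (by omega), if_neg (by omega), if_neg (by omega), hA q hq]
      · simp [h20, e4]
      · simp only [setReg_reg, setMem_reg, setReg_mem, setMem_mem]
        norm_num
        rw [h20, h21, e5]
        rcases Nat.lt_or_ge a (i * (d + 1)) with h | h
        · rw [if_neg (by exact_mod_cast h.ne), hmem a h]
        · obtain rfl : a = i * (d + 1) := by omega
          rw [if_pos rfl, storedAt_label]
    · rintro c hc ρ ⟨⟨hB, b22, b21⟩, ⟨b20, b24⟩, bm⟩
      have f4 := (hB 4 (by norm_num)).trans h4
      refine (wp_read_seq (wp_store_seq (wp_add_seq (wp_add ⟨by simp, by simp [f4], fun w =>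
        ⟨⟨fun q hq => ?_, by simp [b22], by simp [b21]⟩, ⟨?_, ?_⟩, fun a ha => ?_⟩⟩))))
      · simp only [setReg_reg, setMem_reg]
        rw [if_neg (by omega), if_neg (by omega), if_neg (by omega), if_neg (by omega), hB q hq]
      · simp [b20, f4]; ring
      · simp [b24, f4]
      · simp only [setReg_reg, setMem_reg, setReg_mem, setMem_mem]
        norm_num
        rw [b20, b21, b24]
        rcases Nat.lt_or_ge a (i * (d + 1) + 1 + c) with h | h
        · rw [if_neg (by exact_mod_cast h.ne), bm a h]
        · obtain rfl : a = i * (d + 1) + 1 + c := by omega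
          rw [if_pos rfl, storedAt_coord I hc]
    · rintro ρ ⟨h1, h2, h3⟩
      exact ⟨h1, h2.1, h3⟩
    · rintro ρ ⟨⟨hB, b22, b21⟩, b20, bm⟩
      have f4 := (hB 4 (by norm_num)).trans h4
      refine wp_add ⟨by simp [b22], by simp [f4], fun w => ⟨fun q hq => ?_, ?_, ?_, ?_⟩⟩
      · simp only [setReg_reg]
        rw [if_neg (by omega), if_neg (by omega), hB q hq]
      · simp [b20]; ring
      · simp [b21, f4]
      · intro a ha
        exact bm a (by rw [add_mul] at ha; omega)
    · omega
  · rintro τ ⟨hA, -, -, h⟩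
    exact ⟨hA, h⟩

/-- The kernel of the points `u` and `v`. -/
def kernelVal (K d : ℕ) (u v : ℕ → ℤ) : ℤ :=
  ∑ j ∈ Finset.range (K + 1), dpTab (fun c => u c * v c) d j

/-- Accept if the sum of the kernel over the pairs of unlabelled examples is at most the
threshold. -/
def testCmd : Cmd :=
  add 39 7 5 ⨟ const 26 0 ⨟ const 27 0 ⨟ rep 28 12 (const 29 0 ⨟
    rep 30 12 (kernelCmd (read 43 2 27 41 ⨟ read 44 2 29 41) ⨟ add 26 26 55 ⨟ add 29 29 4) ⨟
    add 27 27 4) ⨟ add 31 13 14 ⨟ sub 31 31 26 ⨟ add 0 31 4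

theorem wp_testCmd {N d K : ℕ} (h4 : σ.reg 4 = 1) (h5 : σ.reg 5 = 0) (h6 : σ.reg 6 = d)
    (h12 : σ.reg 12 = N) (h7 : σ.reg 7 = K)
    (hI : ∀ i < N, ∀ c < d, I 2 i c = 1 ∨ I 2 i c = -1) :
    Wp I testCmd (N * (N * ((d + 1) * (15 * K + 19) + 14 * K + 17) + 10) + 15)
      (fun τ => (∀ q < 20, q ≠ 0 → τ.reg q = σ.reg q) ∧ (∀ a : ℤ, 0 ≤ a → τ.mem a = σ.mem a) ∧
        (0 < τ.reg 0 ↔ ∑ i ∈ Finset.range N, ∑ j ∈ Finset.range N,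
          kernelVal K d (fun c => I 2 i c) (fun c => I 2 j c) ≤ σ.reg 13 + σ.reg 14)) σ := by
  set F : ℕ → ℕ → ℤ := fun i j => kernelVal K d (fun c => I 2 i c) (fun c => I 2 j c) with hF
  refine (wp_add_seq (wp_const_seq (wp_const_seq (wp_seq_of (t₂ := 5) (wp_rep
    (t := N * ((d + 1) * (15 * K + 19) + 14 * K + 17) + 7) (n := N)
    (Q := fun τ => Agree 20 σ τ ∧ τ.reg 26 = ∑ i ∈ Finset.range N, ∑ j ∈ Finset.range N, F i j)
    (fun i τ => (Agree 20 σ τ ∧ τ.reg 39 = K) ∧ τ.reg 27 = i ∧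
      τ.reg 26 = ∑ i ∈ Finset.range i, ∑ j ∈ Finset.range N, F i j)
    ?_ ?_ ?_ ?_ ?_) ?_)))).mono (by ring_nf; omega)
  · simpa using h5
  · simpa using h12
  · refine ⟨⟨?_, by simp [h7, h5]⟩, by simp, by simp⟩
    repeat refine Agree.setReg ?_ (by norm_num) _
    exact Agree.refl _ _
  · rintro i hi τ ⟨⟨hA, t39⟩, t27, t26⟩
    have e4 := (hA.1 4 (by norm_num)).trans h4
    have e5 := (hA.1 5 (by norm_num)).trans h5
    have e12 := (hA.1 12 (by norm_num)).trans h12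
    refine (wp_const_seq (wp_seq_of (t₂ := 1) (wp_rep
      (t := (d + 1) * (15 * K + 19) + 14 * K + 14) (n := N)
      (Q := fun ρ => (Agree 20 σ ρ ∧ ρ.reg 39 = K ∧ ρ.reg 27 = i ∧ ρ.reg 28 = τ.reg 28) ∧
        ρ.reg 26 = ∑ i ∈ Finset.range (i + 1), ∑ j ∈ Finset.range N, F i j)
      (fun j ρ => (Agree 20 σ ρ ∧ ρ.reg 39 = K ∧ ρ.reg 27 = i ∧ ρ.reg 28 = τ.reg 28) ∧
        ρ.reg 29 = j ∧ ρ.reg 26 = ∑ i ∈ Finset.range i, ∑ j ∈ Finset.range N, F i j +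
          ∑ j ∈ Finset.range j, F i j)
      ?_ ?_ ?_ ?_ ?_) ?_)).mono (by ring_nf; omega)
    · simpa using e5
    · simpa using e12
    · refine ⟨⟨?_, by simp [t39], by simp [t27], by simp⟩, by simp, by simp [t26]⟩
      repeat refine Agree.setReg ?_ (by norm_num) _
      exact hA
    · rintro j hj ρ ⟨⟨hB, b39, b27, b28⟩, b29, b26⟩
      have f4 := (hB.1 4 (by norm_num)).trans h4
      have f5 := (hB.1 5 (by norm_num)).trans h5
      have f6 := (hB.1 6 (by norm_num)).trans h6
      refine (wp_seq_of (t₂ := 3) (wp_kernelCmd (tf := 3) (u := fun c => I 2 i c)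
        (v := fun c => I 2 j c) f4 f5 f6 b39 (hI i hi) (hI j hj) ?_) ?_).mono (le_of_eq (by ring))
      · intro c hc π hπ h41
        have p27 := (hπ.1 27 (by norm_num)).trans b27
        have p29 := (hπ.1 29 (by norm_num)).trans b29
        refine wp_read_seq (wp_read ⟨?_, by simp, by simp [p27, h41], by simp [p29, h41]⟩)
        repeat refine Agree.setReg ?_ (by norm_num) _
        exact Agree.refl _ _
      · rintro π ⟨hπ, h55⟩
        have p4 := (hπ.1 4 (by norm_num)).trans f4
        have p26 := (hπ.1 26 (by norm_num)).trans b26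
        have p29 := (hπ.1 29 (by norm_num)).trans b29
        have p30 := hπ.1 30 (by norm_num)
        have p27 := (hπ.1 27 (by norm_num)).trans b27
        have p28 := (hπ.1 28 (by norm_num)).trans b28
        have p39 := (hπ.1 39 (by norm_num)).trans b39
        refine wp_add_seq (wp_add ⟨by simp [p30], by simp [p4], fun w => ⟨⟨?_, by simp [p39],
          by simp [p27], by simp [p28]⟩, by simp [p29, p4], ?_⟩⟩)
        · repeat refine Agree.setReg ?_ (by norm_num) _
          exact hB.trans (hπ.mono (by norm_num))
        · rw [Finset.sum_range_succ _ j, ← add_assoc, ← b26]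
          simp only [setReg_reg]
          norm_num
          rw [hπ.1 26 (by norm_num), h55, hF]
          rfl
    · rintro ρ ⟨h1, -, h2⟩
      exact ⟨h1, by rw [h2, Finset.sum_range_succ _ i]⟩
    · rintro ρ ⟨⟨hB, b39, b27, b28⟩, b26⟩
      have f4 := (hB.1 4 (by norm_num)).trans h4
      refine wp_add ⟨by simp [b28], by simp [f4], fun w => ⟨⟨?_, by simp [b39]⟩,
        by simp [b27, f4], by simp [b26]⟩⟩
      repeat refine Agree.setReg ?_ (by norm_num) _
      exact hB
  · rintro τ ⟨⟨hA, -⟩, -, h⟩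
    exact ⟨hA, h⟩
  · rintro τ ⟨hA, h26⟩
    have e4 := (hA.1 4 (by norm_num)).trans h4
    have e13 := hA.1 13 (by norm_num)
    have e14 := hA.1 14 (by norm_num)
    refine wp_add_seq (wp_sub_seq (wp_add ⟨fun q hq hq0 => ?_, ?_, ?_⟩))
    · simp only [setReg_reg]
      rw [if_neg hq0, if_neg (by omega), if_neg (by omega), hA.1 q hq]
    · simpa using hA.2
    · simp only [setReg_reg]
      norm_num
      -- Register `0` holds the threshold minus the sum plus `1`, which turns the strict test for
      -- positivity into a weak inequality.
      rw [h26, e4, e13, e14, Int.lt_add_one_iff, sub_nonneg]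

/-- The learning program. -/
def learnCmd : Cmd := paramCmd ⨟ storeCmd ⨟ testCmd

/-- The prediction program: the sign of the kernel estimate. -/
def predictCmd : Cmd :=
  add 39 9 5 ⨟ const 26 0 ⨟ const 20 0 ⨟ rep 28 12 (load 31 20 ⨟ add 20 20 4 ⨟
    kernelCmd (add 45 20 41 ⨟ load 43 45 ⨟ read 44 0 5 41) ⨟
    branch 31 (add 26 26 55) (sub 26 26 55) ⨟ add 20 20 6) ⨟ add 0 26 5

theorem wp_predictCmd {J : RamInput} {N d K : ℕ} (h4 : σ.reg 4 = 1) (h5 : σ.reg 5 = 0)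
    (h6 : σ.reg 6 = d)
    (h12 : σ.reg 12 = N) (h9 : σ.reg 9 = K) (hmem : ∀ a < N * (d + 1), σ.mem a = storedAt J d a)
    (hJ : ∀ i < N, ∀ c < d, J 0 i c = 1 ∨ J 0 i c = -1)
    (hJ' : ∀ i < N, J 1 i 0 = 1 ∨ J 1 i 0 = -1)
    (hI : ∀ c < d, I 0 0 c = 1 ∨ I 0 0 c = -1) :
    Wp I predictCmd (N * ((d + 1) * (15 * K + 21) + 14 * K + 24) + 11)
      (fun τ => τ.reg 0 = ∑ i ∈ Finset.range N,
          J 1 i 0 * kernelVal K d (fun c => J 0 i c) (fun c => I 0 0 c)) σ := by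
  refine (wp_add_seq (wp_const_seq (wp_const_seq (wp_seq_of (t₂ := 1) (wp_rep
    (t := (d + 1) * (15 * K + 21) + 14 * K + 21) (n := N)
    (Q := fun τ => τ.reg 5 = 0 ∧ τ.reg 26 = ∑ i ∈ Finset.range N,
          J 1 i 0 * kernelVal K d (fun c => J 0 i c) (fun c => I 0 0 c))
    (fun i τ => (Agree 20 σ τ ∧ τ.reg 39 = K) ∧ τ.reg 20 = (i * (d + 1) : ℕ) ∧
      τ.reg 26 = ∑ i ∈ Finset.range i,
          J 1 i 0 * kernelVal K d (fun c => J 0 i c) (fun c => I 0 0 c))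
    ?_ ?_ ?_ ?_ ?_) ?_)))).mono (by ring_nf; omega)
  · simpa using h5
  · simpa using h12
  · refine ⟨⟨?_, by simp [h9, h5]⟩, by simp, by simp⟩
    repeat refine Agree.setReg ?_ (by norm_num) _
    exact Agree.refl _ _
  · rintro i hi τ ⟨⟨hA, t39⟩, t20, t26⟩
    have e4 := (hA.1 4 (by norm_num)).trans h4
    have e5 := (hA.1 5 (by norm_num)).trans h5
    have e6 := (hA.1 6 (by norm_num)).trans h6
    have hmi : (i + 1) * (d + 1) ≤ N * (d + 1) := Nat.mul_le_mul_right _ hi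
    rw [add_mul i 1 (d + 1)] at hmi
    have hlab : τ.mem (τ.reg 20) = J 1 i 0 := by
      rw [t20, hA.2 _ (Int.natCast_nonneg _), hmem _ (by omega), storedAt_label]
    refine (wp_load_seq (wp_add_seq (wp_seq_of (t₂ := 4) (wp_kernelCmd (tf := 5) (K := K) (d := d)
      (u := fun c => J 0 i c) (v := fun c => I 0 0 c) ?_ ?_ ?_ ?_ (hJ i hi) hI ?_) ?_))).mono
      (by ring_nf; omega)
    · simpa using e4
    · simpa using e5
    · simpa using e6
    · simpa using t39
    · intro c hc ρ hρ h41
      have p20 := hρ.1 20 (by norm_num)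
      have p5 := hρ.1 5 (by norm_num)
      have pm := hρ.2 ((i * (d + 1) + 1 + c : ℕ) : ℤ) (Int.natCast_nonneg _)
      simp only [setReg_reg] at p20 p5
      norm_num at p20 p5
      rw [setReg_mem, setReg_mem, hA.2 _ (Int.natCast_nonneg _), hmem _ (by omega),
        storedAt_coord J hc] at pm
      refine wp_add_seq (wp_load_seq (wp_read ⟨?_, by simp, ?_, ?_⟩))
      · repeat refine Agree.setReg ?_ (by norm_num) _
        exact Agree.refl _ _
      · rw [← pm]
        simp [p20, t20, e4, h41]
      · simp [p5, e5, h41]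
    · rintro ρ ⟨hρ, h55⟩
      have p31 := hρ.1 31 (by norm_num)
      have p26 := hρ.1 26 (by norm_num)
      have p4 := hρ.1 4 (by norm_num)
      have p6 := hρ.1 6 (by norm_num)
      have p20 := hρ.1 20 (by norm_num)
      have p28 := hρ.1 28 (by norm_num)
      have p39 := hρ.1 39 (by norm_num)
      simp only [setReg_reg] at p31 p26 p4 p6 p20 p28 p39
      norm_num at p31 p26 p4 p6 p20 p28 p39
      have hAρ : Agree 20 σ ρ := by
        refine Agree.trans ?_ (hρ.mono (by norm_num))
        exact Agree.setReg (Agree.setReg hA (by norm_num) _) (by norm_num) _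
      have key : ∀ w : ℤ, w = ρ.reg 26 + J 1 i 0 * ρ.reg 55 → Wp I (add 20 20 6) 1
          (fun τ' => τ'.reg 28 = τ.reg 28 ∧ τ'.reg 4 = 1 ∧
            ∀ v, ((Agree 20 σ (τ'.setReg 28 v) ∧ (τ'.setReg 28 v).reg 39 = K) ∧
              (τ'.setReg 28 v).reg 20 = ((i + 1) * (d + 1) : ℕ) ∧
              (τ'.setReg 28 v).reg 26 = ∑ i ∈ Finset.range (i + 1),
                J 1 i 0 * kernelVal K d (fun c => J 0 i c) (fun c => I 0 0 c)))
          (ρ.setReg 26 w) := by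
        intro w hw
        refine wp_add ⟨by simp [p28], by simp [p4, e4], fun v =>
          ⟨⟨?_, by simp [p39, t39]⟩, ?_, ?_⟩⟩
        · repeat refine Agree.setReg ?_ (by norm_num) _
          exact hAρ
        · simp [p20, t20, e4, p6, e6]; ring
        · rw [Finset.sum_range_succ _ i, ← t26, ← p26]
          simp only [setReg_reg]
          norm_num
          rw [hw, h55]
          rfl
      refine wp_seq (wp_branch (t := 1) (fun hpos => wp_add (key _ ?_)) fun hneg =>
        wp_sub (key _ ?_))
      · rw [p31, hlab] at hpos
        rcases hJ' i hi with h | h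
        · rw [h]; ring
        · omega
      · rw [p31, hlab] at hneg
        rcases hJ' i hi with h | h
        · omega
        · rw [h]; ring
  · rintro τ ⟨⟨hA, -⟩, -, h⟩
    exact ⟨(hA.1 5 (by norm_num)).trans h5, h⟩
  · rintro τ ⟨h5, h⟩
    exact wp_add (by simp [h5, h])

end Cmd

/-! ## The kernel in terms of characters -/

theorem Cmd.dpTab_eq (z : ℕ → ℤ) (c j : ℕ) :
    Cmd.dpTab z c j = ∑ S ∈ Finset.powersetCard j (Finset.range c), ∏ i ∈ S, z i := by
  induction c generalizing j with
  | zero =>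
    cases j with
    | zero => simp [dpTab]
    | succ j =>
      rw [Finset.range_zero, Finset.powersetCard_eq_empty.2 (by simp)]
      simp [dpTab]
  | succ c ih =>
    cases j with
    | zero => simp [dpTab, ih]
    | succ j =>
      have hc : c ∉ Finset.range c := by simp
      rw [dpTab, ih, ih, Finset.range_add_one, Finset.powersetCard_succ_insert hc,
        Finset.sum_union, Finset.sum_image, Finset.mul_sum]
      · congr 1
        refine Finset.sum_congr rfl fun S hS => ?_
        rw [Finset.prod_insert fun h => hc ((Finset.mem_powersetCard.1 hS).1 h)]
      · intro S hS T hT h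
        have h1 : c ∉ S := fun h => hc ((Finset.mem_powersetCard.1 hS).1 h)
        have h2 : c ∉ T := fun h => hc ((Finset.mem_powersetCard.1 hT).1 h)
        rw [← Finset.erase_insert h1, ← Finset.erase_insert h2, h]
      · refine Finset.disjoint_left.2 fun S hS hS' => ?_
        obtain ⟨T, -, rfl⟩ := Finset.mem_image.1 hS'
        exact hc ((Finset.mem_powersetCard.1 hS).1 (Finset.mem_insert_self _ _))

/-- The `j`-th elementary symmetric polynomial of the products `x_i y_i` is the sum of `χ_S(x)
χ_S(y)` over `|S| = j`. -/
theorem Cmd.kernelVal_eq {d : ℕ} (K : ℕ) {u v : ℕ → ℤ} {x y : Cube d}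
    (hu : ∀ i : Fin d, u i = sgn (x i)) (hv : ∀ i : Fin d, v i = sgn (y i)) :
    (Cmd.kernelVal K d u v : ℝ) = ∑ S ∈ smallSets d K, chi S x * chi S y := by
  have h1 : ∀ j, (Cmd.dpTab (fun c => u c * v c) d j : ℝ) =
      ∑ S ∈ (Finset.univ : Finset (Finset (Fin d))).filter (fun S => S.card = j),
        chi S x * chi S y := by
    intro j
    have hr : Finset.range d = (Finset.univ : Finset (Fin d)).map Fin.valEmbedding := by
      ext i
      simp
    rw [Cmd.dpTab_eq, hr, Finset.powersetCard_map, Finset.sum_map,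
      Finset.univ_filter_card_eq]
    push_cast
    refine Finset.sum_congr rfl fun S _ => ?_
    simp [chi, Finset.prod_mul_distrib, hu, hv, Finset.mapEmbedding_apply]
  rw [Cmd.kernelVal]
  push_cast
  simp only [h1]
  rw [← Finset.sum_fiberwise_of_maps_to (s := smallSets d K) (t := Finset.range (K + 1))
    (g := Finset.card) fun S hS => Finset.mem_range.2 (Nat.lt_succ_of_le (mem_smallSets.1 hS))]
  refine Finset.sum_congr rfl fun j hj => Finset.sum_congr ?_ fun _ _ => rfl
  ext S
  simp only [Finset.mem_filter, Finset.mem_univ, true_and, mem_smallSets]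
  have := Finset.mem_range.1 hj
  omega

/-- A set of at most `k + 1` elements arises from one of at most `k` elements by inserting one of
`d` coordinates or nothing. -/
theorem card_smallSets_le (d k : ℕ) : (smallSets d k).card ≤ (d + 1) ^ k := by
  classical
  induction k with
  | zero =>
    have : smallSets d 0 = {∅} := by ext S; simp
    simp [this]
  | succ k ih =>
    have h : smallSets d (k + 1) ⊆ (smallSets d k ×ˢ (Finset.univ : Finset (Option (Fin d)))).image
        fun z => z.2.elim z.1 fun a => insert a z.1 := by
      intro S hS
      rw [mem_smallSets] at hS
      rcases S.eq_empty_or_nonempty with rfl | ⟨a, ha⟩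
      · exact Finset.mem_image.2 ⟨(∅, none), by simp, rfl⟩
      · refine Finset.mem_image.2 ⟨(S.erase a, some a), ?_, ?_⟩
        · simp [Finset.card_erase_of_mem ha]; omega
        · simp [Finset.insert_erase ha]
    refine (Finset.card_le_card h).trans (Finset.card_image_le.trans ?_)
    rw [Finset.card_product, pow_succ, Finset.card_univ, Fintype.card_option, Fintype.card_fin]
    exact Nat.mul_le_mul_right _ ih

/-! ## Deviations of empirical averages -/

/-- The sum of `φ` over the first `N` members of a sample. -/
def firstSum {α : Type*} {n : ℕ} (N : ℕ) (φ : α → ℝ) (z : Fin n → α) : ℝ :=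
  ∑ i : Fin n, if (i : ℕ) < N then φ (z i) else 0

theorem sum_range_eq_firstSum {α : Type*} {n N : ℕ} (hN : N ≤ n) (φ : α → ℝ) (z : Fin n → α)
    {G : ℕ → ℝ} (hG : ∀ i : Fin n, (i : ℕ) < N → G i = φ (z i)) :
    ∑ i ∈ Finset.range N, G i = firstSum N φ z := by
  have h1 : firstSum N φ z = ∑ i : Fin n, if (i : ℕ) < N then G i else 0 :=
    Finset.sum_congr rfl fun i _ => by
      split_ifs with h
      · rw [hG i h]
      · rfl
  rw [h1, Fin.sum_univ_eq_sum_range (fun i => if i < N then G i else 0) n,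
    ← Finset.sum_filter]
  refine Finset.sum_congr ?_ fun _ _ => rfl
  ext i
  simp only [Finset.mem_range, Finset.mem_filter]
  omega

section

variable {α : Type*} [Fintype α] [MeasurableSpace α] [MeasurableSingletonClass α]

theorem integrable_of_fintype {μ : Measure α} [IsFiniteMeasure μ] (f : α → ℝ) : Integrable f μ :=
  Integrable.of_finite

theorem integral_firstSum (μ : Measure α) [IsProbabilityMeasure μ] {n N : ℕ} (hN : N ≤ n)
    (φ : α → ℝ) :
    ∫ z, firstSum N φ z ∂(Measure.pi fun _ : Fin n => μ) = N * ∫ a, φ a ∂μ := by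
  unfold firstSum
  rw [integral_finsetSum _ fun i _ => integrable_of_fintype _]
  have h1 : ∀ i : Fin n, ∫ z : Fin n → α, (if (i : ℕ) < N then φ (z i) else 0)
      ∂(Measure.pi fun _ : Fin n => μ) = if (i : ℕ) < N then ∫ a, φ a ∂μ else 0 := by
    intro i
    split_ifs
    · have h := measurePreserving_eval (fun _ : Fin n => μ) i
      have h' := integral_map (f := φ) h.measurable.aemeasurable
        (by rw [h.map_eq]; exact (integrable_of_fintype φ).aestronglyMeasurable)
      rw [h.map_eq] at h'
      exact h'.symm
    · simp
  simp only [h1]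
  rw [Fin.sum_univ_eq_sum_range (fun i => if i < N then ∫ a, φ a ∂μ else 0) n,
    ← Finset.sum_filter, Finset.sum_const, nsmul_eq_mul]
  congr 2
  have : (Finset.range n).filter (fun i => i < N) = Finset.range N := by
    ext i
    simp only [Finset.mem_range, Finset.mem_filter]
    omega
  rw [this, Finset.card_range]

/-- The variance of a sum of independent terms is the sum of the variances, and each of the `N`
terms that count has variance at most `1`. -/
theorem integral_sq_deviation_le (μ : Measure α) [IsProbabilityMeasure μ] {n N : ℕ} (hN : N ≤ n)
    (hN0 : 0 < N) (φ : α → ℝ) (hφ : ∀ a, |φ a| ≤ 1) :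
    ∫ z, (firstSum N φ z / N - ∫ a, φ a ∂μ) ^ 2 ∂(Measure.pi fun _ : Fin n => μ) ≤ 1 / N := by
  have hN' : (0 : ℝ) < N := by exact_mod_cast hN0
  have h1 := ProbabilityTheory.variance_sum_pi (μ := fun _ : Fin n => μ)
    (X := fun (i : Fin n) a => if (i : ℕ) < N then φ a else 0)
    fun i => MemLp.of_discrete
  have h2 : (∑ i : Fin n, fun ω : Fin n → α => if (i : ℕ) < N then φ (ω i) else 0) =
      firstSum N φ := by
    ext ω
    simp [firstSum]
  rw [h2] at h1
  have h3 : ∀ i : Fin n, ProbabilityTheory.variance (fun a => if (i : ℕ) < N then φ a else 0) μ ≤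
      if (i : ℕ) < N then 1 else 0 := by
    intro i
    split_ifs
    · refine (ProbabilityTheory.variance_le_expectation_sq
        (integrable_of_fintype φ).aestronglyMeasurable).trans ?_
      have : ∫ a, (φ ^ 2) a ∂μ ≤ ∫ _, (1 : ℝ) ∂μ := by
        refine integral_mono (integrable_of_fintype _) (integrable_of_fintype _) fun a => ?_
        simpa using hφ a
      simpa using this
    · have : (fun _ : α => (0 : ℝ)) = 0 := rfl
      rw [this, ProbabilityTheory.variance_zero]
  have h4 : ∑ i : Fin n, (if (i : ℕ) < N then (1 : ℝ) else 0) ≤ N := by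
    rw [Fin.sum_univ_eq_sum_range (fun i => if i < N then (1 : ℝ) else 0) n,
      ← Finset.sum_filter, Finset.sum_const, nsmul_eq_mul, mul_one]
    have : (Finset.range n).filter (fun i => i < N) ⊆ Finset.range N := by
      intro i
      simp only [Finset.mem_range, Finset.mem_filter]
      omega
    have := Finset.card_le_card this
    rw [Finset.card_range] at this
    exact_mod_cast this
  have h5 := (h1.trans_le (Finset.sum_le_sum fun i _ => h3 i)).trans h4
  rw [ProbabilityTheory.variance_eq_integral
    (integrable_of_fintype (firstSum N φ)).aestronglyMeasurable.aemeasurable,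
    integral_firstSum μ hN φ] at h5
  have h6 : ∀ z : Fin n → α, (firstSum N φ z / N - ∫ a, φ a ∂μ) ^ 2 =
      (firstSum N φ z - N * ∫ a, φ a ∂μ) ^ 2 * (1 / N ^ 2) := by
    intro z; field_simp
  simp only [h6]
  rw [integral_mul_const]
  calc _ ≤ (N : ℝ) * (1 / N ^ 2) := by gcongr
    _ = 1 / N := by field_simp

/-- Markov's inequality for the total squared deviation, whose mean is at most `|J|/N`. The total in
`ℓ₂` is exactly what the test and the coefficient estimate need. -/
theorem measure_deviation_le (μ : Measure α) [IsProbabilityMeasure μ] {n N : ℕ} (hN : N ≤ n)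
    (hN0 : 0 < N) {ι : Type*} (J : Finset ι) (φ : ι → α → ℝ) (hφ : ∀ j a, |φ j a| ≤ 1) {η : ℝ}
    (hη : 0 < η) :
    (Measure.pi fun _ : Fin n => μ).real
      {z | ¬∑ j ∈ J, (firstSum N (φ j) z / N - ∫ a, φ j a ∂μ) ^ 2 ≤ η} ≤ J.card / (N * η) := by
  have hN' : (0 : ℝ) < N := by exact_mod_cast hN0
  have h1 := mul_meas_ge_le_integral_of_nonneg (μ := Measure.pi fun _ : Fin n => μ)
    (f := fun z => ∑ j ∈ J, (firstSum N (φ j) z / N - ∫ a, φ j a ∂μ) ^ 2)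
    (ae_of_all _ fun z => Finset.sum_nonneg fun j _ => sq_nonneg _) (integrable_of_fintype _) η
  rw [integral_finsetSum _ fun i _ => integrable_of_fintype _] at h1
  have h2 := h1.trans (Finset.sum_le_sum fun j _ => integral_sq_deviation_le μ hN hN0 (φ j) (hφ j))
  rw [Finset.sum_const, nsmul_eq_mul] at h2
  have h3 : (Measure.pi fun _ : Fin n => μ).real
      {z | ¬∑ j ∈ J, (firstSum N (φ j) z / N - ∫ a, φ j a ∂μ) ^ 2 ≤ η} ≤
      (Measure.pi fun _ : Fin n => μ).real
      {z | η ≤ ∑ j ∈ J, (firstSum N (φ j) z / N - ∫ a, φ j a ∂μ) ^ 2} :=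
    measureReal_mono fun z hz => (not_le.1 hz).le
  refine h3.trans ?_
  rw [le_div_iff₀ (by positivity)]
  calc _ = N * (η * (Measure.pi fun _ : Fin n => μ).real
        {z | η ≤ ∑ j ∈ J, (firstSum N (φ j) z / N - ∫ a, φ j a ∂μ) ^ 2}) := by ring
    _ ≤ N * (J.card * (1 / N)) := by gcongr
    _ = J.card := by field_simp

end

theorem one_sub_le_prod_real {α β : Type*} [MeasurableSpace α] [MeasurableSpace β]
    (μ : Measure α) (ν : Measure β) [IsProbabilityMeasure μ] [IsProbabilityMeasure ν]
    {A : α → Prop} {B : β → Prop} {G : Set (α × β)} {a b : ℝ}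
    (hA : μ.real {z | ¬A z} ≤ a) (hB : ν.real {z | ¬B z} ≤ b)
    (hG : ∀ z : α × β, A z.1 → B z.2 → z ∈ G) : 1 - (a + b) ≤ (μ.prod ν).real G := by
  have h1 : (Set.univ : Set (α × β)) ⊆
      G ∪ ({z | ¬A z} ×ˢ Set.univ ∪ Set.univ ×ˢ {z | ¬B z}) := by
    rintro z -
    by_cases h : A z.1 ∧ B z.2
    · exact Or.inl (hG z h.1 h.2)
    · rw [not_and_or] at h
      rcases h with h | h
      · exact Or.inr (Or.inl ⟨h, trivial⟩)
      · exact Or.inr (Or.inr ⟨trivial, h⟩)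
  have h2 := measureReal_mono (μ := μ.prod ν) h1
  have h3 := measureReal_union_le (μ := μ.prod ν) G
    ({z | ¬A z} ×ˢ Set.univ ∪ Set.univ ×ˢ {z | ¬B z})
  have h4 := measureReal_union_le (μ := μ.prod ν) ({z : α | ¬A z} ×ˢ (Set.univ : Set β))
    (Set.univ ×ˢ {z | ¬B z})
  rw [measureReal_prod_prod, measureReal_prod_prod, probReal_univ, probReal_univ] at h4
  rw [probReal_univ] at h2
  linarith

/-! ## Fourier analysis -/

instance (d : ℕ) : IsProbabilityMeasure (uniformCube d) := by unfold uniformCube; infer_instance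

/-- The sum over the cube factorizes, and a coordinate in `S` contributes the factor `1 + (-1) = 0`.
-/
theorem integral_chi_uniformCube {d : ℕ} (S : Finset (Fin d)) :
    ∫ x, chi S x ∂(uniformCube d) = if S = ∅ then 1 else 0 := by
  classical
  split_ifs with h
  · simp [h]
  obtain ⟨a, ha⟩ := Finset.nonempty_iff_ne_empty.2 h
  rw [uniformCube, PMF.integral_eq_sum]
  simp only [PMF.uniformOfFintype_apply, smul_eq_mul]
  rw [← Finset.mul_sum]
  have h1 : ∀ x : Cube d, chi S x = ∏ i, if i ∈ S then (sgn (x i) : ℝ) else 1 := fun x => by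
    simp [chi]
  simp only [h1]
  have h2 := Finset.prod_univ_sum (fun _ : Fin d => (Finset.univ : Finset Bool))
    fun i b => if i ∈ S then (sgn b : ℝ) else 1
  rw [Fintype.piFinset_univ] at h2
  rw [← h2, Finset.prod_eq_zero (Finset.mem_univ a) (by simp [ha, sgn]), mul_zero]

section

variable {d : ℕ} {P Q : Measure (Cube d × Bool)}

theorem integral_chi_fst (hP : P.map Prod.fst = uniformCube d) (S : Finset (Fin d)) :
    ∫ z, chi S z.1 ∂P = if S = ∅ then 1 else 0 := by
  rw [← integral_chi_uniformCube, ← hP, integral_map measurable_fst.aemeasurable]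
  exact (measurable_of_finite _).aestronglyMeasurable

/-- The characters of the point are orthonormal in `L₂(P)` because the marginal is uniform; `g` may
depend on the label as well. The proof expands the squared distance of `g` from its projection. -/
theorem bessel [IsProbabilityMeasure P] (hP : P.map Prod.fst = uniformCube d)
    (J : Finset (Finset (Fin d))) (g : Cube d × Bool → ℝ) :
    ∑ S ∈ J, (∫ z, g z * chi S z.1 ∂P) ^ 2 ≤ ∫ z, g z ^ 2 ∂P := by
  set b : Finset (Fin d) → ℝ := fun S => ∫ z, g z * chi S z.1 ∂P with hb
  have h0 : 0 ≤ ∫ z, (g z - ∑ S ∈ J, b S * chi S z.1) ^ 2 ∂P :=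
    integral_nonneg fun z => sq_nonneg _
  have h1 : ∀ z : Cube d × Bool, (g z - ∑ S ∈ J, b S * chi S z.1) ^ 2 =
      g z ^ 2 - 2 * ∑ S ∈ J, b S * (g z * chi S z.1) +
        ∑ S ∈ J, ∑ T ∈ J, b S * b T * chi (symmDiff S T) z.1 := by
    intro z
    have h2 : ∑ S ∈ J, ∑ T ∈ J, b S * b T * chi (symmDiff S T) z.1 =
        (∑ S ∈ J, b S * chi S z.1) * ∑ T ∈ J, b T * chi T z.1 := by
      rw [Finset.sum_mul_sum]
      refine Finset.sum_congr rfl fun S _ => Finset.sum_congr rfl fun T _ => ?_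
      rw [← chi_mul_chi]; ring
    have h3 : ∑ S ∈ J, b S * (g z * chi S z.1) = g z * ∑ S ∈ J, b S * chi S z.1 := by
      rw [Finset.mul_sum]
      exact Finset.sum_congr rfl fun S _ => by ring
    rw [h2, h3]; ring
  simp only [h1] at h0
  rw [integral_add (integrable_of_fintype _) (integrable_of_fintype _),
    integral_sub (integrable_of_fintype _) (integrable_of_fintype _), integral_const_mul,
    integral_finsetSum _ fun _ _ => integrable_of_fintype _,
    integral_finsetSum _ fun _ _ => integrable_of_fintype _] at h0
  have h4 : ∀ S ∈ J, ∫ z, ∑ T ∈ J, b S * b T * chi (symmDiff S T) z.1 ∂P = b S ^ 2 := by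
    intro S hS
    rw [integral_finsetSum _ fun _ _ => integrable_of_fintype _]
    simp only [integral_const_mul, integral_chi_fst hP, ← Finset.bot_eq_empty, symmDiff_eq_bot]
    simp [hS, pow_two]
  have h5 : ∀ S ∈ J, ∫ z, b S * (g z * chi S z.1) ∂P = b S ^ 2 := by
    intro S _
    rw [integral_const_mul, pow_two]
  rw [Finset.sum_congr rfl h4, Finset.sum_congr rfl h5] at h0
  linarith

/-- The characters are nearly orthonormal in `L₂(Q)`: the off-diagonal terms contribute at most `τ
(∑ |a_S|)² ≤ τ |J| ∑ a_S²`. A product of two characters of degree `k` has degree up to `2k`, which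
is why moments up to `2k` have to be tested. -/
theorem integral_sq_le_of_small_moments [IsProbabilityMeasure Q] {k : ℕ} {τ : ℝ}
    (hτ0 : 0 ≤ τ)
    (hτ : τ * (smallSets d k).card ≤ 2)
    (hQ : ∀ S ∈ smallSets d (2 * k), S ≠ ∅ → |∫ z, chi S z.1 ∂Q| ≤ τ) (a : Finset (Fin d) → ℝ) :
    ∫ z, (∑ S ∈ smallSets d k, a S * chi S z.1) ^ 2 ∂Q ≤ 3 * ∑ S ∈ smallSets d k, a S ^ 2 := by
  classical
  set J := smallSets d k
  have h1 : ∀ z : Cube d × Bool, (∑ S ∈ J, a S * chi S z.1) ^ 2 =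
      ∑ S ∈ J, ∑ T ∈ J, a S * a T * chi (symmDiff S T) z.1 := by
    intro z
    rw [pow_two, Finset.sum_mul_sum]
    refine Finset.sum_congr rfl fun S _ => Finset.sum_congr rfl fun T _ => ?_
    rw [← chi_mul_chi]; ring
  simp only [h1]
  rw [integral_finsetSum _ fun _ _ => integrable_of_fintype _]
  have h2 : ∀ S ∈ J, ∫ z, ∑ T ∈ J, a S * a T * chi (symmDiff S T) z.1 ∂Q ≤
      a S ^ 2 + τ * |a S| * ∑ T ∈ J, |a T| := by
    intro S hS
    rw [integral_finsetSum _ fun _ _ => integrable_of_fintype _, Finset.mul_sum]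
    have h3 : a S ^ 2 = ∑ T ∈ J, if S = T then a S * a T else 0 := by
      simp [hS, pow_two]
    rw [h3, ← Finset.sum_add_distrib]
    refine Finset.sum_le_sum fun T hT => ?_
    rw [integral_const_mul]
    have hST : symmDiff S T ∈ smallSets d (2 * k) := by
      have h4 := mem_smallSets.1 hS
      have h5 := mem_smallSets.1 hT
      have h6 := card_symmDiff_le_add S T
      exact mem_smallSets.2 (by omega)
    split_ifs with h
    · subst h
      simp only [symmDiff_self, Finset.bot_eq_empty, chi_empty, integral_const, probReal_univ,
        smul_eq_mul, mul_one]
      exact le_add_of_nonneg_right (by positivity)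
    · have h7 := hQ _ hST (by rwa [← Finset.bot_eq_empty, Ne, symmDiff_eq_bot])
      rw [zero_add]
      calc a S * a T * ∫ z, chi (symmDiff S T) z.1 ∂Q
          ≤ |a S * a T * ∫ z, chi (symmDiff S T) z.1 ∂Q| := le_abs_self _
        _ = |a S| * |a T| * |∫ z, chi (symmDiff S T) z.1 ∂Q| := by rw [abs_mul, abs_mul]
        _ ≤ |a S| * |a T| * τ := by gcongr
        _ = _ := by ring
  refine (Finset.sum_le_sum h2).trans ?_
  rw [Finset.sum_add_distrib, ← Finset.sum_mul, ← Finset.mul_sum]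
  have h8 : (∑ S ∈ J, |a S|) ^ 2 ≤ J.card * ∑ S ∈ J, a S ^ 2 := by
    simpa using sq_sum_le_card_mul_sum_sq (s := J) (f := fun S => |a S|)
  have h9 : 0 ≤ ∑ S ∈ J, a S ^ 2 := Finset.sum_nonneg fun S _ => sq_nonneg _
  calc ∑ S ∈ J, a S ^ 2 + τ * (∑ S ∈ J, |a S|) * ∑ S ∈ J, |a S|
      = ∑ S ∈ J, a S ^ 2 + τ * (∑ S ∈ J, |a S|) ^ 2 := by ring
    _ ≤ ∑ S ∈ J, a S ^ 2 + τ * (J.card * ∑ S ∈ J, a S ^ 2) := by gcongr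
    _ = ∑ S ∈ J, a S ^ 2 + (τ * J.card) * ∑ S ∈ J, a S ^ 2 := by ring
    _ ≤ ∑ S ∈ J, a S ^ 2 + 2 * ∑ S ∈ J, a S ^ 2 := by gcongr
    _ = _ := by ring

/-- The error of the sign of a low-degree estimate. -/
theorem err_le_of_estimates [IsProbabilityMeasure P] [IsProbabilityMeasure Q]
    (hP : P.map Prod.fst = uniformCube d) {k : ℕ} {f h : Cube d → Bool} {δ η τ : ℝ}
    {p c : Finset (Fin d) → ℝ} (hδ0 : 0 ≤ δ) (hδ : δ ≤ 1 / 8) (hτ0 : 0 ≤ τ)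
    (hp : ∀ x, |∑ S ∈ smallSets d k, p S * chi S x - sgn (f x)| ≤ δ)
    (hc : ∑ S ∈ smallSets d k, (c S - ∫ z, sgn z.2 * chi S z.1 ∂P) ^ 2 ≤ η)
    (hτ : τ * (smallSets d k).card ≤ 2)
    (hQ : ∀ S ∈ smallSets d (2 * k), S ≠ ∅ → |∫ z, chi S z.1 ∂Q| ≤ τ)
    (hh : ∀ x, h x = true ↔ 0 < ∑ S ∈ smallSets d k, c S * chi S x) :
    err h Q ≤ 32 * (err f P + err f Q) + 8 * η + 40 * δ := by
  classical
  set J := smallSets d k with hJ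
  set q : Cube d → ℝ := fun x => ∑ S ∈ J, p S * chi S x with hq
  have hnn : ∀ (g : Cube d → Bool) (R : Measure (Cube d × Bool)), 0 ≤ err g R :=
    fun _ _ => measureReal_nonneg
  -- The squared error of `q` on the training distribution.
  have h1 : ∫ z, ((sgn z.2 : ℝ) - q z.1) ^ 2 ∂P ≤ 4 * err f P + 5 * δ := by
    have h2 : ∀ z : Cube d × Bool, ((sgn z.2 : ℝ) - q z.1) ^ 2 ≤
        {z : Cube d × Bool | z.2 ≠ f z.1}.indicator (fun _ => (4 : ℝ)) z + 5 * δ := by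
      rintro ⟨x, y⟩
      have h3 := abs_le.1 (hp x)
      have h4 : δ ^ 2 ≤ δ := by nlinarith
      by_cases hxy : y = f x
      · rw [Set.indicator_of_notMem (by simpa using hxy)]
        simp only [hxy]
        have : ((sgn (f x) : ℝ) - q x) ^ 2 ≤ δ ^ 2 := sq_le_sq' (by linarith) (by linarith)
        linarith
      · rw [Set.indicator_of_mem (by simpa using hxy)]
        simp only
        -- Since `δ ≤ 1/8`, one has `(2 + δ)² = 4 + 4δ + δ² ≤ 4 + 5δ`.
        have : ((sgn y : ℝ) - q x) ^ 2 ≤ (2 + δ) ^ 2 := by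
          have h5 : |(sgn y : ℝ) - sgn (f x)| ≤ 2 := by cases y <;> cases f x <;> norm_num [sgn]
          have h6 := abs_le.1 h5
          exact sq_le_sq' (by linarith) (by linarith)
        nlinarith
    have h5 := integral_mono (μ := P) (integrable_of_fintype _) (integrable_of_fintype _) h2
    rw [integral_add (integrable_of_fintype _) (integrable_of_fintype _),
      integral_indicator_const _ (Set.toFinite _).measurableSet] at h5
    simp only [integral_const, probReal_univ, smul_eq_mul, one_mul] at h5
    unfold err
    linarith
  have h2 : ∀ S ∈ J, ∫ z, ((sgn z.2 : ℝ) - q z.1) * chi S z.1 ∂P =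
      ∫ z, (sgn z.2 : ℝ) * chi S z.1 ∂P - p S := by
    intro S hS
    have h3 : ∀ z : Cube d × Bool, ((sgn z.2 : ℝ) - q z.1) * chi S z.1 =
        sgn z.2 * chi S z.1 - ∑ T ∈ J, p T * chi (symmDiff T S) z.1 := by
      intro z
      rw [sub_mul, hq, Finset.sum_mul]
      simp only [mul_assoc, chi_mul_chi]
    simp only [h3]
    rw [integral_sub (integrable_of_fintype _) (integrable_of_fintype _),
      integral_finsetSum _ fun _ _ => integrable_of_fintype _]
    simp only [integral_const_mul, integral_chi_fst hP, ← Finset.bot_eq_empty, symmDiff_eq_bot]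
    simp [hS]
  -- Bessel for the residual `y - q`, whose coefficients are the true label coefficients minus those
  -- of `q`.
  have h3 := (bessel hP J fun z => (sgn z.2 : ℝ) - q z.1).trans h1
  rw [Finset.sum_congr rfl fun S hS => by rw [h2 S hS]] at h3
  have h4 : ∑ S ∈ J, (c S - p S) ^ 2 ≤ 2 * η + 2 * (4 * err f P + 5 * δ) := by
    calc ∑ S ∈ J, (c S - p S) ^ 2
        ≤ ∑ S ∈ J, (2 * (c S - ∫ z, sgn z.2 * chi S z.1 ∂P) ^ 2 +
          2 * (∫ z, (sgn z.2 : ℝ) * chi S z.1 ∂P - p S) ^ 2) := by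
          refine Finset.sum_le_sum fun S _ => ?_
          nlinarith [sq_nonneg ((c S - ∫ z, sgn z.2 * chi S z.1 ∂P) -
            (∫ z, (sgn z.2 : ℝ) * chi S z.1 ∂P - p S))]
      _ ≤ _ := by
          rw [Finset.sum_add_distrib, ← Finset.mul_sum, ← Finset.mul_sum]
          linarith
  have h5 := integral_sq_le_of_small_moments hτ0 hτ hQ fun S => c S - p S
  -- Where `h` and `f` differ, the two estimates differ.
  have h6 : ∀ z : Cube d × Bool, {z : Cube d × Bool | f z.1 ≠ h z.1}.indicator
      (fun _ => (49 / 64 : ℝ)) z ≤ (∑ S ∈ J, (c S - p S) * chi S z.1) ^ 2 := by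
    rintro ⟨x, y⟩
    by_cases hxy : f x = h x
    · rw [Set.indicator_of_notMem (by simpa using hxy)]
      exact sq_nonneg _
    · rw [Set.indicator_of_mem (by simpa using hxy)]
      have h7 := abs_le.1 (hp x)
      have h8 : ∑ S ∈ J, (c S - p S) * chi S x = ∑ S ∈ J, c S * chi S x - q x := by
        simp only [sub_mul, Finset.sum_sub_distrib, hq]
      simp only [h8]
      have h9 := hh x
      cases hf : f x <;> cases hx : h x <;> simp only [hf, hx, not_true_eq_false] at hxy h7 h9
      · have : 0 < ∑ S ∈ J, c S * chi S x := h9.1 trivial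
        have h10 : 7 / 8 ≤ ∑ S ∈ J, c S * chi S x - q x := by
          simp only [sgn] at h7; push_cast at h7; norm_num at h7; linarith
        nlinarith
      · have : ∑ S ∈ J, c S * chi S x ≤ 0 := by
          by_contra h
          exact absurd (h9.2 (not_le.1 h)) (by simp)
        have h10 : 7 / 8 ≤ q x - ∑ S ∈ J, c S * chi S x := by
          simp only [sgn] at h7; push_cast at h7; norm_num at h7; linarith
        nlinarith
  have h7 := integral_mono (μ := Q) (integrable_of_fintype _) (integrable_of_fintype _) h6
  rw [integral_indicator_const _ (Set.toFinite _).measurableSet, smul_eq_mul] at h7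
  have h8 : err h Q ≤ err f Q + Q.real {z | f z.1 ≠ h z.1} := by
    refine le_trans (measureReal_mono ?_) (measureReal_union_le _ _)
    intro z hz
    by_cases h : z.2 = f z.1
    · right
      intro h'
      exact hz (h.trans h')
    · exact Or.inl h
  have h9 := hnn f P
  have h10 := hnn f Q
  have h11 : 0 ≤ ∑ S ∈ J, (c S - p S) ^ 2 := Finset.sum_nonneg fun S _ => sq_nonneg _
  -- Altogether `Q(h ≠ f) ≤ (64/49) · 3 · (2η + 8 err(f; P) + 10δ)`, and `192/49 ≤ 4` gives the
  -- constants `32`, `8` and `40`.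
  linarith

end

/-! ## What the learner computes -/

theorem sgn_eq_or (b : Bool) : sgn b = 1 ∨ sgn b = -1 := by cases b <;> simp [sgn]

theorem entry_natCast {α : Type} {m : ℕ} (v : Fin m → α) {i : ℕ} (h : i < m) :
    entry v i = some (v ⟨i, h⟩) := by
  simp [entry, h]

theorem coordAt_natCast {d : ℕ} (x : Cube d) {c : ℕ} (h : c < d) :
    coordAt x c = sgn (x ⟨c, h⟩) := by
  simp [coordAt, entry_natCast x h]

section

variable {d m n : ℕ} (S : Fin m → Cube d × Bool) (U : Fin n → Cube d)

theorem sampleInput_zero {i c : ℕ} (hi : i < m) (hc : c < d) :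
    sampleInput S U 0 i c = sgn ((S ⟨i, hi⟩).1 ⟨c, hc⟩) := by
  simp [sampleInput, entry_natCast S hi, coordAt_natCast _ hc]

theorem sampleInput_one {i : ℕ} (hi : i < m) :
    sampleInput S U 1 i 0 = sgn (S ⟨i, hi⟩).2 := by
  simp [sampleInput, entry_natCast S hi]

theorem sampleInput_two {i c : ℕ} (hi : i < n) (hc : c < d) :
    sampleInput S U 2 i c = sgn (U ⟨i, hi⟩ ⟨c, hc⟩) := by
  simp [sampleInput, entry_natCast U hi, coordAt_natCast _ hc]

theorem pointInput_zero (x : Cube d) {c : ℕ} (hc : c < d) :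
    pointInput x 0 0 c = sgn (x ⟨c, hc⟩) := by
  simp [pointInput, coordAt_natCast _ hc]

/-- Exchanging the sums, a double sum of `χ_T(u_i) χ_T(u_j)` over pairs of examples is the square of
a single sum. -/
theorem sum_kernelVal_test {N K : ℕ} (hN : N ≤ n) :
    ((∑ i ∈ Finset.range N, ∑ j ∈ Finset.range N, Cmd.kernelVal K d
      (fun c => sampleInput S U 2 i c) (fun c => sampleInput S U 2 j c) : ℤ) : ℝ) =
      ∑ T ∈ smallSets d K, firstSum N (chi T) U ^ 2 := by
  have h1 : ∀ i ∈ Finset.range N, ∀ j ∈ Finset.range N, (Cmd.kernelVal K d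
      (fun c => sampleInput S U 2 i c) (fun c => sampleInput S U 2 j c) : ℝ) =
      ∑ T ∈ smallSets d K, (if h : i < n then chi T (U ⟨i, h⟩) else 0) *
        (if h : j < n then chi T (U ⟨j, h⟩) else 0) := by
    intro i hi j hj
    have hi' := (Finset.mem_range.1 hi).trans_le hN
    have hj' := (Finset.mem_range.1 hj).trans_le hN
    rw [Cmd.kernelVal_eq K (x := U ⟨i, hi'⟩) (y := U ⟨j, hj'⟩)
      (fun c => sampleInput_two S U hi' c.2) (fun c => sampleInput_two S U hj' c.2)]
    simp [hi', hj']
  have h2 : ∀ T, ∑ i ∈ Finset.range N, (if h : i < n then chi T (U ⟨i, h⟩) else 0) =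
      firstSum N (chi T) U := fun T =>
    sum_range_eq_firstSum hN (chi T) U (G := fun i => if h : i < n then chi T (U ⟨i, h⟩) else 0)
      fun i _ => by simp
  push_cast
  rw [Finset.sum_congr rfl fun i hi => Finset.sum_congr rfl fun j hj => h1 i hi j hj]
  simp only [← h2, pow_two, Finset.sum_mul_sum]
  symm
  rw [Finset.sum_comm]
  exact Finset.sum_congr rfl fun i _ => Finset.sum_comm

theorem sum_kernelVal_predict {N K : ℕ} (hN : N ≤ m) (x : Cube d) :
    ((∑ i ∈ Finset.range N, sampleInput S U 1 i 0 * Cmd.kernelVal K d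
      (fun c => sampleInput S U 0 i c) (fun c => pointInput x 0 0 c) : ℤ) : ℝ) =
      ∑ T ∈ smallSets d K, firstSum N (fun z => (sgn z.2 : ℝ) * chi T z.1) S * chi T x := by
  have h1 : ∀ i ∈ Finset.range N, ((sampleInput S U 1 i 0 : ℤ) : ℝ) * (Cmd.kernelVal K d
      (fun c => sampleInput S U 0 i c) (fun c => pointInput x 0 0 c) : ℝ) =
      ∑ T ∈ smallSets d K, (if h : i < m then (sgn (S ⟨i, h⟩).2 : ℝ) * chi T (S ⟨i, h⟩).1 else 0)
        * chi T x := by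
    intro i hi
    have hi' := (Finset.mem_range.1 hi).trans_le hN
    rw [Cmd.kernelVal_eq K (x := (S ⟨i, hi'⟩).1) (y := x)
      (fun c => sampleInput_zero S U hi' c.2) (fun c => pointInput_zero x c.2),
      sampleInput_one S U hi', Finset.mul_sum]
    simp [hi', mul_assoc]
  have h2 : ∀ T, ∑ i ∈ Finset.range N,
      (if h : i < m then (sgn (S ⟨i, h⟩).2 : ℝ) * chi T (S ⟨i, h⟩).1 else 0) =
      firstSum N (fun z => (sgn z.2 : ℝ) * chi T z.1) S := fun T =>
    sum_range_eq_firstSum hN (fun z => (sgn z.2 : ℝ) * chi T z.1) S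
      (G := fun i => if h : i < m then (sgn (S ⟨i, h⟩).2 : ℝ) * chi T (S ⟨i, h⟩).1 else 0)
      fun i _ => by simp
  push_cast
  rw [Finset.sum_congr rfl h1, Finset.sum_comm]
  simp only [← h2, Finset.sum_mul]

end

/-- The low-degree learner. -/
def lowDegLearner : Learner := ⟨Cmd.learnCmd, Cmd.predictCmd⟩

open Cmd in
/-- A bound for the number of steps of the learner. -/
def learnerTime (d s l E : ℕ) : ℕ :=
  6 * logParam s E + 5 * l * (512 * logParam s E + 10) +
    10 * degParam s l E + 6 * Nat.clog 2 (d + 1) +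
    degParam s l E * (64 * Nat.clog 2 (d + 1) + 6) + 90 +
  (2 ^ (6 * expParam d s l E) * (10 * d + 16) + 7) +
  (2 ^ (6 * expParam d s l E) * (2 ^ (6 * expParam d s l E) *
    ((d + 1) * (15 * (2 * degParam s l E) + 19) + 14 * (2 * degParam s l E) + 17) + 10) + 15) + 2 +
  (2 ^ (6 * expParam d s l E) * ((d + 1) * (15 * degParam s l E + 21) +
    14 * degParam s l E + 24) + 11)

open Cmd in
-- This summarizes everything that is needed about the programs. They use only the first `2^(6
-- expParam)` examples of each sample, so the time bound does not depend on `m` and `n`.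
theorem lowDegLearner_spec {d s l E m n t : ℕ} (hs : 1 ≤ s) (ht : learnerTime d s l E ≤ t)
    (hm : 2 ^ (6 * expParam d s l E) ≤ m) (hn : 2 ^ (6 * expParam d s l E) ≤ n)
    (S : Fin m → Cube d × Bool) (U : Fin n → Cube d) :
    HaltsWithin (sampleInput S U) lowDegLearner.learn (initState [d, s, l, E]) t ∧
    (∀ x : Cube d, HaltsWithin (pointInput x) lowDegLearner.predict
      (lowDegLearner.learned [d, s, l, E] S U t) t) ∧
    (lowDegLearner.Accepts [d, s, l, E] S U t ↔
      ∑ T ∈ smallSets d (2 * degParam s l E),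
        firstSum (2 ^ (6 * expParam d s l E)) (chi T) U ^ 2 ≤
          2 ^ (12 * expParam d s l E) + 2 ^ (10 * expParam d s l E)) ∧
    ∀ x : Cube d, lowDegLearner.hypothesis [d, s, l, E] S U t x = true ↔
      0 < ∑ T ∈ smallSets d (degParam s l E), firstSum (2 ^ (6 * expParam d s l E))
        (fun z => (sgn z.2 : ℝ) * chi T z.1) S * chi T x := by
  unfold learnerTime at ht
  set N := 2 ^ (6 * expParam d s l E) with hN
  set k := degParam s l E with hk
  set I := sampleInput S U with hI
  have hlearn : Wp I learnCmd t (fun τ => τ.reg 4 = 1 ∧ τ.reg 5 = 0 ∧ τ.reg 6 = d ∧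
      τ.reg 9 = k ∧ τ.reg 12 = N ∧ (∀ a < N * (d + 1), τ.mem a = storedAt I d a) ∧
      (0 < τ.reg 0 ↔ ∑ i ∈ Finset.range N, ∑ j ∈ Finset.range N,
          kernelVal (2 * k) d (fun c => I 2 i c) (fun c => I 2 j c) ≤
            2 ^ (12 * expParam d s l E) + 2 ^ (10 * expParam d s l E)))
      (initState [d, s, l, E]) := by
    refine (wp_seq_of (wp_paramCmd (d := d) (l := l) (E := E) hs)
      (t₂ := (N * (10 * d + 16) + 7) + (N * (N * ((d + 1) * (15 * (2 * k) + 19) +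
        14 * (2 * k) + 17) + 10) + 15) + 1) ?_).mono (by rw [hk] at ht ⊢; omega)
    rintro τ ⟨t4, t5, t6, t7, t9, t12, t13, t14⟩
    refine wp_seq_of (wp_storeCmd t4 t5 t6 t12) ?_
    rintro ρ ⟨hA, hmem⟩
    have r4 := (hA 4 (by norm_num)).trans t4
    have r5 := (hA 5 (by norm_num)).trans t5
    have r6 := (hA 6 (by norm_num)).trans t6
    have r7 := (hA 7 (by norm_num)).trans t7
    have r9 := (hA 9 (by norm_num)).trans t9
    have r12 := (hA 12 (by norm_num)).trans t12
    have r13 := (hA 13 (by norm_num)).trans t13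
    have r14 := (hA 14 (by norm_num)).trans t14
    refine (wp_testCmd r4 r5 r6 r12 r7 fun i hi c hc => ?_).imp ?_
    · rw [hI, sampleInput_two S U (hi.trans_le hn) hc]
      exact sgn_eq_or _
    · rintro π ⟨hB, hB', h0⟩
      refine ⟨(hB 4 (by norm_num) (by norm_num)).trans r4,
        (hB 5 (by norm_num) (by norm_num)).trans r5, (hB 6 (by norm_num) (by norm_num)).trans r6,
        (hB 9 (by norm_num) (by norm_num)).trans r9,
        (hB 12 (by norm_num) (by norm_num)).trans r12, fun a ha => ?_, ?_⟩
      · rw [hB' _ (Int.natCast_nonneg _), hmem a ha]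
      · rw [h0, r13, r14]
  obtain ⟨τ, ⟨t4, t5, t6, t9, t12, hmem, hacc⟩, hrun⟩ := hlearn.run
  have hst : lowDegLearner.learned [d, s, l, E] S U t = τ := by
    rw [Learner.learned, lowDegLearner, hrun t le_rfl]
  have hpred : ∀ x : Cube d, Wp (pointInput x) predictCmd t (fun τ => τ.reg 0 =
      ∑ i ∈ Finset.range N, I 1 i 0 * kernelVal k d (fun c => I 0 i c)
        (fun c => pointInput x 0 0 c)) τ := by
    intro x
    refine (wp_predictCmd t4 t5 t6 t12 t9 hmem (fun i hi c hc => ?_) (fun i hi => ?_)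
      fun c hc => ?_).mono (by omega)
    · rw [hI, sampleInput_zero S U (hi.trans_le hm) hc]
      exact sgn_eq_or _
    · rw [hI, sampleInput_one S U (hi.trans_le hm)]
      exact sgn_eq_or _
    · rw [pointInput_zero x hc]
      exact sgn_eq_or _
  refine ⟨?_, fun x => ?_, ?_, fun x => ?_⟩
  · rw [HaltsWithin, lowDegLearner, hrun t le_rfl]
  · obtain ⟨ρ, -, hρ⟩ := (hpred x).run
    rw [HaltsWithin, hst, lowDegLearner, hρ t le_rfl]
  · rw [Learner.Accepts, hst, hacc, ← sum_kernelVal_test S U hn]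
    exact_mod_cast Iff.rfl
  · obtain ⟨ρ, h0, hρ⟩ := (hpred x).run
    rw [Learner.hypothesis, hst, lowDegLearner, hρ t le_rfl, decide_eq_true_iff,
      ← sum_kernelVal_predict S U hm, h0]
    exact_mod_cast Iff.rfl

/-! ## Size of the parameters -/

namespace Cmd

theorem two_pow_logParam_ge {s E : ℕ} : 8 * s * E ≤ 2 ^ logParam s E := by
  have h1 := Nat.le_pow_clog (b := 2) (by norm_num) s
  have h2 := Nat.le_pow_clog (b := 2) (by norm_num) E
  rw [logParam, pow_add, pow_add]
  norm_num
  gcongr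

theorem two_pow_clog_le {n : ℕ} (hn : 1 ≤ n) : 2 ^ Nat.clog 2 n ≤ 2 * n := by
  rcases hn.eq_or_lt with rfl | hn
  · simp
  have h := Nat.pow_pred_clog_lt_self (b := 2) (by norm_num) hn
  have h1 : 1 ≤ Nat.clog 2 n := Nat.clog_pos (by norm_num) hn
  obtain ⟨c, hc⟩ : ∃ c, Nat.clog 2 n = c + 1 := ⟨_, (Nat.succ_pred_eq_of_pos h1).symm⟩
  rw [hc] at h ⊢
  simp only [Nat.pred_eq_sub_one, Nat.add_sub_cancel] at h
  rw [pow_succ]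
  omega

theorem three_le_logParam (s E : ℕ) : 3 ≤ logParam s E := by unfold logParam; omega

theorem logParam_pow_le {s l E : ℕ} (hs : 1 ≤ s) :
    (128 * logParam s E) ^ (5 * l) ≤ degParam s l E ^ 2 :=
  (Nat.le_mul_of_pos_left _ hs).trans le_ceilSqrt_sq

/-- For `l ≥ 1` the exponent `5l` is at least `4`. So the degree dominates the logarithmic parameter
and exceeds an absolute constant, which absorbs all constants in the running time. -/
theorem sq_le_degParam {s l E : ℕ} (hs : 1 ≤ s) (hl : 1 ≤ l) :
    (128 * logParam s E) ^ 2 ≤ degParam s l E := by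
  have h3 := three_le_logParam s E
  have h1 : (128 * logParam s E) ^ (2 * 2) ≤ degParam s l E ^ 2 :=
    (Nat.pow_le_pow_right (by omega) (by omega)).trans (logParam_pow_le hs)
  rw [pow_mul] at h1
  exact (Nat.pow_le_pow_iff_left (by norm_num)).1 h1

theorem logParam_le_degParam {s l E : ℕ} (hs : 1 ≤ s) (hl : 1 ≤ l) :
    logParam s E ≤ degParam s l E := by
  have := sq_le_degParam (E := E) hs hl
  nlinarith [three_le_logParam s E]

theorem le_degParam {s l E : ℕ} (hs : 1 ≤ s) (hl : 1 ≤ l) : 100000 ≤ degParam s l E := by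
  have := sq_le_degParam (E := E) hs hl
  nlinarith [three_le_logParam s E]

/-- Computing the degree takes a number of rounds proportional to `l`, so the depth itself has to be
bounded by the time allowed. -/
theorem depth_le_degParam_sq {s l E : ℕ} (hs : 1 ≤ s) : l ≤ degParam s l E ^ 2 := by
  refine le_trans ?_ (logParam_pow_le (E := E) hs)
  have h3 := three_le_logParam s E
  calc l ≤ 2 ^ l := Nat.lt_two_pow_self.le
    _ ≤ (128 * logParam s E) ^ l := Nat.pow_le_pow_left (by omega) l
    _ ≤ _ := Nat.pow_le_pow_right (by omega) (by omega)

theorem clog_succ_pos {d : ℕ} (hd : 2 ≤ d) : 1 ≤ Nat.clog 2 (d + 1) :=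
  Nat.clog_pos (by norm_num) (by omega)

theorem two_pow_degParam_le {d s l E : ℕ} (hd : 2 ≤ d) :
    2 ^ degParam s l E ≤ 2 ^ expParam d s l E :=
  Nat.pow_le_pow_right (by norm_num) (Nat.le_mul_of_pos_left _ (clog_succ_pos hd))

theorem degParam_le {d s l E : ℕ} (hd : 2 ≤ d) : degParam s l E ≤ 2 ^ expParam d s l E :=
  Nat.lt_two_pow_self.le.trans (two_pow_degParam_le hd)

theorem clog_le_two_pow {d s l E : ℕ} (hs : 1 ≤ s) (hl : 1 ≤ l) :
    2 ^ Nat.clog 2 (d + 1) ≤ 2 ^ expParam d s l E := by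
  have := le_degParam (E := E) hs hl
  exact Nat.pow_le_pow_right (by norm_num) (Nat.le_mul_of_pos_right _ (by omega))

theorem card_smallSets_le_two_pow (d s l E c : ℕ) :
    (smallSets d (c * degParam s l E)).card ≤ (2 ^ expParam d s l E) ^ c := by
  refine (card_smallSets_le _ _).trans ?_
  refine (Nat.pow_le_pow_left (Nat.le_pow_clog (b := 2) (by norm_num) _) _).trans (le_of_eq ?_)
  rw [expParam, ← pow_mul, ← pow_mul, mul_comm c, mul_assoc]

end Cmd

-- With `X = 2^expParam`, the dominant cost is that of the test: `X^12` pairs of examples, each with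
-- a table of size `O(d k)`, where `d, k ≤ X`. This gives `100000 X^14 ≤ X^15`.
open Cmd in
theorem learnerTime_le {d s l E : ℕ} (hd : 2 ≤ d) (hs : 1 ≤ s) (hl : 1 ≤ l) :
    learnerTime d s l E ≤ (2 ^ expParam d s l E) ^ 16 := by
  have hk := degParam_le (s := s) (l := l) (E := E) hd
  have ha := clog_le_two_pow (d := d) (E := E) hs hl
  have hX : 100000 ≤ 2 ^ expParam d s l E := (le_degParam hs hl).trans hk
  have hG := (logParam_le_degParam (E := E) hs hl).trans hk
  have hl2 : l ≤ (2 ^ expParam d s l E) ^ 2 :=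
    (depth_le_degParam_sq (E := E) hs).trans (Nat.pow_le_pow_left hk 2)
  have hd1 : d + 1 ≤ 2 ^ expParam d s l E := (Nat.le_pow_clog (by norm_num) _).trans ha
  have hd0 : d ≤ 2 ^ expParam d s l E := by omega
  have ha' : Nat.clog 2 (d + 1) ≤ 2 ^ expParam d s l E := Nat.lt_two_pow_self.le.trans ha
  unfold learnerTime
  rw [show 2 ^ (6 * expParam d s l E) = (2 ^ expParam d s l E) ^ 6 by rw [mul_comm, pow_mul]]
  generalize 2 ^ expParam d s l E = X at *
  generalize degParam s l E = k at *
  generalize logParam s E = G at *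
  generalize Nat.clog 2 (d + 1) = a at *
  have h1 : ∀ i ≤ 14, X ^ i ≤ X ^ 14 := fun i hi => Nat.pow_le_pow_right (by omega) hi
  have e0 := h1 0 (by norm_num)
  have e1 := h1 1 (by norm_num)
  have e2 := h1 2 (by norm_num)
  have e3 := h1 3 (by norm_num)
  have e6 := h1 6 (by norm_num)
  have e7 := h1 7 (by norm_num)
  have e8 := h1 8 (by norm_num)
  have e12 := h1 12 (by norm_num)
  have e13 := h1 13 (by norm_num)
  rw [pow_zero] at e0
  rw [pow_one] at e1
  calc _ ≤ 6 * X + 5 * X ^ 2 * (512 * X + 10) + 10 * X + 6 * X + X * (64 * X + 6) + 90 +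
        (X ^ 6 * (10 * X + 16) + 7) +
        (X ^ 6 * (X ^ 6 * (X * (15 * (2 * X) + 19) + 14 * (2 * X) + 17) + 10) + 15) + 2 +
        (X ^ 6 * (X * (15 * X + 21) + 14 * X + 24) + 11) := by gcongr
    _ ≤ 100000 * X ^ 14 := by ring_nf at *; omega
    _ ≤ X * X ^ 14 := Nat.mul_le_mul_right _ hX
    _ = X ^ 15 := by ring
    _ ≤ X ^ 16 := Nat.pow_le_pow_right (by omega) (by norm_num)

-- Rounding `d + 1` up to a power of two gives at most `2 (d + 1) ≤ d³` for `d ≥ 2`, whence `48 = 3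
-- · 16`.
open Cmd in
theorem two_pow_expParam_le {d s l E : ℕ} (hd : 2 ≤ d) :
    (2 ^ expParam d s l E) ^ 16 ≤ d ^ (48 * degParam s l E) := by
  have h1 := two_pow_clog_le (n := d + 1) (by omega)
  have h2 : 2 * (d + 1) ≤ d ^ 3 := by
    have : 2 * 2 * d ≤ d * d * d := by gcongr
    rw [pow_succ, pow_two]
    omega
  calc (2 ^ expParam d s l E) ^ 16
      = (2 ^ Nat.clog 2 (d + 1)) ^ (16 * degParam s l E) := by
        rw [expParam, ← pow_mul, ← pow_mul]; congr 1; ring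
    _ ≤ (d ^ 3) ^ (16 * degParam s l E) := Nat.pow_le_pow_left (h1.trans h2) _
    _ = _ := by rw [← pow_mul]; congr 1; ring

/-! ### Comparison of the integer degree with the real exponent of the time bound. -/

theorem sqrt_pow_eq {x : ℝ} (hx : 0 ≤ x) (n : ℕ) : √(x ^ n) = √x ^ n := by
  induction n with
  | zero => simp
  | succ n ih => rw [pow_succ, pow_succ, Real.sqrt_mul (by positivity), ih]

theorem sqrt_sqParam (s l E : ℕ) : √(Cmd.sqParam s l E : ℝ) =
    √(s : ℝ) * √((128 * (Cmd.logParam s E : ℝ)) ^ 5) ^ l := by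
  rw [Cmd.sqParam, ← sqrt_pow_eq (by positivity), ← Real.sqrt_mul (by positivity), ← pow_mul]
  push_cast
  rfl

theorem degParam_le_sqrt {s l E : ℕ} (hs : 1 ≤ s) :
    (Cmd.degParam s l E : ℝ) ≤ 2 * (√(s : ℝ) * √((128 * (Cmd.logParam s E : ℝ)) ^ 5) ^ l) := by
  rw [← sqrt_sqParam]
  have h1 := Cmd.one_le_sqParam (l := l) (E := E) hs
  have h2 : (1 : ℝ) ≤ √(Cmd.sqParam s l E : ℝ) := Real.one_le_sqrt.2 (by exact_mod_cast h1)
  have h3 : (Nat.sqrt (Cmd.sqParam s l E - 1) : ℝ) ≤ √(Cmd.sqParam s l E : ℝ) :=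
    Real.nat_sqrt_le_real_sqrt.trans (Real.sqrt_le_sqrt (by exact_mod_cast Nat.sub_le _ _))
  rw [Cmd.degParam, Cmd.ceilSqrt]
  push_cast
  linarith

theorem sqrt_le_degParam (s l E : ℕ) :
    √(s : ℝ) * √((128 * (Cmd.logParam s E : ℝ)) ^ 5) ^ l ≤ Cmd.degParam s l E := by
  rw [← sqrt_sqParam]
  refine Real.sqrt_le_iff.2 ⟨Nat.cast_nonneg _, ?_⟩
  exact_mod_cast Cmd.le_ceilSqrt_sq

theorem ceil_one_div_le {ε : ℝ} (h0 : 0 < ε) (h1 : ε < 1) : (⌈1 / ε⌉₊ : ℝ) ≤ 2 / ε := by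
  have h2 := (Nat.ceil_lt_add_one (show 0 ≤ 1 / ε by positivity)).le
  have h3 : 1 ≤ 1 / ε := by rw [le_div_iff₀ h0]; linarith
  have h4 : 2 / ε = 1 / ε + 1 / ε := by ring
  linarith

/-- All roundings together cost a factor `2^6`, and `2^6 ≤ (s/ε)^6`. Thus `logParam` is at most `7
log(s/ε) / log 2`. -/
theorem logParam_le_log {s : ℕ} {ε : ℝ} (hs : 1 ≤ s) (h0 : 0 < ε) (h1 : ε < 1)
    (h2 : 2 * ε ≤ s) :
    1024 * (Cmd.logParam s ⌈1 / ε⌉₊ : ℝ) ≤ 20000 * Real.log (s / ε) := by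
  have hE : 1 ≤ ⌈1 / ε⌉₊ := Nat.one_le_iff_ne_zero.2 (Nat.ceil_pos.2 (by positivity)).ne'
  have h3 : 2 ≤ (s : ℝ) / ε := by rw [le_div_iff₀ h0]; exact h2
  have h4 : (2 : ℝ) ^ Cmd.logParam s ⌈1 / ε⌉₊ ≤ ((s : ℝ) / ε) ^ 7 := by
    have a1 : (2 : ℝ) ^ Nat.clog 2 s ≤ 2 * s := by exact_mod_cast Cmd.two_pow_clog_le hs
    have a2 : (2 : ℝ) ^ Nat.clog 2 ⌈1 / ε⌉₊ ≤ 2 * ⌈1 / ε⌉₊ := by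
      exact_mod_cast Cmd.two_pow_clog_le hE
    have a3 := ceil_one_div_le h0 h1
    rw [Cmd.logParam, pow_add, pow_add]
    calc (2 : ℝ) ^ 3 * 2 ^ Nat.clog 2 s * 2 ^ Nat.clog 2 ⌈1 / ε⌉₊
        ≤ 2 ^ 3 * (2 * s) * (2 * (2 / ε)) := by
          gcongr
          exact a2.trans (by linarith)
      _ = 2 ^ 6 * ((s : ℝ) / ε) := by ring
      _ ≤ ((s : ℝ) / ε) ^ 6 * ((s : ℝ) / ε) := by gcongr
      _ = _ := by ring
  have h5 := Real.log_le_log (by positivity) h4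
  rw [Real.log_pow, Real.log_pow] at h5
  push_cast at h5
  have h6 := Real.log_two_gt_d9
  have h7 : Real.log 2 ≤ Real.log (s / ε) := Real.log_le_log (by norm_num) h3
  have h8 : (0 : ℝ) ≤ Cmd.logParam s ⌈1 / ε⌉₊ := Nat.cast_nonneg _
  nlinarith

theorem learnerTime_le_floor {d s l : ℕ} {ε : ℝ} (hd : 2 ≤ d) (hs : 1 ≤ s) (hl : 1 ≤ l)
    (h0 : 0 < ε) (h1 : ε < 1) (h2 : 2 * ε ≤ s) :
    (2 ^ Cmd.expParam d s l ⌈1 / ε⌉₊) ^ 16 ≤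
      ⌊(d : ℝ) ^ (√(s : ℝ) * (20000 * Real.log ((s : ℝ) / ε)) ^ (5 * (l : ℝ) / 2))⌋₊ := by
  have hG := logParam_le_log hs h0 h1 h2
  have hz : 0 ≤ 20000 * Real.log ((s : ℝ) / ε) := le_trans (by positivity) hG
  refine (two_pow_expParam_le hd).trans (Nat.le_floor ?_)
  push_cast
  rw [← Real.rpow_natCast]
  refine Real.rpow_le_rpow_of_exponent_le (by exact_mod_cast (by omega : 1 ≤ d)) ?_
  rw [rpow_five_halves hz]
  have h3 := degParam_le_sqrt (l := l) (E := ⌈1 / ε⌉₊) hs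
  have hG0 : (0 : ℝ) ≤ Cmd.logParam s ⌈1 / ε⌉₊ := Nat.cast_nonneg _
  generalize (Cmd.logParam s ⌈1 / ε⌉₊ : ℝ) = G at *
  -- The constant `96 = 48 · 2` in the exponent is moved into the factor of one gate, which is
  -- possible since `l ≥ 1`; under the fifth power it costs only a factor `8`, as `96² ≤ 8^5`.
  have h4 : 96 * √((128 * G) ^ 5) ≤ √((20000 * Real.log ((s : ℝ) / ε)) ^ 5) := by
    refine Real.le_sqrt_of_sq_le ?_
    rw [mul_pow, Real.sq_sqrt (by positivity)]
    calc 96 ^ 2 * (128 * G) ^ 5 ≤ 8 ^ 5 * (128 * G) ^ 5 := by gcongr; norm_num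
      _ = (1024 * G) ^ 5 := by ring
      _ ≤ _ := by gcongr
  have h5 : (96 : ℝ) ≤ 96 ^ l := le_self_pow₀ (by norm_num) (by omega)
  push_cast
  calc 48 * (Cmd.degParam s l ⌈1 / ε⌉₊ : ℝ) ≤ √(s : ℝ) * (96 * √((128 * G) ^ 5) ^ l) := by linarith
    _ ≤ √(s : ℝ) * (96 ^ l * √((128 * G) ^ 5) ^ l) := by gcongr
    _ = √(s : ℝ) * (96 * √((128 * G) ^ 5)) ^ l := by rw [mul_pow 96]
    _ ≤ _ := by gcongr

/-! ## The theorem -/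

section

variable {d s l : ℕ} {ε : ℝ}

theorem ceil_le_two_pow (hd : 2 ≤ d) (hs : 1 ≤ s) (hl : 1 ≤ l) :
    ⌈1 / ε⌉₊ ≤ 2 ^ Cmd.expParam d s l ⌈1 / ε⌉₊ := by
  calc ⌈1 / ε⌉₊ ≤ 8 * s * ⌈1 / ε⌉₊ := Nat.le_mul_of_pos_left _ (by omega)
    _ ≤ 2 ^ Cmd.logParam s ⌈1 / ε⌉₊ := Cmd.two_pow_logParam_ge
    _ ≤ 2 ^ Cmd.degParam s l ⌈1 / ε⌉₊ :=
        Nat.pow_le_pow_right (by norm_num) (Cmd.logParam_le_degParam hs hl)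
    _ ≤ _ := Cmd.two_pow_degParam_le hd

theorem exists_approximation (hs : 1 ≤ s) {E : ℕ} (hE : 1 ≤ E) {f : Cube d → Bool}
    (hf : f ∈ formulaClass d s l) :
    ∃ p : Finset (Fin d) → ℝ, ∀ x,
      |∑ S ∈ smallSets d (Cmd.degParam s l E), p S * chi S x - sgn (f x)| ≤ 1 / (8 * E) := by
  have hG := Cmd.three_le_logParam s E
  have hG' : (3 : ℝ) ≤ Cmd.logParam s E := by exact_mod_cast hG
  -- Then `2^(2^n) ≥ (8sE)^20`, which covers the budget `16 E s^20` for the error `1/(8E)`, and `2^n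
  -- ≤ 40 G` with `G` the value of `logParam`. The constant `128 = (16/5) · 40` in `sqParam` comes
  -- from `gate_factor_le`.
  obtain ⟨n, hn1, hn2⟩ := exists_two_pow_near (y := 20 * (Cmd.logParam s E : ℝ)) (by linarith)
  have hn1' : 20 * Cmd.logParam s E ≤ 2 ^ n := by exact_mod_cast hn1
  have h1 : 16 * E * s ^ 20 ≤ 2 ^ (2 ^ n) := by
    calc 16 * E * s ^ 20 ≤ 8 ^ 20 * E ^ 20 * s ^ 20 := by
          gcongr
          · norm_num
          · exact Nat.le_self_pow (by norm_num) E
      _ = (8 * s * E) ^ 20 := by ring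
      _ ≤ (2 ^ Cmd.logParam s E) ^ 20 := Nat.pow_le_pow_left Cmd.two_pow_logParam_ge 20
      _ = 2 ^ (20 * Cmd.logParam s E) := by rw [← pow_mul, mul_comm]
      _ ≤ 2 ^ (2 ^ n) := Nat.pow_le_pow_right (by norm_num) hn1'
  have hE0 : (0 : ℝ) < E := by exact_mod_cast hE
  have h2 : 2 * (s : ℝ) ^ 20 ≤ 1 / (8 * E) * 2 ^ (2 ^ n) := by
    have h3 : (16 : ℝ) * E * s ^ 20 ≤ 2 ^ (2 ^ n) := by exact_mod_cast h1
    rw [one_div_mul_eq_div, le_div_iff₀ (by positivity)]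
    linarith
  obtain ⟨k, p, hp, hk, hc⟩ := exists_lowDeg_of_mem_formulaClass hs hf h2
  have hk' : k ≤ Cmd.degParam s l E := by
    have h4 := gate_factor_le hn2
    rw [show 16 / 5 * (2 * (20 * (Cmd.logParam s E : ℝ))) = 128 * Cmd.logParam s E by ring] at h4
    have h5 : (k : ℝ) ≤ Cmd.degParam s l E :=
      (hk.trans (by gcongr)).trans (sqrt_le_degParam s l E)
    exact_mod_cast h5
  obtain ⟨c, hc'⟩ := exists_coeff_of_mem_lowDeg (lowDeg_mono hk' hp)
  exact ⟨c, fun x => by rw [← hc']; exact hc x⟩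

theorem exists_optCommon (hl : 1 ≤ l) (P Q : Measure (Cube d × Bool)) :
    ∃ f ∈ formulaClass d s l, optCommon (formulaClass d s l) P Q = err f P + err f Q := by
  have hne : Nonempty (formulaClass d s l) :=
    -- The empty conjunction has size `0` and depth `1`, so the class is nonempty.
    ⟨⟨fun x => (BoolFormula.and 0 fun i => i.elim0 : BoolFormula d).eval x,
      _, by simp [BoolFormula.size], by simpa [BoolFormula.depth] using hl, fun _ => rfl⟩⟩
  obtain ⟨f, hf⟩ := exists_eq_ciInf_of_finite (f := fun f : formulaClass d s l =>
    err f.1 P + err f.1 Q)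
  exact ⟨f.1, f.2, hf.symm⟩

end

open Cmd in
theorem lowDegLearner_tdsLearns {d s l : ℕ} {ε : ℝ} (hd : 2 ≤ d) (hs : 1 ≤ s) (hl : 1 ≤ l)
    (h0 : 0 < ε) {t : ℕ}
    (ht : (2 ^ expParam d s l ⌈1 / ε⌉₊) ^ 16 ≤ t) :
    lowDegLearner.TDSLearns [d, s, l, ⌈1 / ε⌉₊] (formulaClass d s l) (uniformCube d)
      (fun lam => 32 * lam) (13 * ε) (1 / 10) t := by
  set E := ⌈1 / ε⌉₊ with hEdef
  have hE : 1 ≤ E := Nat.one_le_iff_ne_zero.2 (Nat.ceil_pos.2 (by positivity)).ne'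
  have hE0 : (1 : ℝ) ≤ E := by exact_mod_cast hE
  have hEε : 1 / (E : ℝ) ≤ ε := by
    rw [div_le_comm₀ (by linarith) h0]
    exact Nat.le_ceil _
  have hX1 : 100000 ≤ 2 ^ expParam d s l E := (le_degParam hs hl).trans (degParam_le hd)
  have hEX : E ≤ 2 ^ expParam d s l E := ceil_le_two_pow hd hs hl
  have hN : 2 ^ (6 * expParam d s l E) = (2 ^ expParam d s l E) ^ 6 := by rw [mul_comm, pow_mul]
  have hJ1 : (smallSets d (degParam s l E)).card ≤ 2 ^ expParam d s l E := by
    simpa using card_smallSets_le_two_pow d s l E 1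
  have hJ2 := card_smallSets_le_two_pow d s l E 2
  have h12 : (2 : ℝ) ^ (12 * expParam d s l E) = (2 ^ expParam d s l E) ^ 12 := by
    rw [mul_comm, pow_mul]
  have h10 : (2 : ℝ) ^ (10 * expParam d s l E) = (2 ^ expParam d s l E) ^ 10 := by
    rw [mul_comm, pow_mul]
  refine ⟨2 ^ (6 * expParam d s l E), ?_, fun m n hm hn => ?_⟩
  · rw [hN]
    exact (Nat.pow_le_pow_right (by omega) (by norm_num)).trans ht
  have hspec := fun (S : Fin m → Cube d × Bool) (U : Fin n → Cube d) =>
    lowDegLearner_spec hs ((learnerTime_le hd hs hl).trans ht) hm hn S U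
  refine ⟨fun S U => ⟨(hspec S U).1, fun _ => (hspec S U).2.1⟩, fun P Q hPp hQp hP => ?_⟩
  have hQ' : IsProbabilityMeasure (Q.map Prod.fst) :=
    Measure.isProbabilityMeasure_map measurable_fst.aemeasurable
  set k := degParam s l E with hk
  set N := 2 ^ (6 * expParam d s l E) with hNdef
  have hNX : (N : ℝ) = ((2 ^ expParam d s l E : ℕ) : ℝ) ^ 6 := by rw [hN]; push_cast; rfl
  have hXr : ((2 : ℝ) ^ expParam d s l E) = ((2 ^ expParam d s l E : ℕ) : ℝ) := by push_cast; rfl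
  rw [hXr] at h12 h10
  set X := 2 ^ expParam d s l E with hXdef
  have hXr0 : (100000 : ℝ) ≤ X := by exact_mod_cast hX1
  have hXpos : (0 : ℝ) < X := by linarith
  have hN0 : 0 < N := by positivity
  have hNpos : (0 : ℝ) < N := by exact_mod_cast hN0
  have hEX' : (E : ℝ) ≤ X := by exact_mod_cast hEX
  have hJ1' : ((smallSets d k).card : ℝ) ≤ X := by exact_mod_cast hJ1
  have hJ2' : ((smallSets d (2 * k)).card : ℝ) ≤ (X : ℝ) ^ 2 := by exact_mod_cast hJ2
  -- The coefficients are estimated up to a total squared error `1/E ≤ ε`.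
  have hA := measure_deviation_le P hm hN0 (smallSets d k)
    (fun T z => (sgn z.2 : ℝ) * chi T z.1) (fun T z => by
      rw [abs_mul, abs_chi, mul_one]; rcases sgn_eq_or z.2 with h | h <;> simp [h])
    (η := 1 / E) (by positivity)
  -- The empirical moments differ from those of `Q` by a total squared error of at most `1/X²`. This
  -- one event serves for soundness and for completeness.
  have hB := measure_deviation_le (Q.map Prod.fst) hn hN0 (smallSets d (2 * k))
    (fun T x => chi T x) (fun T x => (abs_chi T x).le) (η := 1 / X ^ 2) (by positivity)
  have hA' : ((smallSets d k).card : ℝ) / (N * (1 / E)) ≤ 1 / 20 := by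
    rw [div_le_iff₀ (by positivity), hNX]
    have h1 : ((smallSets d k).card : ℝ) * E ≤ X * X := by gcongr
    have h2 : 20 * ((X : ℝ) * X) ≤ X ^ 6 := by
      have : (20 : ℝ) ≤ X ^ 4 := by
        calc (20 : ℝ) ≤ X := by linarith
          _ ≤ X ^ 4 := le_self_pow₀ (by linarith) (by norm_num)
      calc 20 * ((X : ℝ) * X) ≤ X ^ 4 * (X * X) := by gcongr
        _ = X ^ 6 := by ring
    rw [show 1 / 20 * ((X : ℝ) ^ 6 * (1 / E)) = X ^ 6 / 20 / E by ring, le_div_iff₀ (by linarith)]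
    linarith
  have hB' : ((smallSets d (2 * k)).card : ℝ) / (N * (1 / X ^ 2)) ≤ 1 / 20 := by
    rw [div_le_iff₀ (by positivity), hNX]
    have h2 : 20 * (X : ℝ) ^ 2 ≤ X ^ 4 := by
      have : (20 : ℝ) ≤ X ^ 2 := by
        calc (20 : ℝ) ≤ X := by linarith
          _ ≤ X ^ 2 := le_self_pow₀ (by linarith) (by norm_num)
      calc 20 * (X : ℝ) ^ 2 ≤ (X : ℝ) ^ 2 * (X : ℝ) ^ 2 := by gcongr
        _ = (X : ℝ) ^ 4 := by ring
    have h3 : (X : ℝ) ^ 6 * (1 / X ^ 2) = X ^ 4 := by field_simp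
    rw [h3]
    linarith
  have hint : ∀ T : Finset (Fin d), ∫ x, chi T x ∂(Q.map Prod.fst) = ∫ z, chi T z.1 ∂Q := by
    intro T
    rw [integral_map measurable_fst.aemeasurable]
    exact (measurable_of_finite _).aestronglyMeasurable
  have hempty : ∅ ∈ smallSets d (2 * k) := by simp
  have hfirst : ∀ U : Fin n → Cube d, firstSum N (chi ∅) U = N := by
    intro U
    rw [← sum_range_eq_firstSum hn (chi ∅) U (G := fun _ => 1) fun i _ => by simp]
    simp
  -- The test in terms of averages.
  have htest : ∀ U : Fin n → Cube d, (∑ T ∈ smallSets d (2 * k), firstSum N (chi T) U ^ 2 ≤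
      2 ^ (12 * expParam d s l E) + 2 ^ (10 * expParam d s l E)) ↔
      ∑ T ∈ (smallSets d (2 * k)).erase ∅, (firstSum N (chi T) U / N) ^ 2 ≤ 1 / X ^ 2 := by
    intro U
    rw [← Finset.add_sum_erase _ _ hempty, hfirst, h12, h10, hNX]
    have h1 : ((X : ℝ) ^ 6) ^ 2 = X ^ 12 := by ring
    have h2 : ∑ T ∈ (smallSets d (2 * k)).erase ∅, (firstSum N (chi T) U / (X : ℝ) ^ 6) ^ 2 =
        (∑ T ∈ (smallSets d (2 * k)).erase ∅, firstSum N (chi T) U ^ 2) / X ^ 12 := by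
      rw [Finset.sum_div]
      exact Finset.sum_congr rfl fun T _ => by rw [div_pow, h1]
    rw [h2, h1, add_le_add_iff_left, div_le_div_iff₀ (by positivity) (by positivity), one_mul]
    rw [show (X : ℝ) ^ 12 = X ^ 10 * X ^ 2 by ring, mul_le_mul_iff_left₀ (by positivity)]
  have hη : (1 : ℝ) - 1 / 10 = 1 - (1 / 20 + 1 / 20) := by norm_num
  rw [hη]
  refine ⟨one_sub_le_prod_real _ _ (hA.trans hA') (hB.trans hB') ?_, fun hQD =>
    one_sub_le_prod_real _ _ (hA.trans hA') (hB.trans hB') ?_⟩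
  · rintro ⟨S, U⟩ hS hU hacc
    obtain ⟨f, hf, hopt⟩ := exists_optCommon (s := s) hl P Q
    obtain ⟨p, hp⟩ := exists_approximation hs hE hf
    have hacc' := (htest U).1 ((hspec S U).2.2.1.1 hacc)
    have hX0 : (0 : ℝ) < 1 / X := by positivity
    -- One `1/X` is the tolerance of the test and the other one the sampling error. As there are at
    -- most `X` sets of size at most `k`, the off-diagonal terms are bounded as required.
    have hmom : ∀ T ∈ smallSets d (2 * k), T ≠ ∅ → |∫ z, chi T z.1 ∂Q| ≤ 2 / X := by
      intro T hT hT0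
      have h1 : (firstSum N (chi T) U / N) ^ 2 ≤ (1 / X) ^ 2 := by
        rw [one_div_pow]
        exact (Finset.single_le_sum (f := fun T => (firstSum N (chi T) U / N) ^ 2)
          (fun _ _ => sq_nonneg _) (Finset.mem_erase.2 ⟨hT0, hT⟩)).trans hacc'
      have h2 : (firstSum N (chi T) U / N - ∫ x, chi T x ∂(Q.map Prod.fst)) ^ 2 ≤ (1 / X) ^ 2 := by
        rw [one_div_pow]
        exact (Finset.single_le_sum (f := fun T => (firstSum N (chi T) U / N -
          ∫ x, chi T x ∂(Q.map Prod.fst)) ^ 2) (fun _ _ => sq_nonneg _) hT).trans hU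
      have h3 := abs_le_of_sq_le_sq' h1 hX0.le
      have h4 := abs_le_of_sq_le_sq' h2 hX0.le
      rw [hint] at h4
      have h5 : (2 : ℝ) / X = 1 / X + 1 / X := by ring
      rw [abs_le, h5]
      constructor <;> linarith [h3.1, h3.2, h4.1, h4.2]
    have hmain := err_le_of_estimates (P := P) (Q := Q) hP (k := k) (f := f)
      (h := lowDegLearner.hypothesis [d, s, l, E] S U t) (δ := 1 / (8 * E)) (η := 1 / E)
      (τ := 2 / X) (p := p)
      (c := fun T => firstSum N (fun z => (sgn z.2 : ℝ) * chi T z.1) S / N)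
      (by positivity) ?_ (by positivity) hp hS ?_ hmom ?_
    -- The excess error is `8η + 40δ = 8/E + 5/E ≤ 13 ε`.
    · rw [hopt]
      refine hmain.trans ?_
      have : (40 : ℝ) * (1 / (8 * E)) = 5 * (1 / E) := by field_simp; norm_num
      rw [this]
      linarith
    · rw [div_le_div_iff₀ (by positivity) (by positivity)]
      linarith
    · rw [div_mul_eq_mul_div, div_le_iff₀ hXpos]
      linarith
    · intro x
      rw [(hspec S U).2.2.2 x]
      simp only [div_mul_eq_mul_div]
      rw [← Finset.sum_div, lt_div_iff₀ hNpos, zero_mul]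
  -- Under the uniform marginal all nonconstant characters have mean `0`, so the sampling error is
  -- itself the tested quantity, and the two tolerances coincide.
  · rintro ⟨S, U⟩ hS hU
    refine (hspec S U).2.2.1.2 ((htest U).2 (le_trans (Finset.sum_le_sum fun T hT => le_of_eq ?_)
      ((Finset.sum_le_sum_of_subset_of_nonneg (Finset.erase_subset ∅ (smallSets d (2 * k)))
        fun _ _ _ => sq_nonneg _).trans hU)))
    simp only
    rw [hQD, integral_chi_uniformCube, if_neg (Finset.ne_of_mem_erase hT), sub_zero]

theorem mainTheorem6 :
    ∃ C : ℝ, 0 < C ∧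
      (∀ (d s l : ℕ) (ε : ℝ), 0 < ε → 2 * ε ≤ (s : ℝ) →
        L2SandwichingDegreeLE (formulaClass d s l) (uniformCube d) ε
          (√(s : ℝ) * (C * Real.log ((s : ℝ) / ε)) ^ (5 * (l : ℝ) / 2))) ∧
      (∃ (A : Learner) (K : ℝ), 0 < K ∧
        ∀ (d s l : ℕ) (ε : ℝ), 2 ≤ d → 1 ≤ l → 0 < ε → ε < 1 → 2 * ε ≤ (s : ℝ) →
          A.TDSLearns [d, s, l, ⌈1 / ε⌉₊] (formulaClass d s l) (uniformCube d)
            (fun lam => 32 * lam) (K * ε) (1 / 10)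
            ⌊(d : ℝ) ^ (√(s : ℝ) * (C * Real.log ((s : ℝ) / ε)) ^ (5 * (l : ℝ) / 2))⌋₊) := by
  refine ⟨20000, by norm_num,
    fun d s l ε h0 h2 => l2SandwichingDegreeLE_formulaClass (by norm_num) d s l h0 h2,
    lowDegLearner, 13, by norm_num, fun d s l ε hd hl h0 h1 h2 => ?_⟩
  have hs : 1 ≤ s := by
    have h : (0 : ℝ) < s := by linarith
    exact_mod_cast h
  exact lowDegLearner_tdsLearns hd hs hl h0 (learnerTime_le_floor hd hs hl h0 h1 h2)
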